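/- Let $d\ge 2$ and $k\ge 1$ be integers and let $c>0$. For a Lebesgue measurable set $\Omega\subset\mathbb{R}^d$ let $|\Omega|$ be its Lebesgue measure, let $$P(\Omega)=\sup\Big\{\int_\Omega \operatorname{div}\varphi\,dx:\ \varphi\in C^1_c(\mathbb{R}^d;\mathbb{R}^d),\ |\varphi|\le 1\Big\}$$ be its De Giorgi perimeter, and let $\widetilde H^1_0(\Omega)=\{u\in H^1(\mathbb{R}^d):\ u=0\text{ a.e. on }\mathbb{R}^d\setminus\Omega\}$. If $|\Omega|<\infty$, let $R_\Omega:L^2(\mathbb{R}^d)\to L^2(\mathbb{R}^d)$ be the compact, positive, self-adjoint operator that maps $f$ to the weak solution $u\in\widetilde H^1_0(\Omega)$ of $-\Delta u=f$, i.e. $\int\nabla u\cdot\nabla v\,dx=\int fv\,dx$ for all $v\in\widetilde H^1_0(\Omega)$; let $\Lambda_k(\Omega)\ge 0$ be the $k$-th largest eigenvalue of $R_\Omega$, counted with multiplicity, and let $\widetilde\lambda_k(\Omega)=1/\Lambda_k(\Omega)\in(0,\infty]$ (with $\widetilde\lambda_k(\Omega)=\infty$ if $\Lambda_k(\Omega)=0$).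 Then the problem $$\min\left\{\widetilde\lambda_k(\Omega):\ \Omega\subset\mathbb{R}^d\ \text{Lebesgue measurable},\ P(\Omega)=c,\ |\Omega|<\infty\right\}$$ has a solution. Moreover, every solution $\Omega$ is bounded up to a null set, i.e. there is $r>0$ such that $|\Omega\setminus B_r(0)|=0$. -/

import Mathlib

open scoped NNReal ENNReal ContDiff

namespace SpectralPerimeter

/-- The Euclidean space `ℝ^d`. -/
abbrev Space (d : ℕ) : Type := EuclideanSpace ℝ (Fin d)

/-- The real Hilbert space `L²(ℝ^d)`. -/
abbrev L2 (d : ℕ) : Type :=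
  MeasureTheory.Lp ℝ 2 (MeasureTheory.volume : MeasureTheory.Measure (Space d))

/-- The real Hilbert space `L²(ℝ^d; ℝ^d)` of square integrable vector fields. -/
abbrev L2Field (d : ℕ) : Type :=
  MeasureTheory.Lp (Space d) 2 (MeasureTheory.volume : MeasureTheory.Measure (Space d))

/-- `G` is the weak gradient of `u`: for every test function `φ ∈ C_c^∞(ℝ^d)` and every direction
`v`, one has `∫ u ∂_v φ = - ∫ (G · v) φ`. -/
def HasWeakGradient {d : ℕ} (u : L2 d) (G : L2Field d) : Prop :=
  ∀ φ : Space d → ℝ, ContDiff ℝ ∞ φ → HasCompactSupport φ → ∀ v : Space d,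
    ∫ x, u x * fderiv ℝ φ x v = - ∫ x, inner ℝ (G x) v * φ x

/-- The Sobolev space `H¹(ℝ^d)`: the square integrable functions that have a square integrable
weak gradient. -/
def H1 (d : ℕ) : Set (L2 d) := {u | ∃ G : L2Field d, HasWeakGradient u G}

/-- The Sobolev-like space `H̃¹₀(Ω)`: the functions of `H¹(ℝ^d)` vanishing almost everywhere on the
complement of `Ω`. -/
def H10 {d : ℕ} (Ω : Set (Space d)) : Set (L2 d) :=
  {u | u ∈ H1 d ∧ ∀ᵐ x, x ∉ Ω → u x = 0}

/-- `u = R_Ω f`: `u` is the weak solution of `-Δu = f`, `u ∈ H̃¹₀(Ω)`, that is `u ∈ H̃¹₀(Ω)` and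
`∫ ∇u · ∇v = ∫ f v` for every `v ∈ H̃¹₀(Ω)`. -/
def IsResolvent {d : ℕ} (Ω : Set (Space d)) (f u : L2 d) : Prop :=
  u ∈ H10 Ω ∧ ∃ G : L2Field d, HasWeakGradient u G ∧
    ∀ v ∈ H10 Ω, ∀ V : L2Field d, HasWeakGradient v V → inner ℝ G V = inner ℝ f v

/-- `f` belongs to the eigenspace `ker (R_Ω - μ)`. -/
def IsResolventEigenvector {d : ℕ} (Ω : Set (Space d)) (μ : ℝ) (f : L2 d) : Prop :=
  IsResolvent Ω f (μ • f)

/-- `Λ_k(Ω)`, the `k`-th largest eigenvalue of `R_Ω` counted with multiplicity, for `k ≥ 1`: the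
largest `Λ` such that there are `k` linearly independent eigenvectors of `R_Ω` whose eigenvalues are
at least `Λ`. If `R_Ω` has fewer than `k` positive eigenvalues (with multiplicity), the value
is `0`. -/
noncomputable def resolventEigenvalue {d : ℕ} (k : ℕ) (Ω : Set (Space d)) : ℝ≥0∞ :=
  ⨆ (Λ : ℝ≥0) (_ : ∃ f : Fin k → L2 d, LinearIndependent ℝ f ∧
    ∀ i, ∃ μ : ℝ, (Λ : ℝ) ≤ μ ∧ IsResolventEigenvector Ω μ (f i)), (Λ : ℝ≥0∞)

/-- `λ̃_k(Ω) = 1 / Λ_k(Ω)`, with value `∞` if `Λ_k(Ω) = 0`. -/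
noncomputable def eigenvalue {d : ℕ} (k : ℕ) (Ω : Set (Space d)) : ℝ≥0∞ :=
  (resolventEigenvalue k Ω)⁻¹

/-- The divergence of a differentiable vector field. -/
noncomputable def divergence {d : ℕ} (φ : Space d → Space d) (x : Space d) : ℝ :=
  ∑ i : Fin d, fderiv ℝ φ x (EuclideanSpace.single i 1) i

/-- The De Giorgi perimeter of `Ω`: the supremum of `∫_Ω div φ` over the vector fields
`φ ∈ C_c^1(ℝ^d; ℝ^d)` with `|φ| ≤ 1`. -/
noncomputable def perimeter {d : ℕ} (Ω : Set (Space d)) : ℝ≥0∞ :=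
  ⨆ (φ : Space d → Space d) (_ : ContDiff ℝ 1 φ ∧ HasCompactSupport φ ∧ ∀ x, ‖φ x‖ ≤ 1),
    ENNReal.ofReal (∫ x in Ω, divergence φ x)

/-- The Lebesgue measurable sets of perimeter `c` and finite measure. -/
def Admissible (d : ℕ) (c : ℝ) : Set (Set (Space d)) :=
  {Ω | MeasureTheory.NullMeasurableSet Ω ∧ perimeter Ω = ENNReal.ofReal c ∧
    MeasureTheory.volume Ω < ⊤}

/-- `Ω` solves `min {λ̃_k(Ω) : Ω measurable, P(Ω) = c, |Ω| < ∞}`. -/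
def IsSolution {d : ℕ} (k : ℕ) (c : ℝ) (Ω : Set (Space d)) : Prop :=
  Ω ∈ Admissible d c ∧ IsMinOn (eigenvalue k) (Admissible d c) Ω

/-- `Ω` is bounded as a measurable set, i.e. up to a set of Lebesgue measure zero. -/
def EssentiallyBounded {d : ℕ} (Ω : Set (Space d)) : Prop :=
  ∃ r : ℝ, MeasureTheory.volume (Ω \ Metric.ball 0 r) = 0

end SpectralPerimeter

namespace SpectralPerimeter

open MeasureTheory Filter Set Topology

variable {d : ℕ}

/-! Scaling removes the constraint. Under a dilation the perimeter and λ_k change by fixed powers of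
the factor, so a minimiser of λ_k + P, suitably rescaled, solves the problem with P = c. Conversely,
a solution with finite λ_k minimises λ_k + βP among its own subsets, for the β that balances the two
scaling laws. Existence therefore reduces to the penalised functional, and boundedness to a
regularity property of inner minimisers (`IsInnerMin`).

Eigenvalues are handled through the min-max principle: `HasTestSpace (gradientPairs Ω) k l`
expresses λ_k(Ω) ≤ l by a k-dimensional space with Rayleigh quotients at most l. The variational
argument then compares pairs (l, p) of real upper bounds for λ_k and P. The passage to and from the
resolvent eigenvalues is `eigenvalue_le_of_hasTestSpace` and `hasTestSpace_of_eigenvalue_le`.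

The analytic inequalities come from one observation: a function which moves little under small
translations is close to its averages over small balls. On a ball much larger than the support this
gives Faber-Krahn and isoperimetric inequalities with non-optimal constants. On shrinking balls it
turns weak convergence into strong convergence, both for H¹ functions and for sets of finite
perimeter. Inside a fixed ball the direct method thus gives minimisers (`exists_min_subset`).

The missing point is compactness in the whole space, and it rests on a density estimate
(`exists_density`). Compare Ω with Ω minus a ball. Cutting along a good sphere costs little
perimeter (`exists_cut`), and cutting off the eigenfunctions raises λ_k by a multiple of their mass
in a slightly larger ball (`IsEigenSystem.hasTestSpace_mul`). The isoperimetric inequality bounds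
the volume inside, and Caccioppoli with Faber-Krahn bounds the mass. De Giorgi's iteration then
shows that an inner minimiser with little volume in a ball of radius 3 has none in the concentric
unit ball.

Consequently a minimiser is covered by N balls of radius 6, where N depends only on bounds for l and
p and not on the ball containing the minimiser. If the centres are widely spread in a coordinate, a
pigeonhole argument finds an empty slab, and moving one side towards the other (`closeGap`) keeps
the bounds for λ_k and P. After finitely many moves the set fits into a ball of universal radius.
Enlarging the container beyond that radius does not lower the minimum, and since any competitor can
be truncated at small cost, this minimum is global. The same covering gives the boundedness of
solutions. -/

/-! ### Translation estimates for H¹ functions and BV sets -/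

/-- If the directional derivatives of the translates of `ψ` have integrals against `u` bounded by
`K`, then so have the increments of `ψ`. -/
lemma integral_mul_sub_translate_le {u : Space d → ℝ} (hu : LocallyIntegrable u)
    {ψ : Space d → ℝ} (hψ : ContDiff ℝ 1 ψ) (hc : HasCompactSupport ψ) (h : Space d) {K : ℝ}
    (hK : ∀ s : ℝ, -∫ x, u x * fderiv ℝ ψ (x - s • h) h ≤ K) :
    ∫ x, u x * ψ (x - h) ≤ (∫ x, u x * ψ x) + K := by
  have hcf : HasCompactSupport (fderiv ℝ ψ) := hc.fderiv (𝕜 := ℝ)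
  have hcont : Continuous (fderiv ℝ ψ) := hψ.continuous_fderiv one_ne_zero
  obtain ⟨C, hC⟩ := hcont.bounded_above_of_compact_support hcf
  obtain ⟨R, hR⟩ := hcf.isCompact.isBounded.subset_closedBall 0
  have key : ∀ s : ℝ, HasDerivAt (fun s : ℝ => ∫ x, u x * ψ (x - s • h))
      (∫ x, u x * -(fderiv ℝ ψ (x - s • h) h)) s := by
    intro s
    -- This ball contains the supports of all the shifted derivatives with parameter within distance
    -- 1 of s, so a multiple of |u| on it dominates the difference quotients.
    set A : Set (Space d) := Metric.closedBall 0 (R + (|s| + 1) * ‖h‖)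
    have hA : IntegrableOn u A := hu.integrableOn_isCompact (isCompact_closedBall _ _)
    have hint : ∀ t : ℝ, Integrable (fun x => u x * ψ (x - t • h)) := by
      intro t
      refine hu.integrable_smul_right_of_hasCompactSupport (g := fun x => ψ (x - t • h)) ?_ ?_
      · exact hψ.continuous.comp (continuous_id.sub continuous_const)
      · exact hc.comp_homeomorph (Homeomorph.subRight (t • h))
    refine (hasDerivAt_integral_of_dominated_loc_of_deriv_le (Metric.ball_mem_nhds s one_pos)
      (bound := A.indicator (fun x => ‖u x‖ * (C * ‖h‖))) (F := fun s x => u x * ψ (x - s • h))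
      (F' := fun s x => u x * -(fderiv ℝ ψ (x - s • h) h)) ?_ ?_ ?_ ?_ ?_ ?_).2
    · exact Eventually.of_forall fun t => (hint t).aestronglyMeasurable
    · exact hint s
    · refine hu.aestronglyMeasurable.mul (Continuous.aestronglyMeasurable ?_)
      fun_prop
    · refine Eventually.of_forall fun x t ht => ?_
      by_cases hx : x ∈ A
      · rw [indicator_of_mem hx, norm_mul, norm_neg]
        gcongr
        exact (ContinuousLinearMap.le_opNorm _ _).trans (by gcongr; exact hC _)
      · rw [indicator_of_notMem hx]
        have : fderiv ℝ ψ (x - t • h) = 0 := by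
          by_contra hne
          apply hx
          have h1 := hR (subset_tsupport _ (Function.mem_support.2 hne))
          rw [mem_closedBall_zero_iff] at h1 ⊢
          have ht' : |t| ≤ |s| + 1 := by
            rw [Metric.mem_ball, Real.dist_eq] at ht
            have := abs_sub_abs_le_abs_sub t s
            linarith
          calc ‖x‖ = ‖(x - t • h) + t • h‖ := by simp
            _ ≤ ‖x - t • h‖ + |t| * ‖h‖ := by
              grw [norm_add_le, norm_smul, Real.norm_eq_abs]
            _ ≤ _ := by gcongr
        simp [this]
    · refine IntegrableOn.integrable_indicator ?_ (Metric.isClosed_closedBall.measurableSet)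
      exact hA.norm.mul_const _
    · refine Eventually.of_forall fun x t ht => ?_
      have h1 : HasDerivAt (fun t : ℝ => x - t • h) (-h) t := by
        simpa using ((hasDerivAt_id t).smul_const h).const_sub x
      have h2 := ((hψ.differentiable one_ne_zero (x - t • h)).hasFDerivAt).comp_hasDerivAt t h1
      simpa using h2.const_mul (u x)
  have hd : Differentiable ℝ (fun s : ℝ => ∫ x, u x * ψ (x - s • h)) :=
    fun s => (key s).differentiableAt
  have := Convex.image_sub_le_mul_sub_of_deriv_le (D := Icc (0:ℝ) 1) (convex_Icc 0 1)
    hd.continuous.continuousOn hd.differentiableOn (C := K) (fun s _ => ?_) 0 (by simp) 1 (by simp)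
    zero_le_one
  · simp only [one_smul, zero_smul, sub_zero, mul_one] at this
    linarith
  · rw [(key s).deriv]
    simpa [integral_neg] using hK s

/-- The translation `f ↦ f (· - h)` of `L²(ℝ^d)`. -/
noncomputable def translate (h : Space d) : L2 d →ₗᵢ[ℝ] L2 d :=
  Lp.compMeasurePreservingₗᵢ ℝ (fun x => x - h) (measurePreserving_sub_right volume h)

lemma translate_ae (h : Space d) (f : L2 d) : translate h f =ᵐ[volume] fun x => f (x - h) :=
  Lp.coeFn_compMeasurePreserving f (measurePreserving_sub_right volume h)

lemma inner_eq_integral (f g : L2 d) : inner ℝ f g = ∫ x, f x * g x := by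
  rw [L2.inner_def]
  refine integral_congr_ae (Eventually.of_forall fun x => ?_)
  simp [mul_comm]

lemma inner_eq_integral_of_ae {f g : L2 d} {f' g' : Space d → ℝ} (hf : f =ᵐ[volume] f')
    (hg : g =ᵐ[volume] g') : inner ℝ f g = ∫ x, f' x * g' x := by
  rw [inner_eq_integral]
  exact integral_congr_ae (hf.mul hg)

lemma inner_translate (h : Space d) (f g : L2 d) :
    inner ℝ f (translate h g) = ∫ x, f x * g (x - h) :=
  inner_eq_integral_of_ae (ae_eq_refl _) (translate_ae h g)

lemma memLp_testFunction {φ : Space d → ℝ} (hφ : ContDiff ℝ ∞ φ) (hc : HasCompactSupport φ) :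
    MemLp φ 2 (volume : Measure (Space d)) :=
  hφ.continuous.memLp_of_hasCompactSupport hc

lemma locallyIntegrable_L2 (u : L2 d) : LocallyIntegrable (u : Space d → ℝ) :=
  (Lp.memLp u).locallyIntegrable (by norm_num)

/-- A function with weak gradient `G` moves by at most `‖h‖ ‖G‖` under the translation by `h`. -/
lemma HasWeakGradient.inner_sub_translate_le {u : L2 d} {G : L2Field d}
    (hG : HasWeakGradient u G) (h : Space d) (w : L2 d) :
    inner ℝ u (translate h w) ≤ inner ℝ u w + ‖h‖ * ‖G‖ * ‖w‖ := by
  have hclosed : IsClosed {w : L2 d |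
      inner ℝ u (translate h w) ≤ inner ℝ u w + ‖h‖ * ‖G‖ * ‖w‖} := by
    refine isClosed_le ?_ ?_
    · exact continuous_const.inner (translate h).continuous
    · fun_prop
  have hdense := Lp.dense_hasCompactSupport_contDiff (F := ℝ) (E := Space d) (μ := volume)
    (p := 2) (by norm_num)
  refine hclosed.closure_subset_iff.2 ?_ (hdense w)
  rintro w ⟨ψ, hwψ, hc, hψ⟩
  have hwh : translate h w =ᵐ[volume] fun x => ψ (x - h) := by
    refine (translate_ae h w).trans ?_
    exact (measurePreserving_sub_right volume h).quasiMeasurePreserving.ae_eq_comp hwψ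
  rw [mem_ofPred_eq, inner_eq_integral_of_ae (ae_eq_refl _) hwh,
    inner_eq_integral_of_ae (ae_eq_refl _) hwψ]
  refine integral_mul_sub_translate_le (locallyIntegrable_L2 u) (hψ.of_le (by simp)) hc h ?_
  intro s
  have hψs : ContDiff ℝ ∞ fun x => ψ (x - s • h) := hψ.comp (contDiff_id.sub contDiff_const)
  have hcs : HasCompactSupport fun x => ψ (x - s • h) :=
    hc.comp_homeomorph (Homeomorph.subRight (s • h))
  have h1 := hG _ hψs hcs h
  have h2 : ∀ x, fderiv ℝ (fun x => ψ (x - s • h)) x = fderiv ℝ ψ (x - s • h) := by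
    intro x
    rw [fderiv_comp_sub]
  simp only [h2] at h1
  rw [h1, neg_neg]
  have h3 : (∫ x, inner ℝ (G x) h * ψ (x - s • h)) ≤
      ∫ x, ‖h‖ * (‖G x‖ * ‖translate (s • h) w x‖) := by
    have hws : translate (s • h) w =ᵐ[volume] fun x => ψ (x - s • h) := by
      refine (translate_ae _ w).trans ?_
      exact (measurePreserving_sub_right volume (s • h)).quasiMeasurePreserving.ae_eq_comp hwψ
    refine integral_mono_ae ?_ ?_ ?_
    · refine MemLp.integrable_mul (p := 2) (q := 2) ?_ (memLp_testFunction hψs hcs)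
      exact (Lp.memLp G).inner_const h
    · refine Integrable.const_mul ?_ _
      exact MemLp.integrable_mul (p := 2) (q := 2) (Lp.memLp G).norm (Lp.memLp _).norm
    · filter_upwards [hws] with x hx
      rw [hx]
      calc inner ℝ (G x) h * ψ (x - s • h) ≤ |inner ℝ (G x) h| * |ψ (x - s • h)| := by
            rw [← abs_mul]; exact le_abs_self _
        _ ≤ (‖G x‖ * ‖h‖) * |ψ (x - s • h)| := by
            gcongr; exact abs_real_inner_le_norm _ _
        _ = _ := by rw [Real.norm_eq_abs]; ring
  refine h3.trans ?_
  rw [integral_const_mul, mul_assoc]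
  gcongr
  have hGn : MemLp (fun x => ‖G x‖) 2 (volume : Measure (Space d)) := (Lp.memLp G).norm
  have hwn : MemLp (fun x => ‖translate (s • h) w x‖) 2 (volume : Measure (Space d)) :=
    (Lp.memLp _).norm
  have h4 := real_inner_le_norm (hGn.toLp _) (hwn.toLp _)
  rw [inner_eq_integral_of_ae hGn.coeFn_toLp hwn.coeFn_toLp] at h4
  refine h4.trans (le_of_eq ?_)
  rw [Lp.norm_toLp, Lp.norm_toLp, eLpNorm_norm, eLpNorm_norm, ← (translate (s • h)).norm_map w]
  rfl

/-- A function with values in `{-1, 0, 1}` whose directional derivatives are measures of total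
mass at most `K` moves by at most `K ‖h‖` under the translation by `h`. -/
lemma inner_sub_translate_le_of_bv {g : L2 d} (hg : ∀ᵐ x, g x = -1 ∨ g x = 0 ∨ g x = 1) {K : ℝ}
    (hK : ∀ ψ : Space d → ℝ, ContDiff ℝ ∞ ψ → HasCompactSupport ψ → (∀ x, |ψ x| ≤ 1) →
      ∀ v : Space d, ∫ x, g x * fderiv ℝ ψ x v ≤ K * ‖v‖) (h : Space d) :
    inner ℝ g g ≤ inner ℝ g (translate h g) + ‖h‖ * K := by
  have happ : ∀ w ∈ {f : L2 d | ∃ (ψ : Space d → ℝ), f =ᵐ[volume] ψ ∧ HasCompactSupport ψ ∧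
      ContDiff ℝ ∞ ψ}, ∃ w' : L2 d, ‖w' - g‖ ≤ Real.pi / 2 * ‖w - g‖ ∧
        inner ℝ g w' ≤ inner ℝ g (translate h w') + ‖h‖ * K := by
    rintro w ⟨ψ₀, hw, hc₀, hψ₀⟩
    -- The sine of π/2 times its argument fixes -1, 0 and 1, is bounded by 1 and is Lipschitz with
    -- constant π/2. Composing with it makes the smooth approximants admissible in `hK` and still
    -- convergent to g in L².
    set ψ : Space d → ℝ := fun x => Real.sin (Real.pi / 2 * ψ₀ x) with hψdef
    have hψ : ContDiff ℝ ∞ ψ := Real.contDiff_sin.comp (contDiff_const.mul hψ₀)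
    have hc : HasCompactSupport ψ := by
      refine hc₀.comp_left (g := fun t => Real.sin (Real.pi / 2 * t)) (by simp)
    have hm := memLp_testFunction hψ hc
    have hψ1 : ∀ x, |ψ x| ≤ 1 := fun x => Real.abs_sin_le_one _
    refine ⟨hm.toLp, ?_, ?_⟩
    · refine Lp.norm_le_mul_norm_of_ae_le_mul ?_
      filter_upwards [Lp.coeFn_sub (hm.toLp) g, Lp.coeFn_sub w g, hg, hw, hm.coeFn_toLp]
        with x h1 h2 h3 h4 h5
      rw [h1, h2, Pi.sub_apply, Pi.sub_apply, h4, h5]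
      have hs : g x = Real.sin (Real.pi / 2 * g x) := by
        rcases h3 with h3 | h3 | h3 <;> rw [h3] <;> simp
      rw [hs, hψdef, Real.norm_eq_abs, Real.norm_eq_abs]
      have hlip : ∀ a b : ℝ, |Real.sin a - Real.sin b| ≤ |a - b| := by
        intro a b
        have := Real.lipschitzWith_sin.dist_le_mul a b
        simpa [Real.dist_eq] using this
      refine (hlip _ _).trans ?_
      rw [← hs, ← mul_sub, abs_mul, abs_of_pos (by positivity)]
    · have hwh : translate h (hm.toLp) =ᵐ[volume] fun x => ψ (x - h) := by
        refine (translate_ae h _).trans ?_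
        exact (measurePreserving_sub_right volume h).quasiMeasurePreserving.ae_eq_comp
          hm.coeFn_toLp
      rw [inner_eq_integral_of_ae (ae_eq_refl _) hwh,
        inner_eq_integral_of_ae (ae_eq_refl _) hm.coeFn_toLp]
      have hψh : ContDiff ℝ ∞ fun x => ψ (x - h) := hψ.comp (contDiff_id.sub contDiff_const)
      have hch : HasCompactSupport fun x => ψ (x - h) :=
        hc.comp_homeomorph (Homeomorph.subRight h)
      -- The estimate is read backwards, from ψ(· - h) with displacement -h, since the translated
      -- pairing must stand on the larger side.
      have := integral_mul_sub_translate_le (locallyIntegrable_L2 g) (hψh.of_le (by simp)) hch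
        (-h) (K := ‖h‖ * K) ?_
      · simpa using this
      · intro s
        have hψs : ContDiff ℝ ∞ fun x => ψ (x - s • (-h) - h) :=
          hψ.comp ((contDiff_id.sub contDiff_const).sub contDiff_const)
        have hcs : HasCompactSupport fun x => ψ (x - s • (-h) - h) :=
          hch.comp_homeomorph (Homeomorph.subRight (s • (-h)))
        have h1 := hK _ hψs hcs (fun x => hψ1 _) h
        have h2 : ∀ x, fderiv ℝ (fun x => ψ (x - s • (-h) - h)) x =
            fderiv ℝ (fun x => ψ (x - h)) (x - s • (-h)) := fun x => by
          rw [← fderiv_comp_sub]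
        simp only [h2] at h1
        rw [← integral_neg]
        simpa [mul_comm] using h1
  have hdense := Lp.dense_hasCompactSupport_contDiff (F := ℝ) (E := Space d) (μ := volume)
    (p := 2) (by norm_num)
  obtain ⟨w, hw, hwg⟩ := mem_closure_iff_seq_limit.1 (hdense g)
  choose w' hw' hw'' using fun n => happ (w n) (hw n)
  have hlim : Tendsto w' atTop (𝓝 g) := by
    rw [tendsto_iff_norm_sub_tendsto_zero] at hwg ⊢
    refine squeeze_zero (fun n => norm_nonneg _) hw' ?_
    simpa using hwg.const_mul (Real.pi / 2)
  refine le_of_tendsto_of_tendsto' (tendsto_const_nhds.inner hlim)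
    ((tendsto_const_nhds.inner (((translate h).continuous.tendsto g).comp hlim)).add_const _) hw''

/-! ### Ball averages, compactness and a Faber-Krahn inequality -/

lemma integral_abs_le_of_support {g : L2 d} {A : Set (Space d)}
    (hg : ∀ᵐ x, x ∉ A → g x = 0) {a : ℝ} (ha : 0 ≤ a) (hA : volume A ≤ ENNReal.ofReal a) :
    Integrable (g : Space d → ℝ) ∧ ∫ x, |g x| ≤ √a * ‖g‖ := by
  set A' := toMeasurable volume A
  have hA' : MeasurableSet A' := measurableSet_toMeasurable _ _
  have hvA : volume A' = volume A := measure_toMeasurable _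
  have hfin : volume A' ≠ ⊤ := by
    rw [hvA]; exact (hA.trans_lt ENNReal.ofReal_lt_top).ne
  have hgA : (fun x => |g x|) =ᵐ[volume] A'.indicator (fun x => |g x|) := by
    filter_upwards [hg] with x hx
    by_cases h : x ∈ A'
    · rw [indicator_of_mem h]
    · rw [indicator_of_notMem h, hx (fun h' => h (subset_toMeasurable _ _ h')), abs_zero]
  have hm : MemLp (fun x => |g x|) 2 (volume : Measure (Space d)) := (Lp.memLp g).norm
  have h1 : ∫ x, |g x| = inner ℝ (indicatorConstLp 2 hA' hfin (1 : ℝ)) (hm.toLp _) := by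
    rw [L2.inner_indicatorConstLp_one, integral_congr_ae hgA, integral_indicator hA']
    refine integral_congr_ae ?_
    filter_upwards [ae_restrict_of_ae hm.coeFn_toLp] with x hx
    rw [hx]
  constructor
  · have h2 : IntegrableOn (fun x => |g x|) A' := by
      have : IsFiniteMeasure (volume.restrict A') := ⟨by simpa using hfin.lt_top⟩
      exact (hm.restrict A').integrable (by norm_num)
    have h3 := (integrable_indicator_iff hA').2 h2
    have h4 : Integrable (fun x => |g x|) := (integrable_congr hgA).2 h3
    exact (integrable_norm_iff (Lp.aestronglyMeasurable g)).1
      (by simpa only [Real.norm_eq_abs] using h4)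
  · rw [h1]
    refine (real_inner_le_norm _ _).trans ?_
    rw [norm_indicatorConstLp (by norm_num) (by norm_num), Lp.norm_toLp]
    have h4 : (eLpNorm (fun x => |g x|) 2 volume).toReal = ‖g‖ := by
      rw [Lp.norm_def]; congr 1
      exact eLpNorm_congr_norm_ae (Eventually.of_forall fun x => by simp)
    rw [h4]
    refine mul_le_mul_of_nonneg_right ?_ (norm_nonneg _)
    have h5 : volume.real A' ≤ a := by
      rw [measureReal_def, hvA]; exact ENNReal.toReal_le_of_le_ofReal ha hA
    simp only [norm_one, one_mul, ENNReal.toReal_ofNat, ← Real.sqrt_eq_rpow]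
    exact Real.sqrt_le_sqrt h5

lemma setIntegral_ball_eq (g : Space d → ℝ) (x : Space d) (ε : ℝ) :
    ∫ h in Metric.ball 0 ε, g (x - h) = ∫ y in Metric.ball x ε, g y := by
  rw [← integral_indicator Metric.isOpen_ball.measurableSet,
    ← integral_indicator Metric.isOpen_ball.measurableSet,
    ← integral_sub_left_eq_self ((Metric.ball x ε).indicator g) volume x]
  congr 1 with h
  by_cases hh : h ∈ Metric.ball (0 : Space d) ε
  · rw [indicator_of_mem hh, indicator_of_mem]
    simpa [Metric.mem_ball, dist_eq_norm] using hh
  · rw [indicator_of_notMem hh, indicator_of_notMem]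
    simpa [Metric.mem_ball, dist_eq_norm] using hh

/-- A function that is nearly invariant under translations by small vectors nearly coincides, in
the mean, with its averages over small balls. -/
lemma volume_ball_mul_le {g : L2 d} (hgi : Integrable (g : Space d → ℝ)) {ε σ : ℝ}
    (hs : ∀ h : Space d, ‖h‖ < ε → inner ℝ g g ≤ inner ℝ g (translate h g) + σ) :
    volume.real (Metric.ball (0 : Space d) ε) * (inner ℝ g g - σ) ≤
      ∫ x, g x * ∫ y in Metric.ball x ε, g y := by
  set B := Metric.ball (0 : Space d) ε
  have hB : MeasurableSet B := Metric.isOpen_ball.measurableSet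
  have hBfin : volume B < ⊤ := Metric.isBounded_ball.measure_lt_top
  have hprod : Integrable (fun p : Space d × Space d => g p.2 * g (p.2 - p.1))
      ((volume.restrict B).prod volume) := by
    have h1 := Integrable.convolution_integrand (ContinuousLinearMap.mul ℝ ℝ) hgi
      (hgi.comp_neg) (μ := volume)
    have h2 : Integrable (fun p : Space d × Space d => g p.2 * g (p.2 - p.1))
        ((volume : Measure (Space d)).prod volume) := by
      simpa using h1
    have h3 := h2.restrict (s := B ×ˢ univ)
    rwa [← Measure.prod_restrict, Measure.restrict_univ] at h3
  have hswap := integral_integral_swap (f := fun h x => g x * g (x - h)) hprod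
  have hR : ∀ x, ∫ h in B, g x * g (x - h) = g x * ∫ y in Metric.ball x ε, g y := by
    intro x
    rw [integral_const_mul, setIntegral_ball_eq]
  simp only [hR] at hswap
  rw [← hswap]
  have hconst : volume.real B * (inner ℝ g g - σ) = ∫ h in B, (inner ℝ g g - σ) := by
    rw [setIntegral_const, smul_eq_mul]
  rw [hconst]
  refine setIntegral_mono_on ?_ hprod.integral_prod_left hB fun h hh => ?_
  · exact integrableOn_const hBfin.ne
  · have := hs h (by simpa [B] using hh)
    rw [inner_translate] at this
    linarith

/-- Averaging over a ball of volume V bounds V(‖g‖² - σ) by (∫|g|)², which is at most a‖g‖² by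
Cauchy-Schwarz on the support. As V ≥ 2a, half of V‖g‖² is absorbed. With σ coming from a gradient
this yields Faber-Krahn, with σ coming from a perimeter the isoperimetric inequality. -/
lemma inner_self_le_of_translate {g : L2 d} {A : Set (Space d)}
    (hg : ∀ᵐ x, x ∉ A → g x = 0) {a : ℝ} (ha : 0 ≤ a) (hA : volume A ≤ ENNReal.ofReal a) {ε σ : ℝ}
    (hε : 0 < ε) (hV : 2 * a ≤ volume.real (Metric.ball (0 : Space d) ε))
    (hs : ∀ h : Space d, ‖h‖ < ε → inner ℝ g g ≤ inner ℝ g (translate h g) + σ) :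
    inner ℝ g g ≤ 2 * σ := by
  obtain ⟨hgi, h1⟩ := integral_abs_le_of_support hg ha hA
  have h2 := volume_ball_mul_le hgi hs
  set V := volume.real (Metric.ball (0 : Space d) ε)
  have hVpos : 0 < V := by
    refine ENNReal.toReal_pos (Metric.measure_ball_pos _ _ hε).ne'
      Metric.isBounded_ball.measure_lt_top.ne
  have h3 : ∫ x, g x * ∫ y in Metric.ball x ε, g y ≤ (∫ x, |g x|) * ∫ x, |g x| := by
    rw [← integral_mul_const]
    refine (le_abs_self _).trans (abs_integral_le_integral_abs.trans ?_)
    refine integral_mono_of_nonneg (Eventually.of_forall fun x => abs_nonneg _)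
      (hgi.abs.mul_const _) (Eventually.of_forall fun x => ?_)
    have h4 : |∫ y in Metric.ball x ε, g y| ≤ ∫ y, |g y| := by
      refine (abs_integral_le_integral_abs).trans ?_
      exact setIntegral_le_integral hgi.abs (Eventually.of_forall fun x => abs_nonneg _)
    beta_reduce
    rw [abs_mul]
    gcongr
  have h5 : (∫ x, |g x|) * ∫ x, |g x| ≤ a * inner ℝ g g := by
    have h0 : 0 ≤ ∫ x, |g x| := integral_nonneg fun x => abs_nonneg _
    calc _ ≤ (√a * ‖g‖) * (√a * ‖g‖) := by gcongr
      _ = (√a * √a) * (‖g‖ * ‖g‖) := by ring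
      _ = _ := by rw [Real.mul_self_sqrt ha, real_inner_self_eq_norm_mul_norm]
  have h6 : 0 ≤ inner ℝ g g := real_inner_self_nonneg
  have h7 : 2 * (a * inner ℝ g g) ≤ V * inner ℝ g g := by nlinarith
  nlinarith

/-- A sequence that converges weakly to zero, with supports in a set of finite measure and with a
uniform modulus of continuity under translations, converges strongly to zero. -/
lemma tendsto_zero_of_weak {ι : Type*} {l : Filter ι} [l.IsCountablyGenerated] {g : ι → L2 d}
    {A : Set (Space d)} (hA : volume A < ⊤) (hg : ∀ i, ∀ᵐ x, x ∉ A → g i x = 0) {C K : ℝ}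
    (hC : ∀ i, ‖g i‖ ≤ C) (hK : ∀ i, ∀ h : Space d,
      inner ℝ (g i) (g i) ≤ inner ℝ (g i) (translate h (g i)) + ‖h‖ * K)
    (hweak : ∀ y, Tendsto (fun i => inner ℝ (g i) y) l (𝓝 0)) :
    Tendsto g l (𝓝 0) := by
  rcases l.eq_or_neBot with rfl | hne
  · simp
  have hK0 : 0 ≤ C := by
    obtain ⟨i⟩ : Nonempty ι := nonempty_of_neBot l
    exact (norm_nonneg _).trans (hC i)
  set A' := toMeasurable volume A
  have hA' : MeasurableSet A' := measurableSet_toMeasurable _ _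
  have hfin : volume A' < ⊤ := by rwa [measure_toMeasurable]
  have hgi : ∀ i, Integrable (g i : Space d → ℝ) := fun i =>
    (integral_abs_le_of_support (hg i) ENNReal.toReal_nonneg
      (ENNReal.ofReal_toReal hA.ne).ge).1
  -- At fixed radius the average of `g i` over a ball is its inner product with an indicator, so it
  -- tends to 0 pointwise by weak convergence. The averages are uniformly bounded and matter only on
  -- a set of finite measure, so dominated convergence applies.
  have main : ∀ ε > 0, Tendsto (fun i => ∫ x, g i x * ∫ y in Metric.ball x ε, g i y) l (𝓝 0) := by
    intro ε hε
    set a : ι → Space d → ℝ := fun i => A'.indicator fun x => ∫ y in Metric.ball x ε, g i y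
    have hBm : ∀ x : Space d, MeasurableSet (Metric.ball x ε) :=
      fun x => Metric.isOpen_ball.measurableSet
    have hBf : ∀ x : Space d, volume (Metric.ball x ε) ≠ ⊤ :=
      fun x => Metric.isBounded_ball.measure_lt_top.ne
    have hform : ∀ i x, ∫ y in Metric.ball x ε, g i y =
        inner ℝ (g i) (indicatorConstLp 2 (hBm x) (hBf x) (1 : ℝ)) := by
      intro i x
      rw [real_inner_comm, L2.inner_indicatorConstLp_one]
    set M : ℝ := C * volume.real (Metric.ball (0 : Space d) ε) ^ ((1 : ℝ) / 2)
    have hbd : ∀ i x, |∫ y in Metric.ball x ε, g i y| ≤ M := by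
      intro i x
      rw [hform]
      refine (abs_real_inner_le_norm _ _).trans ?_
      rw [norm_indicatorConstLp (by norm_num) (by norm_num)]
      have : volume.real (Metric.ball x ε) = volume.real (Metric.ball (0 : Space d) ε) := by
        rw [measureReal_def, measureReal_def, Measure.addHaar_ball_center]
      rw [this]
      simp only [norm_one, one_mul, ENNReal.toReal_ofNat]
      exact mul_le_mul_of_nonneg_right (hC i) (by positivity)
    have hmeas : ∀ i, AEStronglyMeasurable (fun x => ∫ y in Metric.ball x ε, g i y)
        (volume : Measure (Space d)) := by
      intro i
      have h1 : AEStronglyMeasurable ({p : Space d × Space d | dist p.2 p.1 < ε}.indicator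
          fun p => g i p.2) ((volume : Measure (Space d)).prod volume) :=
        ((Lp.aestronglyMeasurable (g i)).comp_snd).indicator
          (measurableSet_lt (by fun_prop) measurable_const)
      refine h1.integral_prod_right'.congr (Eventually.of_forall fun x => ?_)
      beta_reduce
      rw [← integral_indicator (hBm x)]
      rfl
    have hMa : ∀ i x, ‖a i x‖ ≤ A'.indicator (fun _ => M) x := by
      intro i x
      by_cases hx : x ∈ A'
      · simp only [a, indicator_of_mem hx]; exact hbd i x
      · simp [a, indicator_of_notMem hx]
    have hma : ∀ i, MemLp (a i) 2 (volume : Measure (Space d)) := by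
      intro i
      refine MemLp.of_le (g := A'.indicator (fun _ => M)) ?_ ((hmeas i).indicator hA') ?_
      · exact memLp_indicator_const _ hA' _ (Or.inr hfin.ne)
      · refine Eventually.of_forall fun x => (hMa i x).trans (le_abs_self _)
    have hlim : Tendsto (fun i => ∫ x, a i x ^ 2) l (𝓝 0) := by
      have := tendsto_integral_filter_of_dominated_convergence (μ := volume) (l := l)
        (F := fun i x => a i x ^ 2) (f := fun _ => 0) (A'.indicator fun _ => M ^ 2) ?_ ?_ ?_ ?_
      · simpa using this
      · exact Eventually.of_forall fun i => (hma i).aestronglyMeasurable.pow 2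
      · refine Eventually.of_forall fun i => Eventually.of_forall fun x => ?_
        have := hMa i x
        by_cases hx : x ∈ A'
        · rw [indicator_of_mem hx] at this ⊢
          rw [norm_pow]; gcongr
        · simp [a, indicator_of_notMem hx]
      · exact (integrable_indicator_iff hA').2 (integrableOn_const hfin.ne)
      · refine Eventually.of_forall fun x => ?_
        by_cases hx : x ∈ A'
        · simp only [a, indicator_of_mem hx, hform]
          simpa using (hweak (indicatorConstLp 2 (hBm x) (hBf x) (1 : ℝ))).pow 2
        · simp [a, indicator_of_notMem hx]
    have hup : ∀ i, |∫ x, g i x * ∫ y in Metric.ball x ε, g i y| ≤ C * √(∫ x, a i x ^ 2) := by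
      intro i
      have h1 : ∫ x, g i x * ∫ y in Metric.ball x ε, g i y = inner ℝ (g i) ((hma i).toLp _) := by
        rw [inner_eq_integral]
        refine integral_congr_ae ?_
        filter_upwards [hg i, (hma i).coeFn_toLp] with x hx hx'
        rw [hx']
        by_cases h : x ∈ A'
        · simp only [a, indicator_of_mem h]
        · rw [hx (fun h' => h (subset_toMeasurable _ _ h'))]; simp
      have h2 : ‖(hma i).toLp _‖ = √(∫ x, a i x ^ 2) := by
        rw [eq_comm, Real.sqrt_eq_iff_mul_self_eq (integral_nonneg fun x => sq_nonneg _)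
          (norm_nonneg _), ← real_inner_self_eq_norm_mul_norm,
          inner_eq_integral_of_ae (hma i).coeFn_toLp (hma i).coeFn_toLp]
        simp [sq]
      rw [h1, ← h2]
      refine (abs_real_inner_le_norm _ _).trans ?_
      gcongr
      exact hC i
    rw [tendsto_zero_iff_abs_tendsto_zero]
    refine squeeze_zero (fun i => abs_nonneg _) hup ?_
    simpa using (hlim.sqrt).const_mul C
  rw [Metric.tendsto_nhds]
  intro δ hδ
  -- The translation error takes δ²/4 and the averaged integral another δ²/4, leaving ‖g i‖² below
  -- δ².
  obtain ⟨ε, hε, hεK⟩ : ∃ ε > 0, ε * |K| ≤ δ ^ 2 / 4 := by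
    refine ⟨δ ^ 2 / 4 / (|K| + 1), by positivity, ?_⟩
    rw [div_mul_eq_mul_div, div_le_iff₀ (by positivity)]
    have : 0 ≤ δ ^ 2 / 4 := by positivity
    nlinarith
  set V := volume.real (Metric.ball (0 : Space d) ε)
  have hVpos : 0 < V := ENNReal.toReal_pos (Metric.measure_ball_pos _ _ hε).ne'
      Metric.isBounded_ball.measure_lt_top.ne
  have hev : ∀ᶠ i in l, ∫ x, g i x * ∫ y in Metric.ball x ε, g i y < V * (δ ^ 2 / 4) :=
    (main ε hε).eventually_lt_const (by positivity)
  filter_upwards [hev] with i hi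
  have h1 := volume_ball_mul_le (hgi i) (ε := ε) (σ := ε * |K|) fun h hh => by
    refine (hK i h).trans ?_
    have : ‖h‖ * K ≤ ε * |K| := by
      refine (mul_le_mul_of_nonneg_left (le_abs_self K) (norm_nonneg h)).trans ?_
      gcongr
    linarith
  rw [dist_zero_right]
  have h2 : inner ℝ (g i) (g i) - ε * |K| < δ ^ 2 / 4 := by
    have := h1.trans_lt hi
    exact lt_of_mul_lt_mul_left this hVpos.le
  rw [real_inner_self_eq_norm_sq] at h2
  refine lt_of_pow_lt_pow_left₀ 2 hδ.le ?_
  nlinarith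

/-- C is chosen so that the ball has volume exactly 2a. The radius is proportional to the 1/d-th
power of a, which gives the inequalities below their scaling exponents. -/
lemma exists_volume_ball_eq (hd : d ≠ 0) :
    ∃ C > 0, ∀ a > 0, 2 * a ≤ volume.real (Metric.ball (0 : Space d) (C * a ^ (1 / (d : ℝ)))) := by
  have : NeZero d := ⟨hd⟩
  set w := volume.real (Metric.ball (0 : Space d) 1)
  have hw : 0 < w := ENNReal.toReal_pos (Metric.measure_ball_pos _ _ one_pos).ne'
      Metric.isBounded_ball.measure_lt_top.ne
  refine ⟨(2 / w) ^ (1 / (d : ℝ)), by positivity, fun a ha => ?_⟩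
  have hr : 0 ≤ (2 / w) ^ (1 / (d : ℝ)) * a ^ (1 / (d : ℝ)) := by positivity
  rw [measureReal_def, Measure.addHaar_ball _ _ hr, ENNReal.toReal_mul,
    ENNReal.toReal_ofReal (by positivity), ← Real.mul_rpow (by positivity) ha.le]
  rw [finrank_euclideanSpace_fin, one_div, Real.rpow_inv_natCast_pow (by positivity) hd]
  refine le_of_eq ?_
  change _ = _ * w
  field_simp

/-- A Faber-Krahn type inequality (with a non-optimal constant). -/
lemma exists_norm_le_of_hasWeakGradient (hd : d ≠ 0) :
    ∃ C > 0, ∀ (u : L2 d) (G : L2Field d) (A : Set (Space d)) (a : ℝ), HasWeakGradient u G →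
      (∀ᵐ x, x ∉ A → u x = 0) → 0 ≤ a → volume A ≤ ENNReal.ofReal a →
      ‖u‖ ≤ C * a ^ (1 / (d : ℝ)) * ‖G‖ := by
  obtain ⟨C, hC, hV⟩ := exists_volume_ball_eq hd
  refine ⟨2 * C, by positivity, fun u G A a hG hu ha hA => ?_⟩
  rcases ha.eq_or_lt with rfl | hapos
  · have : u = 0 := by
      rw [Lp.eq_zero_iff_ae_eq_zero]
      have hA0 : ∀ᵐ x, x ∉ A := by
        rw [ENNReal.ofReal_zero, nonpos_iff_eq_zero] at hA
        exact measure_eq_zero_iff_ae_notMem.1 hA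
      filter_upwards [hu, hA0] with x h1 h2 using h1 h2
    rw [this, norm_zero]; positivity
  · have h1 := inner_self_le_of_translate hu ha hA (ε := C * a ^ (1 / (d : ℝ))) (by positivity)
      (hV a hapos) (σ := C * a ^ (1 / (d : ℝ)) * ‖G‖ * ‖u‖) ?_
    · rw [real_inner_self_eq_norm_mul_norm] at h1
      rcases (norm_nonneg u).eq_or_lt with h0 | h0
      · rw [← h0]; positivity
      · refine le_of_mul_le_mul_right (h1.trans (le_of_eq ?_)) h0
        ring
    · intro h hh
      -- Translating back the translate of u puts ‖u‖² on the left-hand side.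
      have h2 := hG.inner_sub_translate_le (-h) (translate h u)
      have h3 : translate (-h) (translate h u) = u := by
        apply Lp.ext
        filter_upwards [translate_ae (-h) (translate h u),
          (measurePreserving_sub_right volume (-h)).quasiMeasurePreserving.ae_eq_comp
            (translate_ae h u)] with x hx hx'
        rw [hx]
        simpa using hx'
      rw [h3, LinearIsometry.norm_map, norm_neg] at h2
      refine h2.trans ?_
      gcongr

/-! ### Weak compactness, weak gradients and Rellich's theorem -/

/-- Every bounded sequence of a separable Hilbert space has a weakly convergent subsequence. -/
lemma exists_weak_limit {H : Type*} [NormedAddCommGroup H] [InnerProductSpace ℝ H]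
    [CompleteSpace H] [TopologicalSpace.SeparableSpace H] {x : ℕ → H} {C : ℝ}
    (hx : ∀ n, ‖x n‖ ≤ C) :
    ∃ (y : H) (φ : ℕ → ℕ), StrictMono φ ∧
      ∀ z, Tendsto (fun n => inner ℝ (x (φ n)) z) atTop (𝓝 (inner ℝ y z)) := by
  have hmem : ∀ n, StrongDual.toWeakDual (InnerProductSpace.toDual ℝ H (x n)) ∈
      WeakDual.toStrongDual ⁻¹' Metric.closedBall (0 : StrongDual ℝ H) C := by
    intro n
    simp only [mem_preimage, mem_closedBall_zero_iff]
    refine le_trans (le_of_eq ?_) (hx n)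
    exact (InnerProductSpace.toDual ℝ H).norm_map (x n)
  obtain ⟨f, -, φ, hφ, hlim⟩ := WeakDual.isSeqCompact_closedBall ℝ H 0 C hmem
  refine ⟨(InnerProductSpace.toDual ℝ H).symm (WeakDual.toStrongDual f), φ, hφ, fun z => ?_⟩
  have := ((WeakDual.eval_continuous z).tendsto f).comp hlim
  simp only [InnerProductSpace.toDual_symm_apply]
  exact this

lemma norm_le_of_weak_limit {H ι : Type*} [NormedAddCommGroup H] [InnerProductSpace ℝ H]
    {l : Filter ι} [l.NeBot] {x : ι → H} {y : H} {C : ℝ}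
    (hy : ∀ z, Tendsto (fun n => inner ℝ (x n) z) l (𝓝 (inner ℝ y z)))
    {c : ι → ℝ} (hx : ∀ n, ‖x n‖ ≤ c n) (hc : Tendsto c l (𝓝 C)) : ‖y‖ ≤ C := by
  have h1 : inner ℝ y y ≤ C * ‖y‖ := by
    refine le_of_tendsto_of_tendsto' (hy y) (hc.mul_const ‖y‖) fun n => ?_
    exact (real_inner_le_norm _ _).trans (by gcongr; exact hx n)
  rw [real_inner_self_eq_norm_mul_norm] at h1
  rcases (norm_nonneg y).eq_or_lt with h0 | h0
  · rw [← h0]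
    refine ge_of_tendsto' hc fun n => (norm_nonneg _).trans (hx n)
  · exact le_of_mul_le_mul_right h1 h0

lemma hasWeakGradient_toLp {u : Space d → ℝ} {G : Space d → Space d} (hu : MemLp u 2 volume)
    (hG : MemLp G 2 volume)
    (h : ∀ φ : Space d → ℝ, ContDiff ℝ ∞ φ → HasCompactSupport φ → ∀ v : Space d,
      ∫ x, u x * fderiv ℝ φ x v = - ∫ x, inner ℝ (G x) v * φ x) :
    HasWeakGradient (hu.toLp u) (hG.toLp G) := by
  intro φ hφ hc v
  have h1 : ∫ x, hu.toLp u x * fderiv ℝ φ x v = ∫ x, u x * fderiv ℝ φ x v := by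
    refine integral_congr_ae ?_
    filter_upwards [hu.coeFn_toLp] with x hx
    rw [hx]
  have h2 : ∫ x, inner ℝ (hG.toLp G x) v * φ x = ∫ x, inner ℝ (G x) v * φ x := by
    refine integral_congr_ae ?_
    filter_upwards [hG.coeFn_toLp] with x hx
    rw [hx]
  rw [h1, h2, h φ hφ hc v]

lemma memLp_fderiv_apply {φ : Space d → ℝ} (hφ : ContDiff ℝ ∞ φ) (hc : HasCompactSupport φ)
    (v : Space d) : MemLp (fun x => fderiv ℝ φ x v) 2 (volume : Measure (Space d)) := by
  have h : Continuous fun x => fderiv ℝ φ x v :=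
    (hφ.continuous_fderiv (by simp)).clm_apply continuous_const
  refine h.memLp_of_hasCompactSupport ?_
  exact (hc.fderiv (𝕜 := ℝ)).comp_left (g := fun L : Space d →L[ℝ] ℝ => L v) (by simp)

lemma memLp_smul_const {φ : Space d → ℝ} (hφ : ContDiff ℝ ∞ φ) (hc : HasCompactSupport φ)
    (v : Space d) : MemLp (fun x => φ x • v) 2 (volume : Measure (Space d)) := by
  have h : Continuous fun x => φ x • v := hφ.continuous.smul continuous_const
  exact h.memLp_of_hasCompactSupport (hc.smul_right)

/-- Written with inner products against fixed elements, the relation is linear and visibly stable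
under weak limits of both entries. -/
lemma hasWeakGradient_iff_inner {u : L2 d} {G : L2Field d} :
    HasWeakGradient u G ↔ ∀ (φ : Space d → ℝ) (hφ : ContDiff ℝ ∞ φ) (hc : HasCompactSupport φ)
      (v : Space d), inner ℝ u ((memLp_fderiv_apply hφ hc v).toLp _) =
        - inner ℝ G ((memLp_smul_const hφ hc v).toLp _) := by
  refine forall₂_congr fun φ hφ => forall₂_congr fun hc v => ?_
  rw [inner_eq_integral_of_ae (ae_eq_refl _) (memLp_fderiv_apply hφ hc v).coeFn_toLp, L2.inner_def]
  have : ∫ x, inner ℝ (G x) ((memLp_smul_const hφ hc v).toLp _ x) =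
      ∫ x, inner ℝ (G x) v * φ x := by
    refine integral_congr_ae ?_
    filter_upwards [(memLp_smul_const hφ hc v).coeFn_toLp] with x hx
    rw [hx, inner_smul_right, mul_comm]
  rw [this]

instance : Fact ((2 : ℝ≥0∞) ≠ ⊤) := ⟨by norm_num⟩

/-- The graph of the weak gradient on `H̃¹₀(Ω)`. -/
def gradientPairs (Ω : Set (Space d)) : Submodule ℝ (L2 d × L2Field d) where
  carrier := {p | HasWeakGradient p.1 p.2 ∧ ∀ᵐ x, x ∉ Ω → p.1 x = 0}
  zero_mem' := by
    refine ⟨?_, ?_⟩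
    · rw [hasWeakGradient_iff_inner]; intro φ hφ hc v; simp
    · filter_upwards [Lp.coeFn_zero ℝ 2 (volume : Measure (Space d))] with x hx _ using hx
  add_mem' := by
    rintro p q ⟨hp, hp'⟩ ⟨hq, hq'⟩
    refine ⟨?_, ?_⟩
    · rw [hasWeakGradient_iff_inner] at *
      intro φ hφ hc v
      rw [Prod.fst_add, Prod.snd_add, inner_add_left, inner_add_left, hp φ hφ hc v, hq φ hφ hc v]
      ring
    · filter_upwards [hp', hq', Lp.coeFn_add p.1 q.1] with x h1 h2 h3 hx
      rw [Prod.fst_add, h3, Pi.add_apply, h1 hx, h2 hx, add_zero]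
  smul_mem' := by
    rintro c p ⟨hp, hp'⟩
    refine ⟨?_, ?_⟩
    · rw [hasWeakGradient_iff_inner] at *
      intro φ hφ hc v
      rw [Prod.smul_fst, Prod.smul_snd, real_inner_smul_left, real_inner_smul_left, hp φ hφ hc v]
      ring
    · filter_upwards [hp', Lp.coeFn_smul c p.1] with x h1 h3 hx
      rw [Prod.smul_fst, h3, Pi.smul_apply, h1 hx, smul_zero]

lemma gradientPairs_mono {Ω Ω' : Set (Space d)} (h : ∀ᵐ x, x ∈ Ω → x ∈ Ω') :
    gradientPairs Ω ≤ gradientPairs Ω' := by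
  rintro p ⟨hp, hp'⟩
  refine ⟨hp, ?_⟩
  filter_upwards [h, hp'] with x h1 h2 hx using h2 (fun h3 => hx (h1 h3))

lemma mem_H10_iff {Ω : Set (Space d)} {u : L2 d} :
    u ∈ H10 Ω ↔ ∃ G, (u, G) ∈ gradientPairs Ω := by
  constructor
  · rintro ⟨⟨G, hG⟩, h⟩; exact ⟨G, hG, h⟩
  · rintro ⟨G, hG, h⟩; exact ⟨⟨G, hG⟩, h⟩

/-- Rellich's theorem, for functions vanishing outside sets `Ω n` contained in a set of finite
measure. -/
lemma exists_limit_gradientPairs {A : Set (Space d)} (hA : volume A < ⊤) {Ω : ℕ → Set (Space d)}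
    {Ω' : Set (Space d)} (hΩA : ∀ n, ∀ᵐ x, x ∈ Ω n → x ∈ A)
    (hΩ : ∀ᵐ x, x ∉ Ω' → ∀ᶠ n in atTop, x ∉ Ω n) {p : ℕ → L2 d × L2Field d}
    (hp : ∀ n, p n ∈ gradientPairs (Ω n)) {C : ℝ} (hC : ∀ n, ‖(p n).1‖ ≤ C)
    (hC' : ∀ n, ‖(p n).2‖ ≤ C) :
    ∃ q ∈ gradientPairs Ω', ∃ φ : ℕ → ℕ, StrictMono φ ∧
      Tendsto (fun n => (p (φ n)).1) atTop (𝓝 q.1) ∧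
      ∀ V, Tendsto (fun n => inner ℝ (p (φ n)).2 V) atTop (𝓝 (inner ℝ q.2 V)) := by
  obtain ⟨u, φ₁, hφ₁, hu⟩ := exists_weak_limit hC
  obtain ⟨G, φ₂, hφ₂, hG⟩ := exists_weak_limit (fun n => hC' (φ₁ n))
  have hφ : StrictMono (φ₁ ∘ φ₂) := hφ₁.comp hφ₂
  have hu2 : ∀ z, Tendsto (fun n => inner ℝ (p (φ₁ (φ₂ n))).1 z) atTop (𝓝 (inner ℝ u z)) :=
    fun z => (hu z).comp hφ₂.tendsto_atTop
  have hC0 : 0 ≤ C := (norm_nonneg _).trans (hC 0)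
  have hcauchy : CauchySeq fun n => (p (φ₁ (φ₂ n))).1 := by
    rw [cauchySeq_iff_tendsto_dist_atTop_0]
    -- The estimate is applied to differences indexed by pairs of integers: they tend weakly to
    -- zero, so the sequence is Cauchy. Nothing about the support or the gradient of the weak limit
    -- is needed yet.
    have h1 := tendsto_zero_of_weak (l := atTop) (A := A)
      (g := fun i : ℕ × ℕ => (p (φ₁ (φ₂ i.1)) - p (φ₁ (φ₂ i.2))).1) (C := C + C)
      (K := (C + C) * (C + C)) hA ?_ ?_ ?_ ?_
    · simpa [dist_eq_norm] using h1.norm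
    · intro i
      exact ((gradientPairs A).sub_mem (gradientPairs_mono (hΩA _) (hp (φ₁ (φ₂ i.1))))
        (gradientPairs_mono (hΩA _) (hp (φ₁ (φ₂ i.2))))).2
    · intro i
      exact (norm_sub_le _ _).trans (add_le_add (hC _) (hC _))
    · intro i h
      have hw : HasWeakGradient (p (φ₁ (φ₂ i.1)) - p (φ₁ (φ₂ i.2))).1
          (p (φ₁ (φ₂ i.1)) - p (φ₁ (φ₂ i.2))).2 :=
        ((gradientPairs A).sub_mem (gradientPairs_mono (hΩA _) (hp (φ₁ (φ₂ i.1))))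
        (gradientPairs_mono (hΩA _) (hp (φ₁ (φ₂ i.2))))).1
      set u := (p (φ₁ (φ₂ i.1)) - p (φ₁ (φ₂ i.2))).1
      set G := (p (φ₁ (φ₂ i.1)) - p (φ₁ (φ₂ i.2))).2
      have hu1 : ‖u‖ ≤ C + C := (norm_sub_le _ _).trans (add_le_add (hC _) (hC _))
      have hG1 : ‖G‖ ≤ C + C := (norm_sub_le _ _).trans (add_le_add (hC' _) (hC' _))
      have h2 := hw.inner_sub_translate_le (-h) (translate h u)
      have h3 : translate (-h) (translate h u) = u := by
        apply Lp.ext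
        filter_upwards [translate_ae (-h) (translate h u),
          (measurePreserving_sub_right volume (-h)).quasiMeasurePreserving.ae_eq_comp
            (translate_ae h u)] with x hx hx'
        rw [hx]
        simpa using hx'
      rw [h3, LinearIsometry.norm_map, norm_neg] at h2
      refine h2.trans ?_
      rw [mul_assoc]
      gcongr
    · intro y
      have h1 : Tendsto (fun i : ℕ × ℕ => inner ℝ (p (φ₁ (φ₂ i.1))).1 y) atTop
          (𝓝 (inner ℝ u y)) := (hu2 y).comp (tendsto_fst.mono_left prod_atTop_atTop_eq.ge)
      have h2 : Tendsto (fun i : ℕ × ℕ => inner ℝ (p (φ₁ (φ₂ i.2))).1 y) atTop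
          (𝓝 (inner ℝ u y)) := (hu2 y).comp (tendsto_snd.mono_left prod_atTop_atTop_eq.ge)
      simpa [inner_sub_left] using h1.sub h2
  obtain ⟨u', hu'⟩ := cauchySeq_tendsto_of_complete hcauchy
  have huu : u' = u := ext_inner_right ℝ fun z =>
    tendsto_nhds_unique (hu'.inner tendsto_const_nhds) (hu2 z)
  subst huu
  -- The pointwise convergent subsequence serves only to show that the limit vanishes outside Ω'.
  obtain ⟨ψ, hψ, hae⟩ := (tendstoInMeasure_of_tendsto_Lp hu').exists_seq_tendsto_ae
  refine ⟨(u', G), ⟨?_, ?_⟩, φ₁ ∘ φ₂, hφ, hu', hG⟩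
  · rw [hasWeakGradient_iff_inner]
    intro φ hφ hc v
    refine tendsto_nhds_unique (hu2 _) ?_
    refine Tendsto.congr (fun n => ?_) (hG ((memLp_smul_const hφ hc v).toLp _)).neg
    exact ((hasWeakGradient_iff_inner.1 (hp (φ₁ (φ₂ n))).1) φ hφ hc v).symm
  · have hp' : ∀ᵐ x, ∀ n, x ∉ Ω n → (p n).1 x = 0 := ae_all_iff.2 fun n => (hp n).2
    filter_upwards [hae, hΩ, hp'] with x h1 h2 h3 hx
    have h4 : ∀ᶠ n in atTop, (p (φ₁ (φ₂ (ψ n)))).1 x = 0 := by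
      have h5 := (hφ.comp hψ).tendsto_atTop.eventually (h2 hx)
      filter_upwards [h5] with n hn using h3 _ hn
    refine tendsto_nhds_unique h1 (tendsto_const_nhds.congr' ?_)
    filter_upwards [h4] with n hn using hn.symm

/-! ### Multiplication by smooth cutoffs -/

lemma inner_gradient_eq {η : Space d → ℝ} (x v : Space d) :
    inner ℝ (gradient η x) v = fderiv ℝ η x v := by
  simp [gradient]

lemma norm_gradient_eq {η : Space d → ℝ} (x : Space d) :
    ‖gradient η x‖ = ‖fderiv ℝ η x‖ := by
  simp [gradient]

lemma continuous_gradient {η : Space d → ℝ} (hη : ContDiff ℝ ∞ η) : Continuous (gradient η) :=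
  (InnerProductSpace.toDual ℝ (Space d)).symm.continuous.comp (hη.continuous_fderiv (by simp))

/-- The product rule: a smooth bounded function with bounded derivative acts on `H¹`. -/
lemma exists_mul_gradientPairs {Ω : Set (Space d)} {p : L2 d × L2Field d}
    (hp : p ∈ gradientPairs Ω) {η : Space d → ℝ} (hη : ContDiff ℝ ∞ η) {M K : ℝ}
    (hM : ∀ x, |η x| ≤ M) (hK : ∀ x, ‖fderiv ℝ η x‖ ≤ K) :
    ∃ q ∈ gradientPairs (Ω ∩ {x | η x ≠ 0}), (q.1 =ᵐ[volume] fun x => η x * p.1 x) ∧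
      q.2 =ᵐ[volume] fun x => η x • p.2 x + p.1 x • gradient η x := by
  have hu := Lp.memLp p.1
  have hG := Lp.memLp p.2
  have hgc := continuous_gradient hη
  have h1 : MemLp (fun x => η x * p.1 x) 2 (volume : Measure (Space d)) := by
    refine MemLp.of_le_mul (c := M) hu
      (hη.continuous.aestronglyMeasurable.mul hu.aestronglyMeasurable)
      (Eventually.of_forall fun x => ?_)
    rw [norm_mul]; gcongr; exact hM x
  have h2 : MemLp (fun x => η x • p.2 x) 2 (volume : Measure (Space d)) := by
    refine MemLp.of_le_mul (c := M) hG
      (hη.continuous.aestronglyMeasurable.smul hG.aestronglyMeasurable)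
      (Eventually.of_forall fun x => ?_)
    rw [norm_smul]; gcongr; exact hM x
  have h3 : MemLp (fun x => p.1 x • gradient η x) 2 (volume : Measure (Space d)) := by
    refine MemLp.of_le_mul (c := K) hu
      (hu.aestronglyMeasurable.smul hgc.aestronglyMeasurable)
      (Eventually.of_forall fun x => ?_)
    rw [norm_smul, mul_comm, norm_gradient_eq]; gcongr; exact hK x
  have h4 := h2.add h3
  refine ⟨(h1.toLp _, h4.toLp _), ⟨hasWeakGradient_toLp h1 h4 ?_, ?_⟩, h1.coeFn_toLp, h4.coeFn_toLp⟩
  · intro φ hφ hc v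
    have hηφ : ContDiff ℝ ∞ (fun x => η x * φ x) := hη.mul hφ
    have hηφc : HasCompactSupport (fun x => η x * φ x) := hc.mul_left
    have h5 := hp.1 _ hηφ hηφc v
    have hfd : ∀ x, fderiv ℝ (fun x => η x * φ x) x v =
        η x * fderiv ℝ φ x v + φ x * fderiv ℝ η x v := by
      intro x
      rw [fderiv_fun_mul (hη.differentiable (by simp) x) (hφ.differentiable (by simp) x)]
      simp
    have hi1 : Integrable (fun x => η x * p.1 x * fderiv ℝ φ x v) :=
      MemLp.integrable_mul (p := 2) (q := 2) h1 (memLp_fderiv_apply hφ hc v)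
    have hi2 : Integrable (fun x => inner ℝ (p.1 x • gradient η x) v * φ x) :=
      MemLp.integrable_mul (p := 2) (q := 2) (h3.inner_const v) (memLp_testFunction hφ hc)
    have hi3 : Integrable (fun x => inner ℝ (η x • p.2 x) v * φ x) :=
      MemLp.integrable_mul (p := 2) (q := 2) (h2.inner_const v) (memLp_testFunction hφ hc)
    have e1 : ∫ x, p.1 x * fderiv ℝ (fun x => η x * φ x) x v =
        (∫ x, η x * p.1 x * fderiv ℝ φ x v) + ∫ x, inner ℝ (p.1 x • gradient η x) v * φ x := by
      rw [← integral_add hi1 hi2]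
      refine integral_congr_ae (Eventually.of_forall fun x => ?_)
      beta_reduce
      rw [hfd, real_inner_smul_left, inner_gradient_eq]
      ring
    have e2 : ∫ x, inner ℝ (p.2 x) v * (η x * φ x) = ∫ x, inner ℝ (η x • p.2 x) v * φ x := by
      refine integral_congr_ae (Eventually.of_forall fun x => ?_)
      beta_reduce
      rw [real_inner_smul_left]
      ring
    have e3 : ∫ x, inner ℝ (((fun x => η x • p.2 x) + fun x => p.1 x • gradient η x) x) v * φ x =
        (∫ x, inner ℝ (η x • p.2 x) v * φ x) + ∫ x, inner ℝ (p.1 x • gradient η x) v * φ x := by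
      rw [← integral_add hi3 hi2]
      refine integral_congr_ae (Eventually.of_forall fun x => ?_)
      beta_reduce
      rw [Pi.add_apply, inner_add_left, add_mul]
    rw [e1, e2] at h5
    rw [e3]
    linarith
  · filter_upwards [hp.2, h1.coeFn_toLp] with x hx hx' hx''
    rw [hx']
    by_cases h : x ∈ Ω
    · have : η x = 0 := by
        by_contra h0
        exact hx'' ⟨h, h0⟩
      rw [this, zero_mul]
    · rw [hx h, mul_zero]

/-- The Dirichlet energy of `η u` when `-Δ u = f` in `Ω`. -/
lemma norm_sq_mul_of_resolvent {Ω : Set (Space d)} {p q : L2 d × L2Field d} {f : L2 d}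
    (hp : p ∈ gradientPairs Ω)
    (hf : ∀ r ∈ gradientPairs Ω, inner ℝ p.2 r.2 = inner ℝ f r.1)
    {η : Space d → ℝ} (hη : ContDiff ℝ ∞ η) {K : ℝ}
    (hM : ∀ x, |η x| ≤ 1) (hK : ∀ x, ‖fderiv ℝ η x‖ ≤ K)
    (hq : q.2 =ᵐ[volume] fun x => η x • p.2 x + p.1 x • gradient η x) :
    ‖q.2‖ ^ 2 = (∫ x, f x * (η x ^ 2 * p.1 x)) + ∫ x, p.1 x ^ 2 * ‖fderiv ℝ η x‖ ^ 2 := by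
  have hη2 : ContDiff ℝ ∞ (fun x => η x * η x) := hη.mul hη
  have hfd : ∀ x, fderiv ℝ (fun x => η x * η x) x = (2 * η x) • fderiv ℝ η x := by
    intro x
    rw [fderiv_fun_mul (hη.differentiable (by simp) x) (hη.differentiable (by simp) x), two_mul,
      add_smul]
  have hgr : ∀ x, gradient (fun x => η x * η x) x = (2 * η x) • gradient η x := by
    intro x
    rw [gradient, hfd, map_smulₛₗ]
    rfl
  obtain ⟨r, hr, hr1, hr2⟩ := exists_mul_gradientPairs hp hη2 (M := 1) (K := 2 * K)
    (fun x => by rw [abs_mul]; exact mul_le_one₀ (hM x) (abs_nonneg _) (hM x)) (fun x => by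
      rw [hfd, norm_smul, norm_mul, Real.norm_eq_abs, Real.norm_eq_abs, abs_two]
      have h1 := hM x
      have h2 := hK x
      have : 2 * |η x| ≤ 2 := by linarith
      gcongr)
  -- The equation is tested with η²u. Expanding the squares, |∇(ηu)|² equals ∇u · ∇(η²u) + u²|∇η|²,
  -- because the cross terms agree.
  have h1 := hf r (gradientPairs_mono (Eventually.of_forall fun x hx => hx.1) hr)
  rw [inner_eq_integral_of_ae (ae_eq_refl _) hr1] at h1
  have hu := Lp.memLp p.1
  have hint : Integrable (fun x => p.1 x ^ 2 * ‖fderiv ℝ η x‖ ^ 2) := by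
    refine (hu.integrable_sq).mul_bdd (c := K ^ 2) ?_ (Eventually.of_forall fun x => ?_)
    · exact ((hη.continuous_fderiv (by simp)).norm.pow 2).aestronglyMeasurable
    · rw [norm_pow, norm_norm]; gcongr; exact hK x
  have e1 : ∫ x, f x * (η x ^ 2 * p.1 x) = inner ℝ p.2 r.2 := by
    rw [h1]
    refine integral_congr_ae (Eventually.of_forall fun x => ?_)
    beta_reduce
    ring
  rw [e1, ← real_inner_self_eq_norm_sq, L2.inner_def, L2.inner_def, ← integral_add _ hint]
  · refine integral_congr_ae ?_
    filter_upwards [hq, hr2] with x hx hx'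
    rw [hx, hx', hgr, ← norm_gradient_eq]
    simp only [inner_add_left, inner_add_right, real_inner_smul_left, real_inner_smul_right,
      real_inner_self_eq_norm_sq, real_inner_comm (p.2 x) (gradient η x), norm_smul, mul_pow,
      Real.norm_eq_abs, sq_abs]
    ring
  · exact L2.integrable_inner _ _

/-! ### Min-max theory for an abstract closed quadratic form -/

section Abstract

variable {H K : Type*} [NormedAddCommGroup H] [InnerProductSpace ℝ H] [NormedAddCommGroup K]
  [InnerProductSpace ℝ K]

/-- Bounded sequences of pairs `p n ∈ 𝒢 n` have subsequences converging in `𝒢'`, strongly in the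
first and weakly in the second component. -/
def CompactPairs (𝒢 : ℕ → Submodule ℝ (H × K)) (𝒢' : Submodule ℝ (H × K)) : Prop :=
  ∀ φ : ℕ → ℕ, StrictMono φ → ∀ (p : ℕ → H × K) (C : ℝ), (∀ n, p n ∈ 𝒢 (φ n)) →
    (∀ n, ‖(p n).1‖ ≤ C) → (∀ n, ‖(p n).2‖ ≤ C) →
    ∃ q ∈ 𝒢', ∃ ψ : ℕ → ℕ, StrictMono ψ ∧ Tendsto (fun n => (p (ψ n)).1) atTop (𝓝 q.1) ∧
      ∀ V, Tendsto (fun n => inner ℝ (p (ψ n)).2 V) atTop (𝓝 (inner ℝ q.2 V))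

/-- There is a `k`-dimensional space on which the Rayleigh quotient is at most `l`. -/
def HasTestSpace (𝒢 : Submodule ℝ (H × K)) (k : ℕ) (l : ℝ) : Prop :=
  ∃ p : Fin k → H × K, (∀ i, p i ∈ 𝒢) ∧ LinearIndependent ℝ (fun i => (p i).1) ∧
    ∀ α : Fin k → ℝ, ‖∑ i, α i • (p i).2‖ ^ 2 ≤ l * ‖∑ i, α i • (p i).1‖ ^ 2

/-- An orthonormal family of eigenvectors with eigenvalues at most `l`. -/
structure IsEigenSystem (𝒢 : Submodule ℝ (H × K)) (l : ℝ) {k : ℕ} (p : Fin k → H × K)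
    (μ : Fin k → ℝ) : Prop where
  mem : ∀ i, p i ∈ 𝒢
  orthonormal : Orthonormal ℝ (fun i => (p i).1)
  nonneg : ∀ i, 0 ≤ μ i
  le : ∀ i, μ i ≤ l
  inner_eq : ∀ i, ∀ r ∈ 𝒢, inner ℝ (p i).2 r.2 = μ i * inner ℝ (p i).1 r.1

lemma HasTestSpace.mono {𝒢 𝒢' : Submodule ℝ (H × K)} {k : ℕ} {l l' : ℝ}
    (h : HasTestSpace 𝒢 k l) (h𝒢 : 𝒢 ≤ 𝒢') (hl : l ≤ l') : HasTestSpace 𝒢' k l' := by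
  obtain ⟨p, hp, hi, hα⟩ := h
  exact ⟨p, fun i => h𝒢 (hp i), hi, fun α => (hα α).trans (by gcongr)⟩

lemma eq_zero_of_quadratic_nonneg {a b : ℝ} (h : ∀ t : ℝ, 0 ≤ a * t ^ 2 + b * t) : b = 0 := by
  by_contra hb
  have hpos : 0 < |a| + 1 := by positivity
  have h1 := h (-b / (2 * (|a| + 1)))
  have h2 : a * (-b / (2 * (|a| + 1))) ^ 2 + b * (-b / (2 * (|a| + 1))) =
      (b ^ 2 / (4 * (|a| + 1) ^ 2)) * (a - 2 * (|a| + 1)) := by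
    field_simp
    ring
  rw [h2] at h1
  have h3 : 0 < b ^ 2 / (4 * (|a| + 1) ^ 2) := by positivity
  have h4 : a - 2 * (|a| + 1) < 0 := by linarith [le_abs_self a, abs_nonneg a]
  linarith [mul_neg_of_pos_of_neg h3 h4]

/-- The Dirichlet energy attains its minimum on the unit sphere of the orthogonal complement of
`W`. -/
lemma exists_minimizer {𝒢 : Submodule ℝ (H × K)} (hc : CompactPairs (fun _ => 𝒢) 𝒢)
    (W : Submodule ℝ H) {p₀ : H × K} (hp₀ : p₀ ∈ 𝒢) (hW : p₀.1 ∈ Wᗮ) (h1 : ‖p₀.1‖ = 1) :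
    ∃ q ∈ 𝒢, q.1 ∈ Wᗮ ∧ ‖q.1‖ = 1 ∧ ‖q.2‖ ≤ ‖p₀.2‖ ∧
      ∀ r ∈ 𝒢, r.1 ∈ Wᗮ → inner ℝ q.2 r.2 = ‖q.2‖ ^ 2 * inner ℝ q.1 r.1 := by
  set S : Set ℝ := {t | ∃ p ∈ 𝒢, p.1 ∈ Wᗮ ∧ ‖p.1‖ = 1 ∧ ‖p.2‖ = t}
  have hSne : S.Nonempty := ⟨_, p₀, hp₀, hW, h1, rfl⟩
  have hSb : BddBelow S := ⟨0, by rintro t ⟨p, -, -, -, rfl⟩; exact norm_nonneg _⟩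
  set m := sInf S
  obtain ⟨t, -, ht, htS⟩ := exists_seq_tendsto_sInf hSne hSb
  choose p hp hpW hp1 hpt using htS
  obtain ⟨C, hC⟩ := ht.bddAbove_range
  obtain ⟨q, hq, ψ, hψ, hu, hG⟩ := hc id strictMono_id p (max C 1) hp
    (fun n => by rw [hp1]; exact le_max_right _ _)
    (fun n => by rw [hpt]; exact (hC ⟨n, rfl⟩).trans (le_max_left _ _))
  have hqW : q.1 ∈ Wᗮ := (Submodule.isClosed_orthogonal W).mem_of_tendsto hu
    (Eventually.of_forall fun n => hpW _)
  have hq1 : ‖q.1‖ = 1 := tendsto_nhds_unique hu.norm (by simp [hp1])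
  have hqm : ‖q.2‖ ≤ m := norm_le_of_weak_limit hG (fun n => le_refl _)
    ((ht.comp hψ.tendsto_atTop).congr fun n => (hpt _).symm)
  have hm0 : 0 ≤ m := (norm_nonneg _).trans hqm
  have hqm' : ‖q.2‖ = m := le_antisymm hqm (csInf_le hSb ⟨q, hq, hqW, hq1, rfl⟩)
  -- By homogeneity the minimum on the unit sphere is a Rayleigh bound on the whole orthogonal
  -- complement.
  have hray : ∀ r ∈ 𝒢, r.1 ∈ Wᗮ → m * ‖r.1‖ ≤ ‖r.2‖ := by
    intro r hr hrW
    rcases eq_or_ne r.1 0 with h0 | h0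
    · simp [h0]
    · have hpos : 0 < ‖r.1‖ := norm_pos_iff.2 h0
      have : m ≤ ‖r.1‖⁻¹ * ‖r.2‖ := by
        refine csInf_le hSb ⟨‖r.1‖⁻¹ • r, 𝒢.smul_mem _ hr, Wᗮ.smul_mem _ hrW, ?_, ?_⟩
        · rw [Prod.smul_fst, norm_smul, norm_inv, norm_norm, inv_mul_cancel₀ hpos.ne']
        · rw [Prod.smul_snd, norm_smul, norm_inv, norm_norm]
      rwa [inv_mul_eq_div, le_div_iff₀ hpos] at this
  refine ⟨q, hq, hqW, hq1, hqm.trans (csInf_le hSb ⟨p₀, hp₀, hW, h1, rfl⟩), fun r hr hrW => ?_⟩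
  -- Along q + t r, energy minus m² times mass is a nonnegative quadratic polynomial in t without
  -- constant term. Its linear coefficient vanishes, which is the Euler-Lagrange equation.
  have := eq_zero_of_quadratic_nonneg (a := ‖r.2‖ ^ 2 - m ^ 2 * ‖r.1‖ ^ 2)
    (b := 2 * (inner ℝ q.2 r.2 - m ^ 2 * inner ℝ q.1 r.1)) fun t => ?_
  · rw [hqm']; linarith
  · have h2 := hray (q + t • r) (𝒢.add_mem hq (𝒢.smul_mem t hr))
      (Wᗮ.add_mem hqW (Wᗮ.smul_mem t hrW))
    have h3 : (m * ‖(q + t • r).1‖) ^ 2 ≤ ‖(q + t • r).2‖ ^ 2 := by gcongr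
    rw [mul_pow, Prod.fst_add, Prod.snd_add, norm_add_sq_real, norm_add_sq_real, Prod.smul_fst,
      Prod.smul_snd, inner_smul_right, inner_smul_right, norm_smul, norm_smul, hq1, hqm', mul_pow,
      mul_pow, Real.norm_eq_abs, sq_abs] at h3
    nlinarith

/-- Eigenpairs are produced one at a time. While fewer than k are known, the test space contains a
nonzero vector orthogonal to them, so the minimum of the Rayleigh quotient on their orthogonal
complement is at most l, and a minimiser is the next eigenvector. -/
lemma HasTestSpace.exists_isEigenSystem {𝒢 : Submodule ℝ (H × K)}
    (hc : CompactPairs (fun _ => 𝒢) 𝒢) {k : ℕ} {l : ℝ} (h : HasTestSpace 𝒢 k l) :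
    ∃ (p : Fin k → H × K) (μ : Fin k → ℝ), IsEigenSystem 𝒢 l p μ := by
  obtain ⟨w, hw, hwi, hwα⟩ := h
  suffices ∀ j ≤ k, ∃ (p : Fin j → H × K) (μ : Fin j → ℝ), IsEigenSystem 𝒢 l p μ from this k le_rfl
  intro j
  induction j with
  | zero =>
    intro _
    refine ⟨fun i => i.elim0, fun i => i.elim0, ?_, orthonormal_iff_ite.2 ?_, ?_, ?_, ?_⟩ <;>
      exact fun i => i.elim0
  | succ j ih =>
    intro hj
    obtain ⟨p, μ, hp⟩ := ih (by omega)
    set W : Submodule ℝ H := Submodule.span ℝ (range fun i => (p i).1)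
    have hWmem : ∀ v : H, v ∈ Wᗮ ↔ ∀ i, inner ℝ (p i).1 v = 0 := by
      intro v
      constructor
      · intro hv i
        exact (Submodule.mem_orthogonal W v).1 hv _ (Submodule.subset_span (mem_range_self i))
      · intro hv
        rw [Submodule.mem_orthogonal]
        intro u hu
        induction hu using Submodule.span_induction with
        | mem x hx => obtain ⟨i, rfl⟩ := hx; exact hv i
        | zero => simp
        | add x y _ _ hx hy => rw [inner_add_left, hx, hy, add_zero]
        | smul c x _ hx => rw [real_inner_smul_left, hx, mul_zero]
    let T : (Fin k → ℝ) →ₗ[ℝ] (Fin j → ℝ) :=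
      { toFun := fun α i => inner ℝ (p i).1 (∑ l, α l • (w l).1)
        map_add' := fun α β => by
          ext i; simp [add_smul, Finset.sum_add_distrib, inner_add_right]
        map_smul' := fun c α => by
          ext i; simp [mul_smul, ← Finset.smul_sum, inner_smul_right] }
    -- Orthogonality to j vectors imposes j linear conditions on k > j coefficients.
    have hker : LinearMap.ker T ≠ ⊥ := LinearMap.ker_ne_bot_of_finrank_lt (by simp; omega)
    obtain ⟨α, hα, hα0⟩ := Submodule.exists_mem_ne_zero_of_ne_bot hker
    set r₀ : H × K := ∑ l, α l • w l
    have hr₀ : r₀ ∈ 𝒢 := 𝒢.sum_mem fun i _ => 𝒢.smul_mem _ (hw i)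
    have hfst : r₀.1 = ∑ l, α l • (w l).1 := by simp [r₀, Prod.fst_sum]
    have hsnd : r₀.2 = ∑ l, α l • (w l).2 := by simp [r₀, Prod.snd_sum]
    have hr₀1 : r₀.1 ≠ 0 := by
      intro h0
      apply hα0
      rw [hfst] at h0
      ext i
      exact (Fintype.linearIndependent_iff.1 hwi α h0) i
    have hpos : 0 < ‖r₀.1‖ := norm_pos_iff.2 hr₀1
    have hr₀W : r₀.1 ∈ Wᗮ := by
      rw [hWmem]
      intro i
      rw [hfst]
      exact congrFun (LinearMap.mem_ker.1 hα) i
    obtain ⟨q, hq, hqW, hq1, hqle, hqEL⟩ := exists_minimizer hc W (p₀ := ‖r₀.1‖⁻¹ • r₀)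
      (𝒢.smul_mem _ hr₀) (Wᗮ.smul_mem _ hr₀W)
      (by rw [Prod.smul_fst, norm_smul, norm_inv, norm_norm, inv_mul_cancel₀ hpos.ne'])
    have hql : ‖q.2‖ ^ 2 ≤ l := by
      have h1 : ‖q.2‖ ^ 2 ≤ (‖r₀.1‖⁻¹ * ‖r₀.2‖) ^ 2 := by
        rw [Prod.smul_snd, norm_smul, norm_inv, norm_norm] at hqle
        gcongr
      have h2 := hwα α
      rw [← hfst, ← hsnd] at h2
      refine h1.trans ?_
      rw [mul_pow, inv_pow, inv_mul_eq_div, div_le_iff₀ (by positivity)]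
      exact h2
    have hEL : ∀ r ∈ 𝒢, inner ℝ q.2 r.2 = ‖q.2‖ ^ 2 * inner ℝ q.1 r.1 := by
      intro r hr
      set c : Fin j → ℝ := fun i => inner ℝ (p i).1 r.1
      -- The minimiser satisfies its equation only against the orthogonal complement. Removing the
      -- projection loses nothing, since the earlier eigenvectors are orthogonal to q both in H and,
      -- by their own equations, in energy.
      set r' := r - ∑ i, c i • p i with hr'
      have hr'𝒢 : r' ∈ 𝒢 := 𝒢.sub_mem hr (𝒢.sum_mem fun i _ => 𝒢.smul_mem _ (hp.mem i))
      have hf : r'.1 = r.1 - ∑ i, c i • (p i).1 := by simp [hr', Prod.fst_sum]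
      have hs : r'.2 = r.2 - ∑ i, c i • (p i).2 := by simp [hr', Prod.snd_sum]
      have hr'W : r'.1 ∈ Wᗮ := by
        rw [hWmem]
        intro i
        rw [hf, inner_sub_right, hp.orthonormal.inner_right_fintype, sub_self]
      have h1 := hqEL r' hr'𝒢 hr'W
      have h2 : ∀ i, inner ℝ q.1 (p i).1 = 0 := fun i => by
        rw [real_inner_comm]; exact (hWmem _).1 hqW i
      have h3 : ∀ i, inner ℝ q.2 (p i).2 = 0 := fun i => by
        rw [real_inner_comm, hp.inner_eq i q hq, real_inner_comm, h2, mul_zero]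
      rw [hf, hs, inner_sub_right, inner_sub_right, inner_sum, inner_sum] at h1
      simpa [inner_smul_right, h2, h3] using h1
    refine ⟨Fin.snoc p q, Fin.snoc μ (‖q.2‖ ^ 2), ?_, ?_, ?_, ?_, ?_⟩
    · refine Fin.lastCases ?_ fun i => ?_
      · simpa using hq
      · simpa using hp.mem i
    · rw [orthonormal_iff_ite]
      have h2 : ∀ i, inner ℝ (p i).1 q.1 = 0 := (hWmem _).1 hqW
      have h0 := orthonormal_iff_ite.1 hp.orthonormal
      refine Fin.lastCases ?_ fun i => ?_
      · refine Fin.lastCases ?_ fun i' => ?_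
        · simp [hq1]
        · simp only [Fin.snoc_last, Fin.snoc_castSucc]
          rw [if_neg (Fin.castSucc_lt_last i').ne', real_inner_comm, h2]
      · refine Fin.lastCases ?_ fun i' => ?_
        · simp only [Fin.snoc_last, Fin.snoc_castSucc]
          rw [if_neg (Fin.castSucc_lt_last i).ne, h2]
        · simp only [Fin.snoc_castSucc, Fin.castSucc_inj]
          exact h0 i i'
    · refine Fin.lastCases ?_ fun i => ?_
      · simp
      · simpa using hp.nonneg i
    · refine Fin.lastCases ?_ fun i => ?_
      · simpa using hql
      · simpa using hp.le i
    · refine Fin.lastCases ?_ fun i => ?_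
      · simpa using hEL
      · simpa using hp.inner_eq i

/-- The eigenvectors need not be orthonormal, which matches the definition of the resolvent
eigenvalues. By symmetry of the form, those with different eigenvalues are orthogonal, so in the
Gram matrix weighted by l - μ i this weight may be replaced by √(l - μ i) √(l - μ j). The defect
l‖u‖² - ‖∇u‖² then becomes the square of a norm. -/
lemma hasTestSpace_of_eigenvectors {𝒢 : Submodule ℝ (H × K)} {k : ℕ} {l : ℝ}
    {p : Fin k → H × K} {μ : Fin k → ℝ} (hp : ∀ i, p i ∈ 𝒢)
    (hi : LinearIndependent ℝ (fun i => (p i).1)) (hμ : ∀ i, μ i ≤ l)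
    (hEL : ∀ i, ∀ r ∈ 𝒢, inner ℝ (p i).2 r.2 = μ i * inner ℝ (p i).1 r.1) :
    HasTestSpace 𝒢 k l := by
  refine ⟨p, hp, hi, fun α => ?_⟩
  have h1 : ∀ i j, (l - μ i) * inner ℝ (p i).1 (p j).1 =
      √(l - μ i) * √(l - μ j) * inner ℝ (p i).1 (p j).1 := by
    intro i j
    have h2 := hEL i (p j) (hp j)
    have h3 := hEL j (p i) (hp i)
    rw [real_inner_comm, h2, real_inner_comm (p i).1] at h3
    rcases eq_or_ne (inner ℝ (p i).1 (p j).1) 0 with h0 | h0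
    · simp [h0]
    · rw [mul_right_cancel₀ h0 h3, Real.mul_self_sqrt (sub_nonneg.2 (hμ j))]
  have h2 : 0 ≤ ‖∑ i, (α i * √(l - μ i)) • (p i).1‖ ^ 2 := sq_nonneg _
  have h3 : ‖∑ i, (α i * √(l - μ i)) • (p i).1‖ ^ 2 =
      l * ‖∑ i, α i • (p i).1‖ ^ 2 - ‖∑ i, α i • (p i).2‖ ^ 2 := by
    simp only [← real_inner_self_eq_norm_sq, sum_inner, inner_sum, real_inner_smul_left,
      real_inner_smul_right, Finset.mul_sum, ← Finset.sum_sub_distrib]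
    refine Finset.sum_congr rfl fun i _ => Finset.sum_congr rfl fun j _ => ?_
    rw [hEL j (p i) (hp i)]
    linear_combination (-(α i * α j)) * h1 j i
  linarith

lemma IsEigenSystem.hasTestSpace {𝒢 : Submodule ℝ (H × K)} {k : ℕ} {l : ℝ}
    {p : Fin k → H × K} {μ : Fin k → ℝ} (hp : IsEigenSystem 𝒢 l p μ) : HasTestSpace 𝒢 k l :=
  hasTestSpace_of_eigenvectors hp.mem hp.orthonormal.linearIndependent hp.le hp.inner_eq

lemma exists_common_subsequence {k : ℕ} (P : Fin k → (ℕ → ℕ) → Prop)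
    (hP : ∀ (i : Fin k) (φ ψ : ℕ → ℕ), StrictMono ψ → P i φ → P i (φ ∘ ψ))
    (hex : ∀ (i : Fin k) (φ : ℕ → ℕ), StrictMono φ → ∃ ψ : ℕ → ℕ, StrictMono ψ ∧ P i (φ ∘ ψ)) :
    ∃ φ : ℕ → ℕ, StrictMono φ ∧ ∀ i, P i φ := by
  suffices ∀ s : Finset (Fin k), ∃ φ : ℕ → ℕ, StrictMono φ ∧ ∀ i ∈ s, P i φ by
    obtain ⟨φ, h1, h2⟩ := this Finset.univ
    exact ⟨φ, h1, fun i => h2 i (Finset.mem_univ i)⟩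
  intro s
  induction s using Finset.induction_on with
  | empty => exact ⟨id, strictMono_id, by simp⟩
  | insert a s _ ih =>
    obtain ⟨φ, hφ, h⟩ := ih
    obtain ⟨ψ, hψ, h'⟩ := hex a φ hφ
    refine ⟨φ ∘ ψ, hφ.comp hψ, fun i hi => ?_⟩
    rcases Finset.mem_insert.1 hi with rfl | hi
    · exact h'
    · exact hP i φ ψ hψ (h i hi)

/-- Lower semicontinuity of the eigenvalues. -/
lemma hasTestSpace_of_limit {𝒢 : ℕ → Submodule ℝ (H × K)} {𝒢' : Submodule ℝ (H × K)}
    (hc : CompactPairs 𝒢 𝒢') {k : ℕ} {l : ℕ → ℝ} {l' : ℝ} (hl : Tendsto l atTop (𝓝 l'))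
    {p : ℕ → Fin k → H × K} {μ : ℕ → Fin k → ℝ} (hp : ∀ n, IsEigenSystem (𝒢 n) (l n) (p n) (μ n)) :
    HasTestSpace 𝒢' k l' := by
  obtain ⟨C, hC⟩ := hl.bddAbove_range
  have hb1 : ∀ n i, ‖(p n i).1‖ ≤ max 1 √C := fun n i => by
    rw [(hp n).orthonormal.1 i]; exact le_max_left _ _
  have hb2 : ∀ n i, ‖(p n i).2‖ ≤ max 1 √C := fun n i => by
    refine le_trans ?_ (le_max_right _ _)
    apply Real.le_sqrt_of_sq_le
    rw [← real_inner_self_eq_norm_sq, (hp n).inner_eq i _ ((hp n).mem i),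
      real_inner_self_eq_norm_sq, (hp n).orthonormal.1 i]
    have := hC ⟨n, rfl⟩
    linarith [(hp n).le i]
  obtain ⟨φ, hφ, hφP⟩ := exists_common_subsequence
    (fun (i : Fin k) φ => ∃ q ∈ 𝒢', Tendsto (fun n => (p (φ n) i).1) atTop (𝓝 q.1) ∧
      ∀ V, Tendsto (fun n => inner ℝ (p (φ n) i).2 V) atTop (𝓝 (inner ℝ q.2 V)))
    (by
      rintro i φ ψ hψ ⟨q, hq, h1, h2⟩
      exact ⟨q, hq, h1.comp hψ.tendsto_atTop, fun V => (h2 V).comp hψ.tendsto_atTop⟩)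
    (by
      intro i φ hφ
      obtain ⟨q, hq, ψ, hψ, h⟩ := hc φ hφ (fun n => p (φ n) i) _ (fun n => (hp (φ n)).mem i)
        (fun n => hb1 _ i) (fun n => hb2 _ i)
      exact ⟨ψ, hψ, q, hq, h⟩)
  choose q hq hq1 hq2 using hφP
  -- Strong convergence of the first components preserves orthonormality, so no dimension is lost.
  -- For the second components weak convergence and lower semicontinuity of the norm suffice.
  have hon : Orthonormal ℝ (fun i => (q i).1) := by
    rw [orthonormal_iff_ite]
    intro i j
    refine tendsto_nhds_unique ((hq1 i).inner (hq1 j)) ?_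
    refine tendsto_const_nhds.congr fun n => ?_
    exact (orthonormal_iff_ite.1 (hp (φ n)).orthonormal i j).symm
  refine ⟨q, hq, hon.linearIndependent, fun α => ?_⟩
  have hn : ∀ {u : Fin k → H}, Orthonormal ℝ u → ‖∑ i, α i • u i‖ ^ 2 = ∑ i, α i ^ 2 := by
    intro u hu
    rw [← real_inner_self_eq_norm_sq, hu.inner_sum]
    simp [sq]
  have hts := fun n => (hp n).hasTestSpace
  have hbd : ∀ n, ‖∑ i, α i • (p (φ n) i).2‖ ≤ √(l (φ n) * ∑ i, α i ^ 2) := by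
    intro n
    apply Real.le_sqrt_of_sq_le
    simp only [← real_inner_self_eq_norm_sq, sum_inner, inner_sum, real_inner_smul_left,
      real_inner_smul_right, (hp (φ n)).inner_eq _ _ ((hp (φ n)).mem _)]
    simp only [orthonormal_iff_ite.1 (hp (φ n)).orthonormal, mul_ite, mul_one, mul_zero,
      Finset.mul_sum]
    refine Finset.sum_le_sum fun i _ => ?_
    rw [Finset.sum_ite_eq' Finset.univ i]
    simp only [Finset.mem_univ, if_true]
    have := mul_le_mul_of_nonneg_right ((hp (φ n)).le i) (sq_nonneg (α i))
    linarith
  have hlim : ‖∑ i, α i • (q i).2‖ ≤ √(l' * ∑ i, α i ^ 2) := by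
    refine norm_le_of_weak_limit (l := atTop) (x := fun n => ∑ i, α i • (p (φ n) i).2) ?_ hbd ?_
    · intro z
      simp only [sum_inner, real_inner_smul_left]
      exact tendsto_finsetSum _ fun i _ => (hq2 i z).const_mul (α i)
    · exact ((hl.comp hφ.tendsto_atTop).mul_const _).sqrt
  rw [hn hon]
  have h0 : 0 ≤ l' * ∑ i, α i ^ 2 := by
    refine ge_of_tendsto' ((hl.comp hφ.tendsto_atTop).mul_const (∑ i, α i ^ 2)) fun n => ?_
    -- For k = 0 the sign of l is unknown, but the sum is empty.
    rcases k.eq_zero_or_pos with rfl | hk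
    · simp
    · have : 0 ≤ l (φ n) := ((hp (φ n)).nonneg ⟨0, hk⟩).trans ((hp (φ n)).le ⟨0, hk⟩)
      exact mul_nonneg this (Finset.sum_nonneg fun i _ => sq_nonneg _)
  calc ‖∑ i, α i • (q i).2‖ ^ 2 ≤ (√(l' * ∑ i, α i ^ 2)) ^ 2 := by gcongr
    _ = _ := Real.sq_sqrt h0

end Abstract

/-! ### From test spaces to the eigenvalues of the resolvent -/

lemma compactPairs_gradientPairs {A : Set (Space d)} (hA : volume A < ⊤) {Ω : ℕ → Set (Space d)}
    {Ω' : Set (Space d)} (hΩA : ∀ n, ∀ᵐ x, x ∈ Ω n → x ∈ A)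
    (hΩ : ∀ᵐ x, x ∉ Ω' → ∀ᶠ n in atTop, x ∉ Ω n) :
    CompactPairs (fun n => gradientPairs (Ω n)) (gradientPairs Ω') := by
  intro φ hφ p C hp h1 h2
  refine exists_limit_gradientPairs hA (Ω := Ω ∘ φ) (fun n => hΩA _) ?_ hp h1 h2
  filter_upwards [hΩ] with x hx hx' using hφ.tendsto_atTop.eventually (hx hx')

lemma compactPairs_gradientPairs_self {Ω : Set (Space d)} (hΩ : volume Ω < ⊤) :
    CompactPairs (fun _ => gradientPairs Ω) (gradientPairs Ω) :=
  compactPairs_gradientPairs hΩ (fun _ => Eventually.of_forall fun _ h => h)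
    (Eventually.of_forall fun _ h => Eventually.of_forall fun _ => h)

lemma eq_zero_of_gradient_eq_zero (hd : d ≠ 0) {Ω : Set (Space d)} (hΩ : volume Ω < ⊤)
    {p : L2 d × L2Field d} (hp : p ∈ gradientPairs Ω) (h0 : p.2 = 0) : p.1 = 0 := by
  obtain ⟨C, hC, h⟩ := exists_norm_le_of_hasWeakGradient hd
  have := h p.1 p.2 Ω _ hp.1 hp.2 ENNReal.toReal_nonneg (ENNReal.ofReal_toReal hΩ.ne).ge
  rw [h0, norm_zero, mul_zero] at this
  exact norm_le_zero_iff.1 this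

/-- By Faber-Krahn a function with zero gradient and support of finite measure vanishes. Hence
Dirichlet eigenvalues can be inverted to resolvent eigenvalues. -/
lemma IsEigenSystem.pos (hd : d ≠ 0) {Ω : Set (Space d)} (hΩ : volume Ω < ⊤) {k : ℕ} {l : ℝ}
    {p : Fin k → L2 d × L2Field d} {μ : Fin k → ℝ} (hp : IsEigenSystem (gradientPairs Ω) l p μ)
    (i : Fin k) : 0 < μ i := by
  refine (hp.nonneg i).lt_of_ne fun h0 => ?_
  have h1 := hp.inner_eq i _ (hp.mem i)
  rw [← h0, zero_mul, inner_self_eq_zero] at h1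
  have h2 := eq_zero_of_gradient_eq_zero hd hΩ (hp.mem i) h1
  have h3 : ‖(p i).1‖ = 1 := hp.orthonormal.1 i
  rw [h2, norm_zero] at h3
  exact zero_ne_one h3

lemma eigenvalue_le_of_hasTestSpace (hd : d ≠ 0) {Ω : Set (Space d)} (hΩ : volume Ω < ⊤) {k : ℕ}
    {l : ℝ} (hl : 0 < l) (h : HasTestSpace (gradientPairs Ω) k l) :
    eigenvalue k Ω ≤ ENNReal.ofReal l := by
  obtain ⟨p, μ, hp⟩ := h.exists_isEigenSystem (compactPairs_gradientPairs_self hΩ)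
  have h1 : ENNReal.ofReal l⁻¹ ≤ resolventEigenvalue k Ω := by
    refine le_iSup₂_of_le (l⁻¹).toNNReal ⟨fun i => (p i).1, hp.orthonormal.linearIndependent,
      fun i => ⟨(μ i)⁻¹, ?_, ?_⟩⟩ le_rfl
    · rw [Real.coe_toNNReal _ (by positivity)]
      exact inv_anti₀ (hp.pos hd hΩ i) (hp.le i)
    · have hm : (μ i)⁻¹ • p i ∈ gradientPairs Ω := Submodule.smul_mem _ _ (hp.mem i)
      refine ⟨mem_H10_iff.2 ⟨_, hm⟩, _, hm.1, fun v hv V hV => ?_⟩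
      have := hp.inner_eq i (v, V) ⟨hV, hv.2⟩
      rw [Prod.smul_snd, real_inner_smul_left, this,
        inv_mul_cancel_left₀ (hp.pos hd hΩ i).ne']
  rw [eigenvalue, ENNReal.inv_le_iff_inv_le, ← ENNReal.ofReal_inv_of_pos hl]
  exact h1

/-- The resolvent eigenvalue is defined as a supremum that is not known to be attained. Each l' > l
has eigenvectors beyond 1/l', hence a test space, and letting l' decrease to l uses the
semicontinuity `hasTestSpace_of_limit` on the constant sequence Ω. -/
lemma exists_isEigenSystem_of_eigenvalue_le {Ω : Set (Space d)} (hΩ : volume Ω < ⊤)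
    {k : ℕ} {l : ℝ} (hl : 0 < l) (h : eigenvalue k Ω ≤ ENNReal.ofReal l) :
    ∃ (p : Fin k → L2 d × L2Field d) (μ : Fin k → ℝ), IsEigenSystem (gradientPairs Ω) l p μ := by
  have hts : ∀ l' > l, HasTestSpace (gradientPairs Ω) k l' := by
    intro l' hl'
    have hl'0 : 0 < l' := hl.trans hl'
    have h1 : ENNReal.ofReal l'⁻¹ < resolventEigenvalue k Ω := by
      rw [eigenvalue, ENNReal.inv_le_iff_inv_le, ← ENNReal.ofReal_inv_of_pos hl] at h
      refine lt_of_lt_of_le ?_ h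
      rw [ENNReal.ofReal_lt_ofReal_iff (by positivity)]
      exact inv_strictAnti₀ hl hl'
    simp only [resolventEigenvalue, lt_iSup_iff] at h1
    obtain ⟨Λ, ⟨f, hf, hμ⟩, hΛ⟩ := h1
    choose μ hμΛ hres using hμ
    choose hmem G hG hEL using hres
    have hΛ' : l'⁻¹ < Λ := by
      rw [ENNReal.ofReal_lt_iff_lt_toReal (by positivity) ENNReal.coe_ne_top] at hΛ
      simpa using hΛ
    have hμpos : ∀ i, 0 < μ i := fun i => lt_of_lt_of_le (by positivity) (hΛ'.le.trans (hμΛ i))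
    have hp : ∀ i, (f i, (μ i)⁻¹ • G i) ∈ gradientPairs Ω := by
      intro i
      have h2 : (μ i • f i, G i) ∈ gradientPairs Ω := ⟨hG i, (hmem i).2⟩
      have h3 := Submodule.smul_mem _ (μ i)⁻¹ h2
      rwa [Prod.smul_mk, inv_smul_smul₀ (hμpos i).ne'] at h3
    refine hasTestSpace_of_eigenvectors (p := fun i => (f i, (μ i)⁻¹ • G i))
      (μ := fun i => (μ i)⁻¹) hp hf (fun i => ?_) fun i r hr => ?_
    · rw [inv_le_comm₀ (hμpos i) hl'0]
      exact hΛ'.le.trans (hμΛ i)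
    · rw [real_inner_smul_left, hEL i r.1 (mem_H10_iff.2 ⟨_, hr⟩) r.2 hr.1]
  have hlim : Tendsto (fun n : ℕ => l + 1 / ((n : ℝ) + 1)) atTop (𝓝 l) := by
    simpa using tendsto_one_div_add_atTop_nhds_zero_nat.const_add l
  choose p μ hp using fun n : ℕ => (hts (l + 1 / ((n : ℝ) + 1))
    (by have : 0 < 1 / ((n : ℝ) + 1) := by positivity
        linarith)).exists_isEigenSystem (compactPairs_gradientPairs_self hΩ)
  exact (hasTestSpace_of_limit (compactPairs_gradientPairs_self hΩ) hlim hp).exists_isEigenSystem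
    (compactPairs_gradientPairs_self hΩ)

/-! ### Perimeter: isoperimetric inequality, semicontinuity, compactness -/

/-- The test fields in the definition of the perimeter. -/
def IsTestField (φ : Space d → Space d) : Prop :=
  ContDiff ℝ 1 φ ∧ HasCompactSupport φ ∧ ∀ x, ‖φ x‖ ≤ 1

lemma isTestField_zero : IsTestField (0 : Space d → Space d) :=
  ⟨contDiff_const, HasCompactSupport.zero, by simp⟩

lemma perimeter_le_iff {Ω : Set (Space d)} {p : ℝ} (hp : 0 ≤ p) :
    perimeter Ω ≤ ENNReal.ofReal p ↔ ∀ φ, IsTestField φ → ∫ x in Ω, divergence φ x ≤ p := by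
  simp only [perimeter, iSup_le_iff, ENNReal.ofReal_le_ofReal_iff hp]
  rfl

lemma sum_mul_single (L : Space d →L[ℝ] ℝ) (v : Space d) :
    ∑ i, L (EuclideanSpace.single i 1) * v i = L v := by
  conv_rhs => rw [← (EuclideanSpace.basisFun (Fin d) ℝ).sum_repr v]
  simp [map_sum, mul_comm]

lemma divergence_smul {η : Space d → ℝ} {φ : Space d → Space d} {x : Space d}
    (hη : DifferentiableAt ℝ η x) (hφ : DifferentiableAt ℝ φ x) :
    divergence (fun x => η x • φ x) x = η x * divergence φ x + fderiv ℝ η x (φ x) := by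
  simp only [divergence]
  rw [fderiv_fun_smul hη hφ, ← sum_mul_single (fderiv ℝ η x) (φ x), Finset.mul_sum,
    ← Finset.sum_add_distrib]
  simp

lemma divergence_add {φ ψ : Space d → Space d} {x : Space d}
    (hφ : DifferentiableAt ℝ φ x) (hψ : DifferentiableAt ℝ ψ x) :
    divergence (fun x => φ x + ψ x) x = divergence φ x + divergence ψ x := by
  simp only [divergence]
  rw [fderiv_fun_add hφ hψ, ← Finset.sum_add_distrib]
  simp

lemma divergence_const_smul_field {ψ : Space d → ℝ} {x : Space d} (hψ : DifferentiableAt ℝ ψ x)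
    (v : Space d) : divergence (fun x => ψ x • v) x = fderiv ℝ ψ x v := by
  rw [divergence_smul (φ := fun _ => v) hψ (differentiableAt_const v)]
  simp [divergence]

lemma continuous_divergence {φ : Space d → Space d} (hφ : ContDiff ℝ 1 φ) :
    Continuous (divergence φ) := by
  have h := hφ.continuous_fderiv one_ne_zero
  unfold divergence
  fun_prop

lemma hasCompactSupport_divergence {φ : Space d → Space d} (hφ : HasCompactSupport φ) :
    HasCompactSupport (divergence φ) := by
  refine (hφ.fderiv (𝕜 := ℝ)).comp_left
    (g := fun L : Space d →L[ℝ] Space d => ∑ i : Fin d, L (EuclideanSpace.single i 1) i) ?_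
  simp

lemma integrable_divergence {φ : Space d → Space d} (hφ : IsTestField φ) :
    Integrable (divergence φ) :=
  (continuous_divergence hφ.1).integrable_of_hasCompactSupport (hasCompactSupport_divergence hφ.2.1)

lemma perimeter_congr {Ω Ω' : Set (Space d)} (h : Ω =ᵐ[volume] Ω') :
    perimeter Ω = perimeter Ω' := by
  simp only [perimeter, setIntegral_congr_set h]

lemma memLp_indicator_one {E : Set (Space d)} (hE : NullMeasurableSet E) (hfin : volume E < ⊤) :
    MemLp (E.indicator fun _ => (1 : ℝ)) 2 (volume : Measure (Space d)) := by
  obtain ⟨E', hE', hEE'⟩ := hE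
  have h1 : MemLp (E'.indicator fun _ => (1 : ℝ)) 2 (volume : Measure (Space d)) :=
    memLp_indicator_const _ hE' _ (Or.inr (by rw [← measure_congr hEE']; exact hfin.ne))
  exact h1.ae_eq (indicator_ae_eq_of_ae_eq_set hEE').symm

/-- The characteristic function of a set of finite measure in `L²`. -/
noncomputable def charLp {E : Set (Space d)} (hE : NullMeasurableSet E) (hfin : volume E < ⊤) :
    L2 d := (memLp_indicator_one hE hfin).toLp _

lemma charLp_ae {E : Set (Space d)} (hE : NullMeasurableSet E) (hfin : volume E < ⊤) :
    charLp hE hfin =ᵐ[volume] E.indicator fun _ => (1 : ℝ) :=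
  (memLp_indicator_one hE hfin).coeFn_toLp

lemma inner_self_charLp {E : Set (Space d)} (hE : NullMeasurableSet E) (hfin : volume E < ⊤) :
    inner ℝ (charLp hE hfin) (charLp hE hfin) = volume.real E := by
  rw [inner_eq_integral_of_ae (charLp_ae hE hfin) (charLp_ae hE hfin)]
  have : (fun x => E.indicator (fun _ => (1 : ℝ)) x * E.indicator (fun _ => (1 : ℝ)) x) =
      E.indicator fun _ => (1 : ℝ) := by
    ext x
    by_cases hx : x ∈ E <;> simp [hx]
  rw [this, integral_indicator₀ hE]
  simp

lemma integral_charLp_mul {E : Set (Space d)} (hE : NullMeasurableSet E) (hfin : volume E < ⊤)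
    (f : Space d → ℝ) : ∫ x, charLp hE hfin x * f x = ∫ x in E, f x := by
  rw [← integral_indicator₀ hE]
  refine integral_congr_ae ?_
  filter_upwards [charLp_ae hE hfin] with x hx
  rw [hx]
  by_cases hx : x ∈ E <;> simp [hx]

lemma integrable_charLp_mul {E : Set (Space d)} (hE : NullMeasurableSet E) (hfin : volume E < ⊤)
    {f : Space d → ℝ} (hf : Integrable f) : Integrable fun x => charLp hE hfin x * f x := by
  refine (hf.indicator₀ hE).congr ?_
  filter_upwards [charLp_ae hE hfin] with x hx
  rw [hx]
  by_cases hx : x ∈ E <;> simp [hx]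

/-- The field ψ v/‖v‖ is admissible and its divergence is a multiple of the derivative of ψ along v.
This is the bound that `inner_sub_translate_le_of_bv` requires of an indicator. -/
lemma abs_setIntegral_fderiv_le {E : Set (Space d)} {p : ℝ} (hp : 0 ≤ p)
    (hP : perimeter E ≤ ENNReal.ofReal p) {ψ : Space d → ℝ} (hψ : ContDiff ℝ ∞ ψ)
    (hc : HasCompactSupport ψ) (h1 : ∀ x, |ψ x| ≤ 1) (v : Space d) :
    |∫ x in E, fderiv ℝ ψ x v| ≤ p * ‖v‖ := by
  have key : ∀ v : Space d, ∫ x in E, fderiv ℝ ψ x v ≤ p * ‖v‖ := by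
    intro v
    rcases eq_or_ne v 0 with rfl | hv
    · simp
    have hpos : 0 < ‖v‖ := norm_pos_iff.2 hv
    have h2 := (perimeter_le_iff hp).1 hP (fun x => ψ x • (‖v‖⁻¹ • v))
      ⟨(hψ.of_le (by simp)).smul contDiff_const, hc.smul_right, fun x => by
        rw [norm_smul, norm_smul, norm_inv, norm_norm, inv_mul_cancel₀ hpos.ne', mul_one]
        exact h1 x⟩
    have h3 : ∀ x, divergence (fun x => ψ x • (‖v‖⁻¹ • v)) x = ‖v‖⁻¹ * fderiv ℝ ψ x v := by
      intro x
      rw [divergence_const_smul_field (hψ.differentiable (by simp) x), map_smul, smul_eq_mul]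
    simp only [h3] at h2
    rwa [integral_const_mul, inv_mul_le_iff₀ hpos, mul_comm] at h2
  rw [abs_le]
  refine ⟨?_, key v⟩
  have := key (-v)
  simp only [map_neg, integral_neg, norm_neg] at this
  linarith

/-- An isoperimetric inequality (with a non-optimal constant). -/
lemma exists_isoperimetric (hd : d ≠ 0) :
    ∃ C > 0, ∀ (E : Set (Space d)) (p : ℝ), NullMeasurableSet E → volume E < ⊤ → 0 ≤ p →
      perimeter E ≤ ENNReal.ofReal p →
      volume.real E ≤ C * volume.real E ^ (1 / (d : ℝ)) * p := by
  obtain ⟨C, hC, hV⟩ := exists_volume_ball_eq hd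
  refine ⟨2 * C, by positivity, fun E p hE hfin hp hP => ?_⟩
  rcases (measureReal_nonneg (μ := volume) (s := E)).eq_or_lt with h0 | h0
  · rw [← h0]; positivity
  · have hchar := charLp_ae hE hfin
    have h1 := inner_self_le_of_translate (g := charLp hE hfin) (A := E)
      (a := volume.real E) ?_ h0.le
      (by rw [measureReal_def, ENNReal.ofReal_toReal hfin.ne])
      (ε := C * volume.real E ^ (1 / (d : ℝ))) (by positivity) (hV _ h0)
      (σ := C * volume.real E ^ (1 / (d : ℝ)) * p) ?_
    · rw [inner_self_charLp] at h1
      linarith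
    · filter_upwards [hchar] with x hx hxE
      rw [hx, indicator_of_notMem hxE]
    · intro h hh
      refine (inner_sub_translate_le_of_bv (K := p) ?_ ?_ h).trans ?_
      · filter_upwards [hchar] with x hx
        rw [hx]
        by_cases hx : x ∈ E <;> simp [hx]
      · intro ψ hψ hc hψ1 v
        rw [integral_charLp_mul]
        exact (le_abs_self _).trans (abs_setIntegral_fderiv_le hp hP hψ hc hψ1 v)
      · gcongr

/-- Lower semicontinuity of the perimeter. -/
lemma perimeter_le_of_tendsto {E : ℕ → Set (Space d)} {E' : Set (Space d)}
    (hE : ∀ n, NullMeasurableSet (E n)) (hE' : NullMeasurableSet E')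
    (hlim : ∀ᵐ x, (x ∈ E' ∧ ∀ᶠ n in atTop, x ∈ E n) ∨ (x ∉ E' ∧ ∀ᶠ n in atTop, x ∉ E n))
    {p : ℕ → ℝ} {p' : ℝ} (hp : ∀ n, 0 ≤ p n) (hpp : Tendsto p atTop (𝓝 p'))
    (hP : ∀ n, perimeter (E n) ≤ ENNReal.ofReal (p n)) :
    perimeter E' ≤ ENNReal.ofReal p' := by
  rw [perimeter_le_iff (ge_of_tendsto' hpp hp)]
  intro φ hφ
  refine le_of_tendsto_of_tendsto' ?_ hpp fun n => (perimeter_le_iff (hp n)).1 (hP n) φ hφ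
  simp only [← integral_indicator₀ (hE _), ← integral_indicator₀ hE']
  have hi := integrable_divergence hφ
  refine tendsto_integral_of_dominated_convergence (fun x => ‖divergence φ x‖) (fun n => ?_)
    hi.norm (fun n => Eventually.of_forall fun x => ?_) ?_
  · exact hi.aestronglyMeasurable.indicator₀ (hE n)
  · exact norm_indicator_le_norm_self _ _
  · filter_upwards [hlim] with x hx
    rcases hx with ⟨hx, hxn⟩ | ⟨hx, hxn⟩
    · rw [indicator_of_mem hx]
      refine tendsto_const_nhds.congr' ?_
      filter_upwards [hxn] with n hn
      rw [indicator_of_mem hn]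
    · rw [indicator_of_notMem hx]
      refine tendsto_const_nhds.congr' ?_
      filter_upwards [hxn] with n hn
      rw [indicator_of_notMem hn]

/-- Compactness of sets of bounded perimeter contained in a set of finite measure. -/
lemma exists_limit_set {E : ℕ → Set (Space d)} {A : Set (Space d)} (hA : volume A < ⊤)
    (hE : ∀ n, NullMeasurableSet (E n)) (hEA : ∀ n, E n ⊆ A) {p : ℝ} (hp : 0 ≤ p)
    (hP : ∀ n, perimeter (E n) ≤ ENNReal.ofReal p) :
    ∃ (E' : Set (Space d)) (φ : ℕ → ℕ), StrictMono φ ∧ NullMeasurableSet E' ∧ E' ⊆ A ∧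
      ∀ᵐ x, (x ∈ E' ∧ ∀ᶠ n in atTop, x ∈ E (φ n)) ∨ (x ∉ E' ∧ ∀ᶠ n in atTop, x ∉ E (φ n)) := by
  have hfin : ∀ n, volume (E n) < ⊤ := fun n => (measure_mono (hEA n)).trans_lt hA
  set f : ℕ → L2 d := fun n => charLp (hE n) (hfin n)
  have hf : ∀ n, f n =ᵐ[volume] (E n).indicator fun _ => (1 : ℝ) := fun n => charLp_ae _ _
  have hnorm : ∀ n, ‖f n‖ ≤ √(volume.real A) := by
    intro n
    apply Real.le_sqrt_of_sq_le
    rw [← real_inner_self_eq_norm_sq, inner_self_charLp]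
    exact measureReal_mono (hEA n) hA.ne
  obtain ⟨u, φ₁, hφ₁, hu⟩ := exists_weak_limit hnorm
  have hcauchy : CauchySeq fun n => f (φ₁ n) := by
    rw [cauchySeq_iff_tendsto_dist_atTop_0]
    have h1 := tendsto_zero_of_weak (l := atTop) (A := A)
      (g := fun i : ℕ × ℕ => f (φ₁ i.1) - f (φ₁ i.2)) (C := √(volume.real A) + √(volume.real A))
      (K := p + p) hA ?_ ?_ ?_ ?_
    · simpa [dist_eq_norm] using h1.norm
    · intro i
      filter_upwards [hf (φ₁ i.1), hf (φ₁ i.2), Lp.coeFn_sub (f (φ₁ i.1)) (f (φ₁ i.2))]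
        with x h1 h2 h3 hx
      rw [h3, Pi.sub_apply, h1, h2, indicator_of_notMem (fun h => hx (hEA _ h)),
        indicator_of_notMem (fun h => hx (hEA _ h)), sub_zero]
    · intro i
      exact (norm_sub_le _ _).trans (add_le_add (hnorm _) (hnorm _))
    · intro i h
      -- A difference of two indicators takes only the values -1, 0 and 1, which is why the
      -- translation estimate was proved for such functions.
      refine inner_sub_translate_le_of_bv ?_ ?_ h
      · filter_upwards [hf (φ₁ i.1), hf (φ₁ i.2), Lp.coeFn_sub (f (φ₁ i.1)) (f (φ₁ i.2))]
          with x h1 h2 h3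
        rw [h3, Pi.sub_apply, h1, h2]
        by_cases hx : x ∈ E (φ₁ i.1) <;> by_cases hx' : x ∈ E (φ₁ i.2) <;> simp [hx, hx']
      · intro ψ hψ hc hψ1 v
        have hint : Integrable (fun x => fderiv ℝ ψ x v) := by
          have h : Continuous fun x => fderiv ℝ ψ x v :=
            (hψ.continuous_fderiv (by simp)).clm_apply continuous_const
          exact h.integrable_of_hasCompactSupport ((hc.fderiv (𝕜 := ℝ)).comp_left
            (g := fun L : Space d →L[ℝ] ℝ => L v) (by simp))
        have e1 : ∫ x, (f (φ₁ i.1) - f (φ₁ i.2) : L2 d) x * fderiv ℝ ψ x v =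
            (∫ x in E (φ₁ i.1), fderiv ℝ ψ x v) - ∫ x in E (φ₁ i.2), fderiv ℝ ψ x v := by
          rw [← integral_charLp_mul (hE _) (hfin _), ← integral_charLp_mul (hE _) (hfin _),
            ← integral_sub (integrable_charLp_mul _ _ hint) (integrable_charLp_mul _ _ hint)]
          refine integral_congr_ae ?_
          filter_upwards [Lp.coeFn_sub (f (φ₁ i.1)) (f (φ₁ i.2))] with x h3
          rw [h3, Pi.sub_apply, sub_mul]
        rw [e1]
        have h2 := abs_le.1 (abs_setIntegral_fderiv_le hp (hP (φ₁ i.1)) hψ hc hψ1 v)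
        have h3 := abs_le.1 (abs_setIntegral_fderiv_le hp (hP (φ₁ i.2)) hψ hc hψ1 v)
        linarith [h2.1, h2.2, h3.1, h3.2]
    · intro y
      have h1 : Tendsto (fun i : ℕ × ℕ => inner ℝ (f (φ₁ i.1)) y) atTop
          (𝓝 (inner ℝ u y)) := (hu y).comp (tendsto_fst.mono_left prod_atTop_atTop_eq.ge)
      have h2 : Tendsto (fun i : ℕ × ℕ => inner ℝ (f (φ₁ i.2)) y) atTop
          (𝓝 (inner ℝ u y)) := (hu y).comp (tendsto_snd.mono_left prod_atTop_atTop_eq.ge)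
      simpa [inner_sub_left] using h1.sub h2
  obtain ⟨u', hu'⟩ := cauchySeq_tendsto_of_complete hcauchy
  obtain ⟨ψ, hψ, hae⟩ := (tendstoInMeasure_of_tendsto_Lp hu').exists_seq_tendsto_ae
  have hEeq : {x | ∀ᶠ n in atTop, x ∈ E (φ₁ (ψ n))} = ⋃ N, ⋂ n, ⋂ (_ : N ≤ n), E (φ₁ (ψ n)) := by
    ext x
    simp [eventually_atTop]
  refine ⟨{x | ∀ᶠ n in atTop, x ∈ E (φ₁ (ψ n))}, φ₁ ∘ ψ, hφ₁.comp hψ, ?_, ?_, ?_⟩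
  · rw [hEeq]
    exact NullMeasurableSet.iUnion fun N => NullMeasurableSet.iInter fun n =>
      NullMeasurableSet.iInter fun _ => hE _
  · intro x hx
    obtain ⟨n, hn⟩ := hx.exists
    exact hEA _ hn
  · have hf' : ∀ᵐ x, ∀ n, f n x = (E n).indicator (fun _ => (1 : ℝ)) x := ae_all_iff.2 hf
    filter_upwards [hae, hf'] with x h1 h2
    -- Indicators take the values 0 and 1, so being within 1/2 of the limit from some index on
    -- excludes taking both values there: convergence means that membership is eventually constant.
    have h3 := (Metric.tendsto_nhds.1 h1) (1 / 2) (by norm_num)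
    by_cases hx : ∀ᶠ n in atTop, x ∈ E (φ₁ (ψ n))
    · exact Or.inl ⟨hx, hx⟩
    · refine Or.inr ⟨hx, ?_⟩
      rw [not_eventually] at hx
      obtain ⟨n, hn, hn'⟩ := (hx.and_eventually h3).exists
      rw [h2, indicator_of_notMem hn, Real.dist_eq, abs_lt] at hn'
      filter_upwards [h3] with m hm hm'
      change x ∈ E (φ₁ (ψ m)) at hm'
      rw [h2, indicator_of_mem hm', Real.dist_eq, abs_lt] at hm
      linarith [hm.1, hm.2, hn'.1, hn'.2]

/-! ### Cutoff functions and cutting along spheres -/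

lemma deriv_smoothTransition_eq_zero {t : ℝ} (ht : ¬ (0 < t ∧ t < 1)) :
    deriv Real.smoothTransition t = 0 := by
  rcases le_or_gt t 0 with h | h
  · refine IsLocalMin.deriv_eq_zero (Eventually.of_forall fun s => ?_)
    rw [Real.smoothTransition.zero_of_nonpos h]
    exact Real.smoothTransition.nonneg s
  · have h1 : 1 ≤ t := by
      by_contra h2
      exact ht ⟨h, not_le.1 h2⟩
    refine IsLocalMax.deriv_eq_zero (Eventually.of_forall fun s => ?_)
    rw [Real.smoothTransition.one_of_one_le h1]
    exact Real.smoothTransition.le_one s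

lemma exists_bound_deriv_smoothTransition :
    ∃ C > 0, ∀ t, |deriv Real.smoothTransition t| ≤ C := by
  have hcont : Continuous (deriv Real.smoothTransition) :=
    (Real.smoothTransition.contDiff (n := 1)).continuous_deriv le_rfl
  have hsupp : HasCompactSupport (deriv Real.smoothTransition) := by
    refine HasCompactSupport.intro (isCompact_Icc (a := (0 : ℝ)) (b := 1)) fun t ht => ?_
    exact deriv_smoothTransition_eq_zero fun h => ht ⟨h.1.le, h.2.le⟩
  obtain ⟨C, hC⟩ := hcont.bounded_above_of_compact_support hsupp
  exact ⟨|C| + 1, by positivity, fun t => (hC t).trans (by linarith [le_abs_self C])⟩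

/-- Radial cutoff functions. -/
lemma exists_ramp (d : ℕ) : ∃ C > 0, ∀ (x₀ : Space d) (a b : ℝ), a < b → 0 ≤ b →
    ∃ r : Space d → ℝ, ContDiff ℝ ∞ r ∧ (∀ x, 0 ≤ r x ∧ r x ≤ 1) ∧
      (∀ x, ‖x - x₀‖ ^ 2 ≤ a → r x = 0) ∧ (∀ x, b ≤ ‖x - x₀‖ ^ 2 → r x = 1) ∧
      (∀ x, ‖fderiv ℝ r x‖ ≤ C * √b / (b - a)) ∧
      ∀ x, ¬ (a < ‖x - x₀‖ ^ 2 ∧ ‖x - x₀‖ ^ 2 < b) → fderiv ℝ r x = 0 := by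
  obtain ⟨C, hC, hCb⟩ := exists_bound_deriv_smoothTransition
  refine ⟨2 * C, by positivity, fun x₀ a b hab hb => ?_⟩
  have hba : 0 < b - a := sub_pos.2 hab
  -- The ramp is a function of the squared distance, which is smooth at the centre too. The
  -- thresholds a and b are therefore squared radii.
  have hN : ContDiff ℝ ∞ fun x : Space d => (‖x - x₀‖ ^ 2 - a) / (b - a) :=
    (((contDiff_id.sub contDiff_const).norm_sq ℝ).sub contDiff_const).div_const _
  set r : Space d → ℝ := fun x => Real.smoothTransition ((‖x - x₀‖ ^ 2 - a) / (b - a))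
  have hfd : ∀ x, fderiv ℝ r x = (deriv Real.smoothTransition ((‖x - x₀‖ ^ 2 - a) / (b - a))) •
      ((b - a)⁻¹ • (2 : ℝ) • innerSL ℝ (x - x₀)) := by
    intro x
    have h1 : HasFDerivAt (fun x : Space d => (‖x - x₀‖ ^ 2 - a) / (b - a))
        ((b - a)⁻¹ • (2 : ℝ) • innerSL ℝ (x - x₀)) x := by
      have h2 := ((hasStrictFDerivAt_norm_sq (x - x₀)).hasFDerivAt.comp x
        ((hasFDerivAt_id x).sub_const x₀))
      have h3 := (h2.sub_const a).mul_const (b - a)⁻¹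
      refine (h3.congr_fderiv ?_).congr_of_eventuallyEq (Eventually.of_forall fun y => ?_)
      · ext v; simp
      · simp [div_eq_mul_inv]
    have h4 : HasDerivAt Real.smoothTransition _ ((‖x - x₀‖ ^ 2 - a) / (b - a)) :=
      ((Real.smoothTransition.contDiff (n := 1)).differentiable one_ne_zero _).hasDerivAt
    exact (h4.comp_hasFDerivAt x h1).fderiv
  have hzero : ∀ x, ¬ (a < ‖x - x₀‖ ^ 2 ∧ ‖x - x₀‖ ^ 2 < b) → fderiv ℝ r x = 0 := by
    intro x hx
    rw [hfd, deriv_smoothTransition_eq_zero, zero_smul]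
    rintro ⟨h1, h2⟩
    rw [div_pos_iff_of_pos_right hba] at h1
    rw [div_lt_one hba] at h2
    exact hx ⟨by linarith, by linarith⟩
  refine ⟨r, Real.smoothTransition.contDiff.comp hN, fun x => ⟨Real.smoothTransition.nonneg _,
    Real.smoothTransition.le_one _⟩, fun x hx => ?_, fun x hx => ?_, fun x => ?_, hzero⟩
  · exact Real.smoothTransition.zero_of_nonpos (div_nonpos_of_nonpos_of_nonneg (by linarith) hba.le)
  · exact Real.smoothTransition.one_of_one_le ((one_le_div hba).2 (by linarith))
  · by_cases hx : a < ‖x - x₀‖ ^ 2 ∧ ‖x - x₀‖ ^ 2 < b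
    · have h1 : ‖x - x₀‖ ≤ √b := Real.le_sqrt_of_sq_le hx.2.le
      rw [hfd, norm_smul, norm_smul, norm_smul, innerSL_apply_norm, norm_inv,
        Real.norm_of_nonneg hba.le, Real.norm_two, Real.norm_eq_abs]
      calc _ ≤ C * ((b - a)⁻¹ * (2 * √b)) := by
            gcongr
            exact hCb _
        _ = _ := by ring
    · rw [hzero x hx, norm_zero]
      positivity

/-- A substitute for almost everywhere differentiability of monotone functions. If the forward slope
were eventually at least L at every point, the supremum of the points where the total increment is
at least L(t - a) could be pushed to b, contradicting the mean slope. Monotonicity puts the supremum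
itself into the set. -/
lemma exists_frequently_slope_lt {M : ℝ → ℝ} (hM : Monotone M) {a b L : ℝ} (hab : a < b)
    (hL : M b - M a < L * (b - a)) :
    ∃ t ∈ Ico a b, ∃ᶠ h in 𝓝[>] (0 : ℝ), M (t + h) - M t < L * h := by
  by_contra! hcon
  set S : Set ℝ := {t | t ∈ Icc a b ∧ L * (t - a) ≤ M t - M a}
  have haS : a ∈ S := ⟨⟨le_rfl, hab.le⟩, by simp⟩
  have hSb : BddAbove S := ⟨b, fun t ht => ht.1.2⟩
  set c := sSup S
  have hcS : c ∈ S := by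
    obtain ⟨t, -, ht, htS⟩ := exists_seq_tendsto_sSup ⟨a, haS⟩ hSb
    refine ⟨⟨le_csSup hSb haS, csSup_le ⟨a, haS⟩ fun t ht => ht.1.2⟩, ?_⟩
    refine le_of_tendsto' ((ht.sub_const a).const_mul L) fun n => (htS n).2.trans ?_
    have := hM (le_csSup hSb (htS n))
    linarith
  rcases hcS.1.2.eq_or_lt with hcb | hcb
  · have := hcS.2
    rw [hcb] at this
    linarith
  · have h1 := hcon c ⟨hcS.1.1, hcb⟩
    have h2 : ∀ᶠ h in 𝓝[>] (0 : ℝ), h < b - c :=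
      nhdsWithin_le_nhds (gt_mem_nhds (sub_pos.2 hcb))
    obtain ⟨h, hh1, hh2, hh0⟩ := (h1.and (h2.and self_mem_nhdsWithin)).exists
    have h3 : c + h ∈ S := by
      refine ⟨⟨by linarith [hcS.1.1], by linarith⟩, ?_⟩
      have := hcS.2
      linarith
    linarith [le_csSup hSb h3]

/-- The two fields vary independently, so the supremum over the first can be taken before that over
the second, and it splits q. -/
lemma exists_perimeter_bounds {E F : Set (Space d)} {q : ℝ}
    (h : ∀ φ ψ, IsTestField φ → IsTestField ψ →
      (∫ x in E, divergence φ x) + ∫ x in F, divergence ψ x ≤ q) :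
    ∃ p₁ p₂ : ℝ, 0 ≤ p₁ ∧ 0 ≤ p₂ ∧ perimeter E ≤ ENNReal.ofReal p₁ ∧
      perimeter F ≤ ENNReal.ofReal p₂ ∧ p₁ + p₂ ≤ q := by
  set S : Set ℝ := {t | ∃ φ, IsTestField φ ∧ ∫ x in E, divergence φ x = t}
  have hz : ∀ E : Set (Space d), ∫ x in E, divergence (0 : Space d → Space d) x = 0 := by
    intro E
    simp [divergence]
  have h0S : (0 : ℝ) ∈ S := ⟨0, isTestField_zero, hz E⟩
  have hSb : BddAbove S := by
    refine ⟨q, ?_⟩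
    rintro t ⟨φ, hφ, rfl⟩
    have := h φ 0 hφ isTestField_zero
    rwa [hz, add_zero] at this
  have hF : ∀ ψ, IsTestField ψ → ∫ x in F, divergence ψ x ≤ q - sSup S := by
    intro ψ hψ
    have : sSup S ≤ q - ∫ x in F, divergence ψ x := by
      refine csSup_le ⟨0, h0S⟩ ?_
      rintro t ⟨φ, hφ, rfl⟩
      linarith [h φ ψ hφ hψ]
    linarith
  have h1 : 0 ≤ sSup S := le_csSup hSb h0S
  have h2 : 0 ≤ q - sSup S := by simpa [hz] using hF 0 isTestField_zero
  exact ⟨sSup S, q - sSup S, h1, h2,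
    (perimeter_le_iff h1).2 fun φ hφ => le_csSup hSb ⟨φ, hφ, rfl⟩, (perimeter_le_iff h2).2 hF,
    by linarith⟩

lemma isTestField_interpolate {r : Space d → ℝ} (hr : ContDiff ℝ ∞ r)
    (hr01 : ∀ x, 0 ≤ r x ∧ r x ≤ 1) {φ ψ : Space d → Space d} (hφ : IsTestField φ)
    (hψ : IsTestField ψ) : IsTestField fun x => (1 - r x) • φ x + r x • ψ x := by
  have hr1 : ContDiff ℝ 1 r := hr.of_le (by simp)
  refine ⟨((contDiff_const.sub hr1).smul hφ.1).add (hr1.smul hψ.1),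
    (hφ.2.1.smul_left (f := fun x => 1 - r x)).add (hψ.2.1.smul_left (f := r)), fun x => ?_⟩
  obtain ⟨h0, h1⟩ := hr01 x
  refine (norm_add_le _ _).trans ?_
  rw [norm_smul, norm_smul, Real.norm_of_nonneg h0, Real.norm_of_nonneg (sub_nonneg.2 h1)]
  have e1 := mul_le_mul_of_nonneg_left (hφ.2.2 x) (sub_nonneg.2 h1)
  have e2 := mul_le_mul_of_nonneg_left (hψ.2.2 x) h0
  linarith

lemma divergence_interpolate {r : Space d → ℝ} (hr : ContDiff ℝ ∞ r)
    {φ ψ : Space d → Space d} (hφ : IsTestField φ) (hψ : IsTestField ψ) (x : Space d) :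
    divergence (fun x => (1 - r x) • φ x + r x • ψ x) x =
      (1 - r x) * divergence φ x + r x * divergence ψ x + fderiv ℝ r x (ψ x - φ x) := by
  have hdr : DifferentiableAt ℝ r x := hr.differentiable (by simp) x
  have hdφ : DifferentiableAt ℝ φ x := hφ.1.differentiable one_ne_zero x
  have hdψ : DifferentiableAt ℝ ψ x := hψ.1.differentiable one_ne_zero x
  have hd1 : DifferentiableAt ℝ (fun x => 1 - r x) x := hdr.const_sub 1
  rw [divergence_add (φ := fun x => (1 - r x) • φ x) (ψ := fun x => r x • ψ x)
    (hd1.smul hdφ) (hdr.smul hdψ), divergence_smul hd1 hdφ,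
    divergence_smul hdr hdψ, fderiv_const_sub, map_sub]
  simp only [neg_apply]
  ring

set_option maxHeartbeats 1000000 in
/-- Cutting a set along a well-chosen sphere. -/
lemma exists_cut (d : ℕ) : ∃ C > 0, ∀ (Ω : Set (Space d)) (p : ℝ), NullMeasurableSet Ω → 0 ≤ p →
    perimeter Ω ≤ ENNReal.ofReal p → ∀ (x₀ : Space d) (s δ ε : ℝ), 0 ≤ s → 0 < δ → 0 < ε →
    ∃ t ∈ Ico s (s + δ), ∃ p₁ p₂ : ℝ, 0 ≤ p₁ ∧ 0 ≤ p₂ ∧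
      perimeter (Ω ∩ Metric.closedBall x₀ t) ≤ ENNReal.ofReal p₁ ∧
      perimeter (Ω \ Metric.closedBall x₀ t) ≤ ENNReal.ofReal p₂ ∧
      p₁ + p₂ ≤ p + C / δ * volume.real
        (Ω ∩ (Metric.closedBall x₀ (s + δ) \ Metric.closedBall x₀ s)) + ε := by
  obtain ⟨C, hC, hramp⟩ := exists_ramp d
  refine ⟨2 * C, by positivity, fun Ω p hΩ hp hP x₀ s δ ε hs hδ hε => ?_⟩
  set D : ℝ → Set (Space d) := fun τ => {x | ‖x - x₀‖ ^ 2 ≤ τ}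
  have hDball : ∀ t, 0 ≤ t → D (t ^ 2) = Metric.closedBall x₀ t := by
    intro t ht
    ext x
    simp only [D, Metric.mem_closedBall, dist_eq_norm]
    exact pow_le_pow_iff_left₀ (norm_nonneg _) ht two_ne_zero
  have hDm : ∀ τ, MeasurableSet (D τ) := fun τ =>
    measurableSet_le (by fun_prop) measurable_const
  have hDmono : ∀ τ τ', τ ≤ τ' → D τ ⊆ D τ' := fun τ τ' h x hx => le_trans hx h
  have hDfin : ∀ τ, volume (D τ) < ⊤ := by
    intro τ
    refine (measure_mono ?_).trans_lt
      (Metric.isBounded_closedBall (x := x₀) (r := √τ)).measure_lt_top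
    intro x hx
    rw [Metric.mem_closedBall, dist_eq_norm]
    exact Real.le_sqrt_of_sq_le hx
  have hΩDfin : ∀ τ, volume (Ω ∩ D τ) ≠ ⊤ := fun τ =>
    ((measure_mono inter_subset_right).trans_lt (hDfin τ)).ne
  set M : ℝ → ℝ := fun τ => volume.real (Ω ∩ D τ)
  have hMmono : Monotone M := fun τ τ' h =>
    measureReal_mono (inter_subset_inter_right _ (hDmono _ _ h)) (hΩDfin _)
  have hMdiff : ∀ τ τ', τ ≤ τ' → volume.real (Ω ∩ (D τ' \ D τ)) = M τ' - M τ := by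
    intro τ τ' h
    have h1 : Ω ∩ (D τ' \ D τ) = (Ω ∩ D τ') \ (Ω ∩ D τ) := by
      ext x; simp only [mem_inter_iff, Set.mem_sdiff]; tauto
    rw [h1, measureReal_def, measure_sdiff (inter_subset_inter_right _ (hDmono _ _ h))
      (hΩ.inter (hDm τ).nullMeasurableSet) (hΩDfin _),
      ENNReal.toReal_sub_of_le (measure_mono (inter_subset_inter_right _ (hDmono _ _ h)))
        (hΩDfin _)]
    rfl
  -- As for the ramps, the volume function M is parametrised by the squared radius.
  set a := s ^ 2
  set b := (s + δ) ^ 2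
  have hab : a < b := by simp only [a, b]; gcongr; linarith
  have hb0 : 0 ≤ b := sq_nonneg _
  have hsδ : 0 < s + δ := by linarith
  -- Slack making the mean slope strictly smaller than L, normalised so that its final contribution
  -- is ε.
  set ε' := ε / (2 * C * (s + δ))
  have hε' : 0 < ε' := by positivity
  set L := (M b - M a) / (b - a) + ε'
  have hL0 : 0 ≤ L :=
    add_nonneg (div_nonneg (sub_nonneg.2 (hMmono hab.le)) (sub_pos.2 hab).le) hε'.le
  obtain ⟨τ, ⟨hτa, hτb⟩, hfreq⟩ := exists_frequently_slope_lt hMmono hab (L := L) (by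
    simp only [L]
    rw [add_mul, div_mul_cancel₀ _ (sub_pos.2 hab).ne']
    have := mul_pos hε' (sub_pos.2 hab)
    linarith)
  have hτ0 : 0 ≤ τ := (sq_nonneg s).trans hτa
  have hsqrt : D τ = Metric.closedBall x₀ √τ := by
    rw [← hDball _ (Real.sqrt_nonneg _), Real.sq_sqrt hτ0]
  have hsb : √b = s + δ := Real.sqrt_sq hsδ.le
  -- A field for the inner part and one for the outer part are interpolated across a shell of
  -- squared width h. The result is admissible for Ω, and the only error is at most 2 times the
  -- gradient of the ramp, of order 1/h, integrated over the shell. This is controlled by the slope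
  -- of M.
  have hmain : ∀ φ ψ, IsTestField φ → IsTestField ψ →
      (∫ x in Ω ∩ D τ, divergence φ x) + ∫ x in Ω \ D τ, divergence ψ x ≤
        p + 2 * C * (s + δ) * L := by
    intro φ ψ hφ hψ
    have hr : ∀ h : ℝ, ∃ r : Space d → ℝ, 0 < h → ContDiff ℝ ∞ r ∧ (∀ x, 0 ≤ r x ∧ r x ≤ 1) ∧
        (∀ x, ‖x - x₀‖ ^ 2 ≤ τ → r x = 0) ∧ (∀ x, τ + h ≤ ‖x - x₀‖ ^ 2 → r x = 1) ∧
        (∀ x, ‖fderiv ℝ r x‖ ≤ C * √(τ + h) / h) ∧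
        ∀ x, ¬ (τ < ‖x - x₀‖ ^ 2 ∧ ‖x - x₀‖ ^ 2 < τ + h) → fderiv ℝ r x = 0 := by
      intro h
      by_cases hh : 0 < h
      · obtain ⟨r, hr⟩ := hramp x₀ τ (τ + h) (by linarith) (by linarith)
        rw [add_sub_cancel_left] at hr
        exact ⟨r, fun _ => hr⟩
      · exact ⟨0, fun h' => absurd h' hh⟩
    choose r hr using hr
    have hiφ := integrable_divergence hφ
    have hiψ := integrable_divergence hψ
    set F : ℝ → Space d → ℝ := fun h x => (1 - r h x) * divergence φ x + r h x * divergence ψ x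
    set F₀ : Space d → ℝ := fun x => (D τ).indicator (divergence φ) x +
      (D τ)ᶜ.indicator (divergence ψ) x
    have hlim : Tendsto (fun h => ∫ x in Ω, F h x) (𝓝[>] 0) (𝓝 (∫ x in Ω, F₀ x)) := by
      refine tendsto_integral_filter_of_dominated_convergence
        (fun x => ‖divergence φ x‖ + ‖divergence ψ x‖) ?_ ?_ ?_ ?_
      · filter_upwards [self_mem_nhdsWithin] with h hh
        have hrc := (hr h hh).1.continuous
        have hc1 := continuous_divergence hφ.1
        have hc2 := continuous_divergence hψ.1
        exact (((continuous_const.sub hrc).mul hc1).add (hrc.mul hc2)).aestronglyMeasurable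
      · filter_upwards [self_mem_nhdsWithin] with h hh
        refine Eventually.of_forall fun x => ?_
        obtain ⟨h0, h1⟩ := (hr h hh).2.1 x
        refine (norm_add_le _ _).trans ?_
        rw [norm_mul, norm_mul, Real.norm_of_nonneg h0, Real.norm_of_nonneg (sub_nonneg.2 h1)]
        refine add_le_add ?_ ?_
        · exact mul_le_of_le_one_left (norm_nonneg _) (by linarith)
        · exact mul_le_of_le_one_left (norm_nonneg _) h1
      · exact (hiφ.norm.add hiψ.norm).restrict
      · refine Eventually.of_forall fun x => ?_
        by_cases hx : x ∈ D τ
        · have : F₀ x = divergence φ x := by simp [F₀, hx]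
          rw [this]
          refine tendsto_const_nhds.congr' ?_
          filter_upwards [self_mem_nhdsWithin] with h hh
          simp [F, (hr h hh).2.2.1 x hx]
        · have : F₀ x = divergence ψ x := by simp [F₀, hx]
          rw [this]
          refine tendsto_const_nhds.congr' ?_
          have hx' : 0 < ‖x - x₀‖ ^ 2 - τ := sub_pos.2 (not_le.1 hx)
          filter_upwards [self_mem_nhdsWithin, nhdsWithin_le_nhds (gt_mem_nhds hx')] with h hh hh'
          simp [F, (hr h hh).2.2.2.1 x (by linarith)]
    have hF₀ : ∫ x in Ω, F₀ x = (∫ x in Ω ∩ D τ, divergence φ x) +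
        ∫ x in Ω \ D τ, divergence ψ x := by
      rw [integral_add (hiφ.indicator (hDm τ)).restrict (hiψ.indicator (hDm τ).compl).restrict,
        setIntegral_indicator (hDm τ), setIntegral_indicator (hDm τ).compl, Set.sdiff_eq]
    rw [← hF₀]
    have hev : ∀ᶠ h in 𝓝[>] (0 : ℝ), 0 < h ∧ h < b - τ :=
      (eventually_mem_nhdsWithin).and (nhdsWithin_le_nhds (gt_mem_nhds (sub_pos.2 hτb)))
    -- Small slopes occur only for a sequence of widths h, which is enough since the left-hand side
    -- has a limit as h tends to 0.
    refine le_of_tendsto_of_frequently hlim ((hfreq.and_eventually hev).mono ?_)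
    rintro h ⟨hslope, hh0, hhb⟩
    obtain ⟨hrs, hr01, hr0, hr1, hrd, hrz⟩ := hr h hh0
    set Φ : Space d → Space d := fun x => (1 - r h x) • φ x + r h x • ψ x
    have hΦ : IsTestField Φ := isTestField_interpolate hrs hr01 hφ hψ
    have hdiv : ∀ x, divergence Φ x = F h x + fderiv ℝ (r h) x (ψ x - φ x) :=
      divergence_interpolate hrs hφ hψ
    have hiF : Integrable (F h) := by
      have hc1 : Continuous (F h) := ((continuous_const.sub hrs.continuous).mul
        (continuous_divergence hφ.1)).add (hrs.continuous.mul (continuous_divergence hψ.1))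
      exact hc1.integrable_of_hasCompactSupport
        ((hasCompactSupport_divergence hφ.2.1).mul_left.add
          (hasCompactSupport_divergence hψ.2.1).mul_left)
    have hPΦ := (perimeter_le_iff hp).1 hP Φ hΦ
    have hiΦ := integrable_divergence hΦ
    set c := 2 * (C * (s + δ) / h)
    have hc0 : 0 ≤ c := by positivity
    have hle : ∫ x in Ω, F h x ≤ (∫ x in Ω, divergence Φ x) +
        ∫ x in Ω, (D (τ + h) \ D τ).indicator (fun _ => c) x := by
      have hindi : Integrable ((D (τ + h) \ D τ).indicator fun _ => c) :=
        (integrable_indicator_iff ((hDm _).diff (hDm _))).2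
          (integrableOn_const ((measure_mono sdiff_subset).trans_lt (hDfin _)).ne)
      rw [← integral_add hiΦ.restrict hindi.restrict]
      refine integral_mono hiF.restrict (hiΦ.add hindi).restrict fun x => ?_
      beta_reduce
      rw [hdiv]
      suffices -(fderiv ℝ (r h) x (ψ x - φ x)) ≤ (D (τ + h) \ D τ).indicator (fun _ => c) x by
        linarith
      by_cases hx : τ < ‖x - x₀‖ ^ 2 ∧ ‖x - x₀‖ ^ 2 < τ + h
      · have hx' : x ∈ D (τ + h) \ D τ := ⟨hx.2.le, not_le.2 hx.1⟩
        rw [indicator_of_mem hx']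
        refine (neg_le_abs _).trans ?_
        refine ((fderiv ℝ (r h) x).le_opNorm _).trans ?_
        have e1 : ‖ψ x - φ x‖ ≤ 2 := by
          refine (norm_sub_le _ _).trans ?_
          linarith [hφ.2.2 x, hψ.2.2 x]
        have e2 : ‖fderiv ℝ (r h) x‖ ≤ C * (s + δ) / h := by
          refine (hrd x).trans ?_
          rw [← hsb]
          gcongr
          linarith
        calc _ ≤ (C * (s + δ) / h) * 2 := by gcongr
          _ = c := by ring
      · rw [hrz x hx]
        simpa using indicator_nonneg (fun _ _ => hc0) x
    refine hle.trans (add_le_add hPΦ ?_)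
    rw [setIntegral_indicator ((hDm _).diff (hDm _)), setIntegral_const, hMdiff _ _ (by linarith),
      smul_eq_mul]
    calc (M (τ + h) - M τ) * c ≤ (L * h) * c := by gcongr
      _ = _ := by simp only [c]; field_simp
  obtain ⟨p₁, p₂, hp₁, hp₂, hP₁, hP₂, hsum⟩ := exists_perimeter_bounds hmain
  refine ⟨√τ, ⟨Real.le_sqrt_of_sq_le hτa, ?_⟩, p₁, p₂, hp₁, hp₂, ?_, ?_, hsum.trans ?_⟩
  · rw [← hsb]; exact Real.sqrt_lt_sqrt hτ0 hτb
  · rwa [← hsqrt]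
  · rwa [← hsqrt]
  · rw [← hDball _ hsδ.le, ← hDball _ hs, hMdiff _ _ hab.le]
    have hΔ : 0 ≤ M b - M a := sub_nonneg.2 (hMmono hab.le)
    have e1 : 2 * C * (s + δ) * ε' = ε := by simp only [ε']; field_simp
    -- Here b - a = δ(2s + δ) ≥ δ(s + δ), so the factor s + δ from the gradient of the ramp cancels.
    have e2 : (s + δ) * ((M b - M a) / (b - a)) ≤ (M b - M a) / δ := by
      rw [mul_div_assoc', div_le_div_iff₀ (sub_pos.2 hab) hδ]
      have : δ * (s + δ) ≤ b - a := by simp only [a, b]; nlinarith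
      nlinarith
    have e3 : 2 * C * (s + δ) * L = 2 * C * ((s + δ) * ((M b - M a) / (b - a))) + ε := by
      simp only [L]; rw [mul_add, e1]; ring
    have e4 : 2 * C * ((s + δ) * ((M b - M a) / (b - a))) ≤ 2 * C * ((M b - M a) / δ) := by
      gcongr
    rw [e3]
    have e5 : 2 * C / δ * (M b - M a) = 2 * C * ((M b - M a) / δ) := by ring
    rw [e5]
    linarith

/-! ### Transfer of test spaces along linear operations -/

section Transfer

variable {H K : Type*} [NormedAddCommGroup H] [InnerProductSpace ℝ H] [NormedAddCommGroup K]
  [InnerProductSpace ℝ K]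

/-- The operations below (dilation, cutoff, rearrangement) are known through almost everywhere
formulas. A relation compatible with linear combinations replaces the construction of linear
operators on L². -/
lemma sum_smul_rel {R : H × K → H × K → Prop} (h0 : R 0 0)
    (hadd : ∀ p q p' q', R p q → R p' q' → R (p + p') (q + q'))
    (hsmul : ∀ (c : ℝ) p q, R p q → R (c • p) (c • q)) {k : ℕ} {p q : Fin k → H × K}
    (h : ∀ i, R (p i) (q i)) (α : Fin k → ℝ) : R (∑ i, α i • p i) (∑ i, α i • q i) := by
  suffices ∀ s : Finset (Fin k), R (∑ i ∈ s, α i • p i) (∑ i ∈ s, α i • q i) from this _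
  intro s
  induction s using Finset.induction_on with
  | empty => simpa using h0
  | insert a s ha ih =>
    rw [Finset.sum_insert ha, Finset.sum_insert ha]
    exact hadd _ _ _ _ (hsmul _ _ _ (h a)) ih

/-- Transfer of test spaces along a linear relation. -/
lemma HasTestSpace.transfer {𝒢 𝒢' : Submodule ℝ (H × K)} {R : H × K → H × K → Prop} (h0 : R 0 0)
    (hadd : ∀ p q p' q', R p q → R p' q' → R (p + p') (q + q'))
    (hsmul : ∀ (c : ℝ) p q, R p q → R (c • p) (c • q))
    (hex : ∀ p ∈ 𝒢, ∃ q ∈ 𝒢', R p q) {a b : ℝ} (ha : 0 < a) (hb : 0 ≤ b)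
    (h1 : ∀ p ∈ 𝒢, ∀ q, R p q → ‖q.1‖ ^ 2 = a * ‖p.1‖ ^ 2)
    (h2 : ∀ p ∈ 𝒢, ∀ q, R p q → ‖q.2‖ ^ 2 ≤ b * ‖p.2‖ ^ 2) {k : ℕ} {l : ℝ}
    (h : HasTestSpace 𝒢 k l) : HasTestSpace 𝒢' k (b / a * l) := by
  obtain ⟨p, hp, hi, hl⟩ := h
  choose q hq hR using fun i => hex (p i) (hp i)
  have hsum := sum_smul_rel h0 hadd hsmul hR
  have hmem : ∀ α : Fin k → ℝ, ∑ i, α i • p i ∈ 𝒢 := fun α =>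
    𝒢.sum_mem fun i _ => 𝒢.smul_mem _ (hp i)
  have e1 : ∀ α : Fin k → ℝ, ‖∑ i, α i • (q i).1‖ ^ 2 = a * ‖∑ i, α i • (p i).1‖ ^ 2 := by
    intro α
    have := h1 _ (hmem α) _ (hsum α)
    simpa [Prod.fst_sum] using this
  have e2 : ∀ α : Fin k → ℝ, ‖∑ i, α i • (q i).2‖ ^ 2 ≤ b * ‖∑ i, α i • (p i).2‖ ^ 2 := by
    intro α
    have := h2 _ (hmem α) _ (hsum α)
    simpa [Prod.snd_sum] using this
  refine ⟨q, hq, ?_, fun α => ?_⟩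
  · rw [Fintype.linearIndependent_iff] at hi ⊢
    intro α hα i
    refine hi α ?_ i
    have h3 := e1 α
    rw [hα, norm_zero] at h3
    have h4 : ‖∑ i, α i • (p i).1‖ ^ 2 = 0 := by
      have : a * ‖∑ i, α i • (p i).1‖ ^ 2 = 0 := by rw [← h3]; norm_num
      exact (mul_eq_zero.1 this).resolve_left ha.ne'
    exact norm_eq_zero.1 (pow_eq_zero_iff two_ne_zero |>.1 h4)
  · rw [e1]
    refine (e2 α).trans ?_
    have := mul_le_mul_of_nonneg_left (hl α) hb
    refine this.trans (le_of_eq ?_)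
    field_simp

end Transfer

/-! ### Dilations and translations -/

lemma norm_sq_eq_integral {E : Type*} [NormedAddCommGroup E] [InnerProductSpace ℝ E]
    (f : Lp E 2 (volume : Measure (Space d))) : ‖f‖ ^ 2 = ∫ x, ‖f x‖ ^ 2 := by
  rw [← real_inner_self_eq_norm_sq, L2.inner_def]
  simp

/-- The similarity `x ↦ t x + v`. -/
def similarity (t : ℝ) (v : Space d) (x : Space d) : Space d := t • x + v

lemma integral_comp_similarity {t : ℝ} (ht : 0 < t) (v : Space d) (f : Space d → ℝ) :
    ∫ x, f (similarity t v x) = (t ^ d)⁻¹ * ∫ x, f x := by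
  have h1 := Measure.integral_comp_smul (volume : Measure (Space d)) (fun y => f (y + v)) t
  rw [integral_add_right_eq_self f v, finrank_euclideanSpace_fin, abs_of_pos (by positivity),
    smul_eq_mul] at h1
  exact h1

lemma map_similarity {t : ℝ} (ht : 0 < t) (v : Space d) :
    Measure.map (similarity t v) (volume : Measure (Space d)) =
      ENNReal.ofReal ((t ^ d)⁻¹) • volume := by
  have h1 : similarity t v = (fun x => x + v) ∘ fun x : Space d => t • x := rfl
  rw [h1, ← Measure.map_map (measurable_add_const v) (measurable_const_smul t),
    Measure.map_addHaar_smul _ ht.ne', finrank_euclideanSpace_fin, abs_of_pos (by positivity),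
    Measure.map_smul, map_add_right_eq_self]

lemma measurable_similarity (t : ℝ) (v : Space d) : Measurable (similarity t v) :=
  (measurable_const_smul t).add_const v

lemma quasiMeasurePreserving_similarity {t : ℝ} (ht : 0 < t) (v : Space d) :
    Measure.QuasiMeasurePreserving (similarity t v) volume volume :=
  ⟨measurable_similarity t v, by
    rw [map_similarity ht]
    exact Measure.smul_absolutelyContinuous⟩

lemma volume_preimage_similarity {t : ℝ} (ht : 0 < t) (v : Space d) {Ω : Set (Space d)}
    (hΩ : NullMeasurableSet Ω) :
    volume (similarity t v ⁻¹' Ω) = ENNReal.ofReal ((t ^ d)⁻¹) * volume Ω := by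
  rw [← Measure.map_apply₀ (measurable_similarity t v).aemeasurable, map_similarity ht]
  · simp
  · rw [map_similarity ht]
    exact hΩ.mono_ac Measure.smul_absolutelyContinuous

lemma memLp_comp_similarity {E : Type*} [NormedAddCommGroup E] {t : ℝ} (ht : 0 < t) (v : Space d)
    {f : Space d → E} (hf : MemLp f 2 volume) :
    MemLp (fun x => f (similarity t v x)) 2 volume := by
  have h1 : MemLp f 2 (Measure.map (similarity t v) (volume : Measure (Space d))) := by
    rw [map_similarity ht]
    exact hf.smul_measure (by simp)
  exact (memLp_map_measure_iff h1.aestronglyMeasurable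
    (measurable_similarity t v).aemeasurable).1 h1

lemma similarity_rightInverse {t : ℝ} (ht : 0 < t) (v x : Space d) :
    t⁻¹ • (similarity t v x - v) = x := by
  simp [similarity, inv_smul_smul₀ ht.ne']

lemma fderiv_comp_inv_similarity {E : Type*} [NormedAddCommGroup E] [NormedSpace ℝ E]
    {t : ℝ} (v : Space d) {φ : Space d → E}
    (hφ : Differentiable ℝ φ) (y : Space d) :
    fderiv ℝ (fun y => φ (t⁻¹ • (y - v))) y = t⁻¹ • fderiv ℝ φ (t⁻¹ • (y - v)) := by
  have h1 : HasFDerivAt (fun y : Space d => t⁻¹ • (y - v)) (t⁻¹ • ContinuousLinearMap.id ℝ _) y :=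
    ((hasFDerivAt_id y).sub_const v).const_smul t⁻¹
  refine ((hφ (t⁻¹ • (y - v))).hasFDerivAt.comp y h1).fderiv.trans ?_
  ext w
  simp

lemma hasCompactSupport_comp_inv_similarity {E : Type*} [Zero E]
    {t : ℝ} (ht : 0 < t) (v : Space d) {φ : Space d → E} (hφ : HasCompactSupport φ) :
    HasCompactSupport fun y => φ (t⁻¹ • (y - v)) :=
  hφ.comp_homeomorph ((Homeomorph.subRight v).trans
    (Homeomorph.smulOfNeZero t⁻¹ (inv_pos.2 ht).ne'))

lemma exists_gradientPairs_similarity {t : ℝ} (ht : 0 < t) (v : Space d) {Ω : Set (Space d)}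
    {p : L2 d × L2Field d} (hp : p ∈ gradientPairs Ω) :
    ∃ q ∈ gradientPairs (similarity t v ⁻¹' Ω),
      (q.1 =ᵐ[volume] fun x => p.1 (similarity t v x)) ∧
      q.2 =ᵐ[volume] fun x => t • p.2 (similarity t v x) := by
  have h1 := memLp_comp_similarity ht v (Lp.memLp p.1)
  have h2 : MemLp (fun x => t • p.2 (similarity t v x)) 2 volume :=
    (memLp_comp_similarity ht v (Lp.memLp p.2)).const_smul t
  refine ⟨(h1.toLp _, h2.toLp _), ⟨hasWeakGradient_toLp h1 h2 ?_, ?_⟩, h1.coeFn_toLp, h2.coeFn_toLp⟩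
  · intro φ hφ hc w
    set ψ : Space d → ℝ := fun y => φ (t⁻¹ • (y - v))
    have hψ : ContDiff ℝ ∞ ψ := hφ.comp ((contDiff_id.sub contDiff_const).const_smul t⁻¹)
    have hψc : HasCompactSupport ψ := hasCompactSupport_comp_inv_similarity ht v hc
    have h3 := hp.1 ψ hψ hψc w
    have hfd : ∀ y, fderiv ℝ ψ y = t⁻¹ • fderiv ℝ φ (t⁻¹ • (y - v)) :=
      fderiv_comp_inv_similarity v (hφ.differentiable (by simp))
    have e1 := integral_comp_similarity ht v (fun y => t * (p.1 y * fderiv ℝ ψ y w))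
    have e2 := integral_comp_similarity ht v (fun y => t * (inner ℝ (p.2 y) w * ψ y))
    have e3 : ∀ x, t * (p.1 (similarity t v x) * fderiv ℝ ψ (similarity t v x) w) =
        p.1 (similarity t v x) * fderiv ℝ φ x w := by
      intro x
      rw [hfd, similarity_rightInverse ht]
      simp only [smul_apply, smul_eq_mul]
      field_simp
    have e4 : ∀ x, t * (inner ℝ (p.2 (similarity t v x)) w * ψ (similarity t v x)) =
        inner ℝ (t • p.2 (similarity t v x)) w * φ x := by
      intro x
      simp only [ψ]
      rw [similarity_rightInverse ht, real_inner_smul_left]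
      ring
    simp only [e3] at e1
    simp only [e4] at e2
    rw [e1, integral_const_mul, h3, e2, integral_const_mul]
    ring
  · filter_upwards [(quasiMeasurePreserving_similarity ht v).ae hp.2, h1.coeFn_toLp] with x hx hx' h
    rw [hx']
    exact hx h

/-- Function and gradient acquire the same Jacobian, and the squared gradient an additional factor
t². Preimages are used, so t > 1 shrinks the set and raises the eigenvalues. -/
lemma HasTestSpace.similarity {t : ℝ} (ht : 0 < t) (v : Space d) {Ω : Set (Space d)}
    {k : ℕ} {l : ℝ} (h : HasTestSpace (gradientPairs Ω) k l) :
    HasTestSpace (gradientPairs (similarity t v ⁻¹' Ω)) k (t ^ 2 * l) := by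
  set T := SpectralPerimeter.similarity t v
  have hT := quasiMeasurePreserving_similarity ht v
  have := h.transfer (𝒢' := gradientPairs (T ⁻¹' Ω))
    (R := fun p q => (q.1 =ᵐ[volume] fun x => p.1 (T x)) ∧ q.2 =ᵐ[volume] fun x => t • p.2 (T x))
    (a := (t ^ d)⁻¹) (b := t ^ 2 * (t ^ d)⁻¹) ?_ ?_ ?_ ?_ (by positivity) (by positivity) ?_ ?_
  · rwa [mul_div_assoc, div_self (by positivity), mul_one] at this
  · constructor
    · filter_upwards [Lp.coeFn_zero ℝ 2 (volume : Measure (Space d)),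
        hT.ae (Lp.coeFn_zero ℝ 2 (volume : Measure (Space d)))] with x h1 h2
      rw [Prod.fst_zero, h1, h2]; rfl
    · filter_upwards [Lp.coeFn_zero (Space d) 2 (volume : Measure (Space d)),
        hT.ae (Lp.coeFn_zero (Space d) 2 (volume : Measure (Space d)))] with x h1 h2
      rw [Prod.snd_zero, h1, h2]; simp
  · rintro p q p' q' ⟨h1, h2⟩ ⟨h1', h2'⟩
    constructor
    · filter_upwards [h1, h1', Lp.coeFn_add q.1 q'.1, hT.ae (Lp.coeFn_add p.1 p'.1)]
        with x e1 e2 e3 e4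
      rw [Prod.fst_add, Prod.fst_add, e3, e4, Pi.add_apply, Pi.add_apply, e1, e2]
    · filter_upwards [h2, h2', Lp.coeFn_add q.2 q'.2, hT.ae (Lp.coeFn_add p.2 p'.2)]
        with x e1 e2 e3 e4
      rw [Prod.snd_add, Prod.snd_add, e3, e4, Pi.add_apply, Pi.add_apply, e1, e2, smul_add]
  · rintro c p q ⟨h1, h2⟩
    constructor
    · filter_upwards [h1, Lp.coeFn_smul c q.1, hT.ae (Lp.coeFn_smul c p.1)] with x e1 e3 e4
      rw [Prod.smul_fst, Prod.smul_fst, e3, e4, Pi.smul_apply, Pi.smul_apply, e1]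
    · filter_upwards [h2, Lp.coeFn_smul c q.2, hT.ae (Lp.coeFn_smul c p.2)] with x e1 e3 e4
      rw [Prod.smul_snd, Prod.smul_snd, e3, e4, Pi.smul_apply, Pi.smul_apply, e1, smul_comm]
  · intro p hp
    exact exists_gradientPairs_similarity ht v hp
  · rintro p - q ⟨h1, -⟩
    rw [norm_sq_eq_integral, norm_sq_eq_integral, ← integral_comp_similarity ht v]
    refine integral_congr_ae ?_
    filter_upwards [h1] with x e1
    rw [e1]
  · rintro p - q ⟨-, h2⟩
    rw [norm_sq_eq_integral, norm_sq_eq_integral, mul_assoc, ← integral_comp_similarity ht v,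
      ← integral_const_mul]
    refine le_of_eq (integral_congr_ae ?_)
    filter_upwards [h2] with x e1
    rw [e1, norm_smul, mul_pow, Real.norm_eq_abs, sq_abs]

/-- Transporting a test field keeps the bound 1. The derivative contributes t and the Jacobian t to
the power -d. -/
lemma perimeter_similarity_le (hd : 1 ≤ d) {t : ℝ} (ht : 0 < t) (v : Space d) {Ω : Set (Space d)}
    (hΩ : NullMeasurableSet Ω) {p : ℝ} (hp : 0 ≤ p) (hP : perimeter Ω ≤ ENNReal.ofReal p) :
    perimeter (similarity t v ⁻¹' Ω) ≤ ENNReal.ofReal ((t ^ (d - 1))⁻¹ * p) := by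
  rw [perimeter_le_iff (by positivity)]
  intro φ hφ
  have hdφ : Differentiable ℝ φ := hφ.1.differentiable one_ne_zero
  have hψ : IsTestField fun y => φ (t⁻¹ • (y - v)) :=
    ⟨hφ.1.comp ((contDiff_id.sub contDiff_const).const_smul t⁻¹),
      hasCompactSupport_comp_inv_similarity ht v hφ.2.1, fun x => hφ.2.2 _⟩
  set ψ : Space d → Space d := fun y => φ (t⁻¹ • (y - v))
  have h1 := (perimeter_le_iff hp).1 hP ψ hψ
  have hdiv : ∀ x, divergence φ x = t * divergence ψ (similarity t v x) := by
    intro x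
    simp only [divergence, ψ, fderiv_comp_inv_similarity v hdφ, similarity_rightInverse ht]
    rw [Finset.mul_sum]
    refine Finset.sum_congr rfl fun i _ => ?_
    simp only [smul_apply, PiLp.smul_apply, smul_eq_mul]
    field_simp
  have hΩ' : NullMeasurableSet (similarity t v ⁻¹' Ω) :=
    hΩ.preimage (quasiMeasurePreserving_similarity ht v)
  have e1 : ∫ x in similarity t v ⁻¹' Ω, divergence φ x =
      t * ((t ^ d)⁻¹ * ∫ x in Ω, divergence ψ x) := by
    rw [← integral_indicator₀ hΩ', ← integral_indicator₀ hΩ, ← integral_comp_similarity ht v,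
      ← integral_const_mul]
    refine integral_congr_ae (Eventually.of_forall fun x => ?_)
    beta_reduce
    by_cases hx : similarity t v x ∈ Ω
    · rw [indicator_of_mem (show x ∈ similarity t v ⁻¹' Ω from hx), indicator_of_mem hx, hdiv]
    · rw [indicator_of_notMem (show x ∉ similarity t v ⁻¹' Ω from hx), indicator_of_notMem hx,
        mul_zero]
  have e2 : t * (t ^ d)⁻¹ = (t ^ (d - 1))⁻¹ := by
    obtain ⟨m, rfl⟩ : ∃ m, d = m + 1 := ⟨d - 1, by omega⟩
    rw [Nat.add_sub_cancel, pow_succ]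
    field_simp
  rw [e1, ← mul_assoc, e2]
  gcongr

/-! ### Closing an empty slab -/

/-- Cutoff functions depending on one coordinate. -/
lemma exists_coordinate_ramp (j : Fin d) (c : ℝ) : ∃ (r : Space d → ℝ) (C : ℝ), ContDiff ℝ ∞ r ∧
    (∀ x, 0 ≤ r x ∧ r x ≤ 1) ∧ (∀ x, x j ≤ c → r x = 0) ∧ (∀ x, c + 1 ≤ x j → r x = 1) ∧
    (∀ x, ‖fderiv ℝ r x‖ ≤ C) ∧ ∀ x, ¬ (c < x j ∧ x j < c + 1) → fderiv ℝ r x = 0 := by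
  obtain ⟨C, hC, hCb⟩ := exists_bound_deriv_smoothTransition
  set P : Space d →L[ℝ] ℝ := EuclideanSpace.proj j
  have hfd : ∀ x, fderiv ℝ (fun x : Space d => Real.smoothTransition (x j - c)) x =
      deriv Real.smoothTransition (x j - c) • P := by
    intro x
    have h1 : HasFDerivAt (fun x : Space d => x j - c) P x := P.hasFDerivAt.sub_const c
    have h4 : HasDerivAt Real.smoothTransition _ (x j - c) :=
      ((Real.smoothTransition.contDiff (n := 1)).differentiable one_ne_zero _).hasDerivAt
    exact (h4.comp_hasFDerivAt x h1).fderiv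
  refine ⟨fun x => Real.smoothTransition (x j - c), C * ‖P‖, ?_, fun x =>
    ⟨Real.smoothTransition.nonneg _, Real.smoothTransition.le_one _⟩, fun x hx => ?_,
    fun x hx => ?_, fun x => ?_, fun x hx => ?_⟩
  · exact Real.smoothTransition.contDiff.comp (P.contDiff.sub contDiff_const)
  · exact Real.smoothTransition.zero_of_nonpos (by linarith)
  · exact Real.smoothTransition.one_of_one_le (by linarith)
  · rw [hfd, norm_smul]
    gcongr
    exact hCb _
  · rw [hfd, deriv_smoothTransition_eq_zero, zero_smul]
    rintro ⟨h1, h2⟩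
    exact hx ⟨by linarith, by linarith⟩

/-- The set obtained from `Ω` by moving the part in `{a + 5 ≤ x j}` towards the part in
`{x j ≤ a}` by one unit. -/
def closeGap (j : Fin d) (a : ℝ) (Ω : Set (Space d)) : Set (Space d) :=
  (Ω ∩ {x | x j ≤ a}) ∪ similarity 1 (EuclideanSpace.single j 1) ⁻¹' (Ω ∩ {x | a + 5 ≤ x j})

lemma similarity_one_apply (j : Fin d) (x : Space d) :
    similarity 1 (EuclideanSpace.single j 1) x j = x j + 1 := by
  simp [similarity]

lemma measurableSet_coord_le (j : Fin d) (a : ℝ) : MeasurableSet {x : Space d | x j ≤ a} :=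
  measurableSet_le (by fun_prop) measurable_const

lemma measurableSet_le_coord (j : Fin d) (a : ℝ) : MeasurableSet {x : Space d | a ≤ x j} :=
  measurableSet_le measurable_const (by fun_prop)

lemma nullMeasurableSet_closeGap (j : Fin d) (a : ℝ) {Ω : Set (Space d)}
    (hΩ : NullMeasurableSet Ω) : NullMeasurableSet (closeGap j a Ω) :=
  (hΩ.inter (measurableSet_coord_le j a).nullMeasurableSet).union
    ((hΩ.inter (measurableSet_le_coord j _).nullMeasurableSet).preimage
      (quasiMeasurePreserving_similarity one_pos _))

/-- The integral of the squared norm of a superposition of two pieces with disjoint supports. -/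
lemma integral_norm_sq_two_pieces {E : Type*} [NormedAddCommGroup E] [InnerProductSpace ℝ E]
    {θ₁ θ₂ : Space d → ℝ} (h₁ : Continuous θ₁) (h₂ : Continuous θ₂) (hb₁ : ∀ x, |θ₁ x| ≤ 1)
    (hb₂ : ∀ x, |θ₂ x| ≤ 1) (e : Space d)
    (hdisj : ∀ x, θ₁ x = 0 ∨ θ₂ (similarity 1 e x) = 0)
    (F : Lp E 2 (volume : Measure (Space d))) :
    ∫ x, ‖θ₁ x • F x + θ₂ (similarity 1 e x) • F (similarity 1 e x)‖ ^ 2 =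
      ∫ x, (θ₁ x ^ 2 + θ₂ x ^ 2) * ‖F x‖ ^ 2 := by
  have hF : Integrable fun x => ‖F x‖ ^ 2 := (Lp.memLp F).integrable_norm_pow two_ne_zero
  have hi : ∀ {θ : Space d → ℝ}, Continuous θ → (∀ x, |θ x| ≤ 1) →
      Integrable fun x => θ x ^ 2 * ‖F x‖ ^ 2 := by
    intro θ hc hb
    refine hF.bdd_mul (c := 1) (hc.pow 2).aestronglyMeasurable (Eventually.of_forall fun x => ?_)
    rw [norm_pow, Real.norm_eq_abs]
    exact pow_le_one₀ (abs_nonneg _) (hb x)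
  have hT : (Measure.map (similarity 1 e) (volume : Measure (Space d))) = volume := by
    rw [map_similarity one_pos]; simp
  have hmp : MeasurePreserving (similarity 1 e) (volume : Measure (Space d)) volume :=
    ⟨measurable_similarity 1 e, hT⟩
  have hi2 : Integrable fun x => θ₂ (similarity 1 e x) ^ 2 * ‖F (similarity 1 e x)‖ ^ 2 :=
    hmp.integrable_comp_of_integrable (hi h₂ hb₂)
  have e1 : ∫ x, θ₂ (similarity 1 e x) ^ 2 * ‖F (similarity 1 e x)‖ ^ 2 =
      ∫ x, θ₂ x ^ 2 * ‖F x‖ ^ 2 := by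
    rw [integral_comp_similarity one_pos e (fun x => θ₂ x ^ 2 * ‖F x‖ ^ 2)]
    simp
  simp only [add_mul]
  rw [integral_add (hi h₁ hb₁) (hi h₂ hb₂), ← e1, ← integral_add (hi h₁ hb₁) hi2]
  refine integral_congr_ae (Eventually.of_forall fun x => ?_)
  beta_reduce
  rcases hdisj x with h | h <;> simp [h, norm_smul, mul_pow]

/-- Each test function splits into its parts on the two sides of the slab, of which one is shifted.
The cutoffs vary only inside the slab, where the function vanishes, so the mass is unchanged and the
energy does not grow. -/
lemma hasTestSpace_closeGap (j : Fin d) (a : ℝ) {Ω : Set (Space d)}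
    (hgap : ∀ x ∈ Ω, x j ≤ a ∨ a + 5 ≤ x j) {k : ℕ} {l : ℝ}
    (h : HasTestSpace (gradientPairs Ω) k l) :
    HasTestSpace (gradientPairs (closeGap j a Ω)) k l := by
  -- The slab of width 5 leaves room for both ramps, between a + 1 and a + 2 and between a + 3 and a
  -- + 4, so that the two cutoffs stay disjoint even after the right one is moved by 1.
  obtain ⟨r₁, C₁, hr₁, h01₁, h0₁, h1₁, hC₁, hz₁⟩ := exists_coordinate_ramp j (a + 1)
  obtain ⟨r₂, C₂, hr₂, h01₂, h0₂, h1₂, hC₂, hz₂⟩ := exists_coordinate_ramp j (a + 3)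
  set e : Space d := EuclideanSpace.single j 1
  set T := similarity 1 e
  have hTj : ∀ x, T x j = x j + 1 := similarity_one_apply j
  have hT : Measure.QuasiMeasurePreserving T volume volume :=
    quasiMeasurePreserving_similarity one_pos e
  set θ₁ : Space d → ℝ := fun x => 1 - r₁ x
  have hθ₁ : ContDiff ℝ ∞ θ₁ := contDiff_const.sub hr₁
  have hb₁ : ∀ x, |θ₁ x| ≤ 1 := fun x => by
    rw [abs_le]; constructor <;> simp only [θ₁] <;> linarith [(h01₁ x).1, (h01₁ x).2]
  have hb₂ : ∀ x, |r₂ x| ≤ 1 := fun x => by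
    rw [abs_le]; constructor <;> linarith [(h01₂ x).1, (h01₂ x).2]
  have hfd₁ : ∀ x, fderiv ℝ θ₁ x = - fderiv ℝ r₁ x := fun x => by
    simp only [θ₁]; rw [fderiv_const_sub]
  have hL : ∀ x, x j ≤ a → θ₁ x = 1 ∧ r₂ x = 0 ∧ gradient θ₁ x = 0 ∧ gradient r₂ x = 0 := by
    intro x hx
    refine ⟨by simp [θ₁, h0₁ x (by linarith)], h0₂ x (by linarith), ?_, ?_⟩
    · rw [← norm_eq_zero, norm_gradient_eq, hfd₁, hz₁ x (fun h => by linarith [h.1])]; simp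
    · rw [← norm_eq_zero, norm_gradient_eq, hz₂ x (fun h => by linarith [h.1])]; simp
  have hR : ∀ x, a + 5 ≤ x j → θ₁ x = 0 ∧ r₂ x = 1 ∧ gradient θ₁ x = 0 ∧ gradient r₂ x = 0 := by
    intro x hx
    refine ⟨by simp [θ₁, h1₁ x (by linarith)], h1₂ x (by linarith), ?_, ?_⟩
    · rw [← norm_eq_zero, norm_gradient_eq, hfd₁, hz₁ x (fun h => by linarith [h.2])]; simp
    · rw [← norm_eq_zero, norm_gradient_eq, hz₂ x (fun h => by linarith [h.2])]; simp
  have hdisj : ∀ x, θ₁ x = 0 ∨ r₂ (T x) = 0 := by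
    intro x
    rcases le_total (a + 2) (x j) with hx | hx
    · left; simp [θ₁, h1₁ x (by linarith)]
    · right; exact h0₂ _ (by rw [hTj]; linarith)
  have hsq : ∀ x, θ₁ x ^ 2 + r₂ x ^ 2 ≤ 1 := by
    intro x
    rcases le_total (a + 2) (x j) with hx | hx
    · have : θ₁ x = 0 := by simp [θ₁, h1₁ x (by linarith)]
      rw [this]
      nlinarith [(h01₂ x).1, (h01₂ x).2]
    · rw [h0₂ x (by linarith)]
      have := abs_le.1 (hb₁ x)
      nlinarith
  have := h.transfer (𝒢' := gradientPairs (closeGap j a Ω))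
    (R := fun p q => (q.1 =ᵐ[volume] fun x => θ₁ x • p.1 x + r₂ (T x) • p.1 (T x)) ∧
      q.2 =ᵐ[volume] fun x => θ₁ x • p.2 x + r₂ (T x) • p.2 (T x))
    (a := 1) (b := 1) ?_ ?_ ?_ ?_ one_pos zero_le_one ?_ ?_
  · simpa using this
  · constructor
    · filter_upwards [Lp.coeFn_zero ℝ 2 (volume : Measure (Space d)),
        hT.ae (Lp.coeFn_zero ℝ 2 (volume : Measure (Space d)))] with x h1 h2
      rw [Prod.fst_zero, h1, h2]; simp
    · filter_upwards [Lp.coeFn_zero (Space d) 2 (volume : Measure (Space d)),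
        hT.ae (Lp.coeFn_zero (Space d) 2 (volume : Measure (Space d)))] with x h1 h2
      rw [Prod.snd_zero, h1, h2]; simp
  · rintro p q p' q' ⟨h1, h2⟩ ⟨h1', h2'⟩
    constructor
    · filter_upwards [h1, h1', Lp.coeFn_add q.1 q'.1, Lp.coeFn_add p.1 p'.1,
        hT.ae (Lp.coeFn_add p.1 p'.1)] with x e1 e2 e3 e4 e5
      rw [Prod.fst_add, Prod.fst_add, e3, e4, e5, Pi.add_apply, Pi.add_apply, Pi.add_apply, e1, e2]
      module
    · filter_upwards [h2, h2', Lp.coeFn_add q.2 q'.2, Lp.coeFn_add p.2 p'.2,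
        hT.ae (Lp.coeFn_add p.2 p'.2)] with x e1 e2 e3 e4 e5
      rw [Prod.snd_add, Prod.snd_add, e3, e4, e5, Pi.add_apply, Pi.add_apply, Pi.add_apply, e1, e2]
      module
  · rintro c p q ⟨h1, h2⟩
    constructor
    · filter_upwards [h1, Lp.coeFn_smul c q.1, Lp.coeFn_smul c p.1, hT.ae (Lp.coeFn_smul c p.1)]
        with x e1 e3 e4 e5
      rw [Prod.smul_fst, Prod.smul_fst, e3, e4, e5, Pi.smul_apply, Pi.smul_apply, Pi.smul_apply, e1]
      module
    · filter_upwards [h2, Lp.coeFn_smul c q.2, Lp.coeFn_smul c p.2, hT.ae (Lp.coeFn_smul c p.2)]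
        with x e1 e3 e4 e5
      rw [Prod.smul_snd, Prod.smul_snd, e3, e4, e5, Pi.smul_apply, Pi.smul_apply, Pi.smul_apply, e1]
      module
  · intro p hp
    have hgr : ∀ᵐ x, p.1 x • gradient θ₁ x = 0 ∧ p.1 x • gradient r₂ x = 0 := by
      filter_upwards [hp.2] with x hx
      by_cases hxΩ : x ∈ Ω
      · rcases hgap x hxΩ with h | h
        · obtain ⟨-, -, h1, h2⟩ := hL x h; simp [h1, h2]
        · obtain ⟨-, -, h1, h2⟩ := hR x h; simp [h1, h2]
      · simp [hx hxΩ]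
    obtain ⟨qa, hqa, hqa1, hqa2⟩ := exists_mul_gradientPairs hp hθ₁ hb₁ (K := C₁)
      (fun x => by rw [hfd₁, norm_neg]; exact hC₁ x)
    obtain ⟨qb, hqb, hqb1, hqb2⟩ := exists_mul_gradientPairs hp hr₂ hb₂ hC₂
    obtain ⟨qb', hqb', hqb1', hqb2'⟩ := exists_gradientPairs_similarity one_pos e hqb
    refine ⟨qa + qb', Submodule.add_mem _ (gradientPairs_mono ?_ hqa) (gradientPairs_mono ?_ hqb'),
      ?_, ?_⟩
    · refine Eventually.of_forall fun x hx => Or.inl ⟨hx.1, ?_⟩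
      rcases hgap x hx.1 with h | h
      · exact h
      · exact absurd (hR x h).1 hx.2
    · refine Eventually.of_forall fun x hx => Or.inr ⟨hx.1, ?_⟩
      rcases hgap _ hx.1 with h | h
      · exact absurd (hL _ h).2.1 hx.2
      · exact h
    · filter_upwards [Lp.coeFn_add qa.1 qb'.1, hqa1, hqb1', hT.ae hqb1] with x e1 e2 e3 e4
      rw [Prod.fst_add, e1, Pi.add_apply, e2, e3, e4]; rfl
    · filter_upwards [Lp.coeFn_add qa.2 qb'.2, hqa2, hqb2', hT.ae hqb2, hgr, hT.ae hgr]
        with x e1 e2 e3 e4 e5 e6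
      rw [Prod.snd_add, e1, Pi.add_apply, e2, e3, e4, e5.1, e6.2, add_zero, add_zero, one_smul]
  · rintro p hp q ⟨h1, -⟩
    rw [norm_sq_eq_integral, norm_sq_eq_integral, one_mul]
    have := integral_norm_sq_two_pieces hθ₁.continuous hr₂.continuous hb₁ hb₂ e hdisj p.1
    refine Eq.trans ?_ (this.trans ?_)
    · refine integral_congr_ae ?_
      filter_upwards [h1] with x e1
      rw [e1]
    · refine integral_congr_ae ?_
      filter_upwards [hp.2] with x hx
      by_cases hxΩ : x ∈ Ω
      · rcases hgap x hxΩ with h | h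
        · obtain ⟨h1, h2, -, -⟩ := hL x h; simp [h1, h2]
        · obtain ⟨h1, h2, -, -⟩ := hR x h; simp [h1, h2]
      · simp [hx hxΩ]
  · rintro p hp q ⟨-, h2⟩
    rw [norm_sq_eq_integral, norm_sq_eq_integral, one_mul]
    have := integral_norm_sq_two_pieces hθ₁.continuous hr₂.continuous hb₁ hb₂ e hdisj p.2
    refine le_trans (le_of_eq (Eq.trans ?_ this)) ?_
    · refine integral_congr_ae ?_
      filter_upwards [h2] with x e1
      rw [e1]
    · refine integral_mono_of_nonneg (Eventually.of_forall fun x => by positivity)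
        ((Lp.memLp p.2).integrable_norm_pow two_ne_zero) (Eventually.of_forall fun x => ?_)
      exact mul_le_of_le_one_left (sq_nonneg _) (hsq x)

/-- A test field φ for the new set is turned into one for Ω by taking φ to the left of the slab and
its translate to the right. The cutoffs have disjoint supports, so the bound 1 survives, and their
gradients live in the slab, away from Ω. -/
lemma perimeter_closeGap_le (j : Fin d) (a : ℝ) {Ω : Set (Space d)} (hΩ : NullMeasurableSet Ω)
    (hgap : ∀ x ∈ Ω, x j ≤ a ∨ a + 5 ≤ x j) {p : ℝ} (hp : 0 ≤ p)
    (hP : perimeter Ω ≤ ENNReal.ofReal p) :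
    perimeter (closeGap j a Ω) ≤ ENNReal.ofReal p := by
  obtain ⟨r₁, C₁, hr₁, h01₁, h0₁, h1₁, hC₁, hz₁⟩ := exists_coordinate_ramp j (a + 1)
  obtain ⟨r₂, C₂, hr₂, h01₂, h0₂, h1₂, hC₂, hz₂⟩ := exists_coordinate_ramp j (a + 3)
  set e : Space d := EuclideanSpace.single j 1
  set T := similarity 1 e
  have hTj : ∀ x, T x j = x j + 1 := similarity_one_apply j
  rw [perimeter_le_iff hp]
  intro φ hφ
  set ψ : Space d → Space d := fun x => φ (x - e)
  have hψ : IsTestField ψ := ⟨hφ.1.comp (contDiff_id.sub contDiff_const),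
    hφ.2.1.comp_homeomorph (Homeomorph.subRight e), fun x => hφ.2.2 _⟩
  have hr₁' : ContDiff ℝ 1 r₁ := hr₁.of_le (by simp)
  have hr₂' : ContDiff ℝ 1 r₂ := hr₂.of_le (by simp)
  set Φ : Space d → Space d := fun x => (1 - r₁ x) • φ x + r₂ x • ψ x
  have hΦ : IsTestField Φ := by
    refine ⟨((contDiff_const.sub hr₁').smul hφ.1).add (hr₂'.smul hψ.1),
      (hφ.2.1.smul_left (f := fun x => 1 - r₁ x)).add (hψ.2.1.smul_left (f := r₂)), fun x => ?_⟩
    refine (norm_add_le _ _).trans ?_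
    rw [norm_smul, norm_smul, Real.norm_of_nonneg (h01₂ x).1,
      Real.norm_of_nonneg (sub_nonneg.2 (h01₁ x).2)]
    rcases le_total (a + 2) (x j) with hx | hx
    · rw [h1₁ x (by linarith), sub_self, zero_mul, zero_add]
      exact mul_le_one₀ (h01₂ x).2 (norm_nonneg _) (hψ.2.2 x)
    · rw [h0₂ x (by linarith), zero_mul, add_zero]
      exact mul_le_one₀ (by linarith [(h01₁ x).1]) (norm_nonneg _) (hφ.2.2 x)
  have hdiv : ∀ x, divergence Φ x = (1 - r₁ x) * divergence φ x - fderiv ℝ r₁ x (φ x) +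
      (r₂ x * divergence ψ x + fderiv ℝ r₂ x (ψ x)) := by
    intro x
    have hd1 : DifferentiableAt ℝ (fun x => 1 - r₁ x) x :=
      (hr₁.differentiable (by simp) x).const_sub 1
    have hd2 : DifferentiableAt ℝ r₂ x := hr₂.differentiable (by simp) x
    have hdφ : DifferentiableAt ℝ φ x := hφ.1.differentiable one_ne_zero x
    have hdψ : DifferentiableAt ℝ ψ x := hψ.1.differentiable one_ne_zero x
    rw [divergence_add (φ := fun x => (1 - r₁ x) • φ x) (ψ := fun x => r₂ x • ψ x)
      (hd1.smul hdφ) (hd2.smul hdψ), divergence_smul hd1 hdφ, divergence_smul hd2 hdψ,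
      fderiv_const_sub]
    simp only [neg_apply]
    ring
  have hdivL : ∀ x, x j ≤ a → divergence Φ x = divergence φ x := by
    intro x hx
    rw [hdiv, h0₁ x (by linarith), h0₂ x (by linarith), hz₁ x (fun h => by linarith [h.1]),
      hz₂ x (fun h => by linarith [h.1])]
    simp
  have hdivR : ∀ x, a + 5 ≤ x j → divergence Φ x = divergence ψ x := by
    intro x hx
    rw [hdiv, h1₁ x (by linarith), h1₂ x (by linarith), hz₁ x (fun h => by linarith [h.2]),
      hz₂ x (fun h => by linarith [h.2])]
    simp
  have hψT : ∀ x, divergence ψ (T x) = divergence φ x := by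
    intro x
    have : ∀ y, fderiv ℝ ψ y = fderiv ℝ φ (y - e) := fun y => fderiv_comp_sub _
    simp [divergence, this, T, similarity]
  have hmL := measurableSet_coord_le j a
  have hmR := measurableSet_le_coord j (a + 5)
  have hL : NullMeasurableSet (Ω ∩ {x | x j ≤ a}) := hΩ.inter hmL.nullMeasurableSet
  have hR : NullMeasurableSet (Ω ∩ {x | a + 5 ≤ x j}) := hΩ.inter hmR.nullMeasurableSet
  have hR' : NullMeasurableSet (T ⁻¹' (Ω ∩ {x | a + 5 ≤ x j})) :=
    hR.preimage (quasiMeasurePreserving_similarity one_pos e)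
  have hint : ∀ {φ : Space d → Space d} {s : Set (Space d)}, IsTestField φ →
      IntegrableOn (divergence φ) s := fun h => (integrable_divergence h).integrableOn
  have e1 : ∫ x in closeGap j a Ω, divergence φ x = (∫ x in Ω ∩ {x | x j ≤ a}, divergence φ x) +
      ∫ x in T ⁻¹' (Ω ∩ {x | a + 5 ≤ x j}), divergence φ x := by
    refine setIntegral_union₀ (Disjoint.aedisjoint ?_) hR' (hint hφ) (hint hφ)
    rw [Set.disjoint_left]
    rintro x ⟨-, h1⟩ ⟨-, h2⟩
    change x j ≤ a at h1
    change a + 5 ≤ T x j at h2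
    rw [hTj] at h2
    linarith
  have e2 : ∫ x in Ω, divergence Φ x = (∫ x in Ω ∩ {x | x j ≤ a}, divergence Φ x) +
      ∫ x in Ω ∩ {x | a + 5 ≤ x j}, divergence Φ x := by
    have hΩeq : Ω = (Ω ∩ {x | x j ≤ a}) ∪ (Ω ∩ {x | a + 5 ≤ x j}) := by
      ext x
      constructor
      · intro hx
        rcases hgap x hx with h | h
        · exact Or.inl ⟨hx, h⟩
        · exact Or.inr ⟨hx, h⟩
      · rintro (h | h) <;> exact h.1
    conv_lhs => rw [hΩeq]
    refine setIntegral_union₀ (Disjoint.aedisjoint ?_) hR (hint hΦ) (hint hΦ)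
    rw [Set.disjoint_left]
    rintro x ⟨-, h1⟩ ⟨-, h2⟩
    change x j ≤ a at h1
    change a + 5 ≤ x j at h2
    linarith
  have e3 : ∫ x in Ω ∩ {x | x j ≤ a}, divergence Φ x =
      ∫ x in Ω ∩ {x | x j ≤ a}, divergence φ x := by
    rw [← integral_indicator₀ hL, ← integral_indicator₀ hL]
    congr 1
    ext x
    by_cases hx : x ∈ Ω ∩ {x | x j ≤ a}
    · rw [indicator_of_mem hx, indicator_of_mem hx, hdivL x hx.2]
    · rw [indicator_of_notMem hx, indicator_of_notMem hx]
  have e4 : ∫ x in Ω ∩ {x | a + 5 ≤ x j}, divergence Φ x =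
      ∫ x in T ⁻¹' (Ω ∩ {x | a + 5 ≤ x j}), divergence φ x := by
    rw [← integral_indicator₀ hR, ← integral_indicator₀ hR']
    have h1 := integral_comp_similarity one_pos e
      ((Ω ∩ {x | a + 5 ≤ x j}).indicator (divergence Φ))
    rw [one_pow, inv_one, one_mul] at h1
    rw [← h1]
    congr 1
    ext x
    by_cases hx : T x ∈ Ω ∩ {x | a + 5 ≤ x j}
    · rw [indicator_of_mem hx,
        indicator_of_mem (show x ∈ T ⁻¹' (Ω ∩ {x | a + 5 ≤ x j}) from hx), hdivR _ hx.2, hψT]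
    · rw [indicator_of_notMem hx,
        indicator_of_notMem (show x ∉ T ⁻¹' (Ω ∩ {x | a + 5 ≤ x j}) from hx)]
  rw [e1, ← e3, ← e4, ← e2]
  exact (perimeter_le_iff hp).1 hP Φ hΦ

/-! ### Cutting off eigenfunctions and Caccioppoli's inequality -/

/-- The sum of the squares of the functions of a finite family. -/
noncomputable def squareSum {k : ℕ} (p : Fin k → L2 d × L2Field d) (x : Space d) : ℝ :=
  ∑ i, (p i).1 x ^ 2

lemma squareSum_nonneg {k : ℕ} (p : Fin k → L2 d × L2Field d) (x : Space d) :
    0 ≤ squareSum p x := Finset.sum_nonneg fun _ _ => sq_nonneg _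

lemma integrable_squareSum {k : ℕ} (p : Fin k → L2 d × L2Field d) :
    Integrable (squareSum p) := by
  unfold squareSum
  exact integrable_finsetSum _ fun i _ => (Lp.memLp (p i).1).integrable_sq

lemma norm_sq_eq_integral_sq (u : L2 d) : ‖u‖ ^ 2 = ∫ x, u x ^ 2 := by
  rw [norm_sq_eq_integral]
  simp

lemma integral_squareSum {k : ℕ} {𝒢 : Submodule ℝ (L2 d × L2Field d)} {l : ℝ}
    {p : Fin k → L2 d × L2Field d} {μ : Fin k → ℝ} (hp : IsEigenSystem 𝒢 l p μ) :
    ∫ x, squareSum p x = k := by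
  unfold squareSum
  rw [integral_finsetSum _ fun i _ => (Lp.memLp (p i).1).integrable_sq]
  have : ∀ i, ∫ x, (p i).1 x ^ 2 = 1 := fun i => by
    rw [← norm_sq_eq_integral_sq, hp.orthonormal.1 i, one_pow]
  simp [this]

lemma sum_smul_ae {k : ℕ} (α : Fin k → ℝ) (u : Fin k → L2 d) :
    (∑ i, α i • u i : L2 d) =ᵐ[volume] fun x => ∑ i, α i * u i x := by
  have h1 := Lp.coeFn_finsetSum (μ := (volume : Measure (Space d))) (p := 2) Finset.univ
    fun i => α i • u i
  have h2 : ∀ᵐ x, ∀ i, (α i • u i : L2 d) x = α i * u i x := ae_all_iff.2 fun i => by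
    filter_upwards [Lp.coeFn_smul (α i) (u i)] with x hx using hx
  filter_upwards [h1, h2] with x h1 h2
  rw [h1, Finset.sum_apply]
  exact Finset.sum_congr rfl fun i _ => h2 i

/-- Restriction of a test space by a cutoff function. -/
lemma IsEigenSystem.hasTestSpace_mul {Ω : Set (Space d)} {k : ℕ} {l : ℝ}
    {p : Fin k → L2 d × L2Field d} {μ : Fin k → ℝ} (hp : IsEigenSystem (gradientPairs Ω) l p μ)
    (hl : 0 ≤ l) {η : Space d → ℝ} (hη : ContDiff ℝ ∞ η) (h01 : ∀ x, 0 ≤ η x ∧ η x ≤ 1) {K : ℝ}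
    (hK : ∀ x, ‖fderiv ℝ η x‖ ≤ K) {S : Set (Space d)} (hS : MeasurableSet S)
    (hSη : ∀ x, x ∉ S → η x = 1) (hSη' : ∀ x, x ∉ S → fderiv ℝ η x = 0)
    (he : ∫ x in S, squareSum p x ≤ 1 / 2) :
    HasTestSpace (gradientPairs (Ω ∩ {x | η x ≠ 0})) k
      (l + 2 * (l + K ^ 2) * ∫ x in S, squareSum p x) := by
  set e := ∫ x in S, squareSum p x
  have he0 : 0 ≤ e := integral_nonneg fun x => squareSum_nonneg p x
  have hM : ∀ x, |η x| ≤ 1 := fun x => abs_le.2 ⟨by linarith [(h01 x).1], (h01 x).2⟩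
  set R : L2 d × L2Field d → L2 d × L2Field d → Prop := fun p q =>
    (q.1 =ᵐ[volume] fun x => η x * p.1 x) ∧
      q.2 =ᵐ[volume] fun x => η x • p.2 x + p.1 x • gradient η x
  choose q hq hR using fun i => exists_mul_gradientPairs (hp.mem i) hη hM hK
  have hsum : ∀ α : Fin k → ℝ, R (∑ i, α i • p i) (∑ i, α i • q i) := by
    refine fun α => sum_smul_rel (R := R) ?_ ?_ ?_ hR α
    · constructor
      · filter_upwards [Lp.coeFn_zero ℝ 2 (volume : Measure (Space d))] with x h1
        rw [Prod.fst_zero, h1]; simp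
      · filter_upwards [Lp.coeFn_zero ℝ 2 (volume : Measure (Space d)),
          Lp.coeFn_zero (Space d) 2 (volume : Measure (Space d))] with x h1 h2
        rw [Prod.fst_zero, Prod.snd_zero, h1, h2]; simp
    · rintro p q p' q' ⟨h1, h2⟩ ⟨h1', h2'⟩
      constructor
      · filter_upwards [h1, h1', Lp.coeFn_add q.1 q'.1, Lp.coeFn_add p.1 p'.1]
          with x e1 e2 e3 e4
        rw [Prod.fst_add, Prod.fst_add, e3, e4, Pi.add_apply, Pi.add_apply, e1, e2, mul_add]
      · filter_upwards [h2, h2', Lp.coeFn_add q.2 q'.2, Lp.coeFn_add p.2 p'.2,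
          Lp.coeFn_add p.1 p'.1] with x e1 e2 e3 e4 e5
        rw [Prod.snd_add, Prod.snd_add, Prod.fst_add, e3, e4, e5, Pi.add_apply, Pi.add_apply,
          Pi.add_apply, e1, e2]
        module
    · rintro c p q ⟨h1, h2⟩
      constructor
      · filter_upwards [h1, Lp.coeFn_smul c q.1, Lp.coeFn_smul c p.1] with x e1 e3 e4
        rw [Prod.smul_fst, Prod.smul_fst, e3, e4, Pi.smul_apply, Pi.smul_apply, e1, smul_eq_mul,
          smul_eq_mul]
        ring
      · filter_upwards [h2, Lp.coeFn_smul c q.2, Lp.coeFn_smul c p.2, Lp.coeFn_smul c p.1]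
          with x e1 e3 e4 e5
        rw [Prod.smul_snd, Prod.smul_snd, Prod.smul_fst, e3, e4, e5, Pi.smul_apply, Pi.smul_apply,
          Pi.smul_apply, e1]
        module
  have hu : ∀ α : Fin k → ℝ, ‖∑ i, α i • (p i).1‖ ^ 2 = ∑ i, α i ^ 2 := by
    intro α
    rw [← real_inner_self_eq_norm_sq, hp.orthonormal.inner_sum]
    simp [sq]
  -- For U = ∑ α i u i and f = ∑ α i μ i u i, at most e|α|² of the mass of U is lost. The energy of
  -- ηU is ∫ f η²U plus ∫ U²|∇η|². Since ∫ (f - lU)U ≤ 0, inserting η² affects the first term only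
  -- on S. Hence the error is linear in e.
  have key : ∀ α : Fin k → ℝ,
      (1 - e) * ∑ i, α i ^ 2 ≤ ‖∑ i, α i • (q i).1‖ ^ 2 ∧
      ‖∑ i, α i • (q i).2‖ ^ 2 ≤ l * ‖∑ i, α i • (q i).1‖ ^ 2 +
        (l + K ^ 2) * (e * ∑ i, α i ^ 2) := by
    intro α
    set U := ∑ i, α i • p i
    set Q := ∑ i, α i • q i
    have hQ1 : Q.1 = ∑ i, α i • (q i).1 := by simp [Q, Prod.fst_sum]
    have hQ2 : Q.2 = ∑ i, α i • (q i).2 := by simp [Q, Prod.snd_sum]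
    have hU1 : U.1 = ∑ i, α i • (p i).1 := by simp [U, Prod.fst_sum]
    have hU2 : U.2 = ∑ i, α i • (p i).2 := by simp [U, Prod.snd_sum]
    set f : L2 d := ∑ i, (α i * μ i) • (p i).1
    have hUmem : U ∈ gradientPairs Ω := Submodule.sum_mem _ fun i _ =>
      Submodule.smul_mem _ _ (hp.mem i)
    have hf : ∀ r ∈ gradientPairs Ω, inner ℝ U.2 r.2 = inner ℝ f r.1 := by
      intro r hr
      rw [hU2, sum_inner, sum_inner]
      refine Finset.sum_congr rfl fun i _ => ?_
      rw [real_inner_smul_left, real_inner_smul_left, hp.inner_eq i r hr, mul_assoc]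
    have hE := norm_sq_mul_of_resolvent hUmem hf hη hM hK (hsum α).2
    have hN : ‖Q.1‖ ^ 2 = ∫ x, η x ^ 2 * U.1 x ^ 2 := by
      rw [norm_sq_eq_integral_sq]
      refine integral_congr_ae ?_
      filter_upwards [(hsum α).1] with x hx
      rw [hx, mul_pow]
    set A := ∑ i, α i ^ 2
    have hA0 : 0 ≤ A := Finset.sum_nonneg fun i _ => sq_nonneg _
    have hu2 : ∀ᵐ x, U.1 x ^ 2 ≤ A * squareSum p x := by
      filter_upwards [sum_smul_ae α fun i => (p i).1] with x hx
      rw [hU1, hx]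
      exact Finset.sum_mul_sq_le_sq_mul_sq _ _ _
    -- Cauchy-Schwarz on the coefficients, using |μ i - l| ≤ l because 0 ≤ μ i ≤ l.
    have hfl : ∀ᵐ x, |(f x - l * U.1 x) * U.1 x| ≤ l * (A * squareSum p x) := by
      filter_upwards [sum_smul_ae α fun i => (p i).1,
        sum_smul_ae (fun i => α i * μ i) fun i => (p i).1] with x hx hx'
      have h1 : f x - l * U.1 x = ∑ i, (α i * (μ i - l)) * (p i).1 x := by
        rw [hU1, hx, hx', Finset.mul_sum, ← Finset.sum_sub_distrib]
        exact Finset.sum_congr rfl fun i _ => by ring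
      have h2 : (f x - l * U.1 x) ^ 2 ≤ (l ^ 2 * A) * squareSum p x := by
        rw [h1]
        refine (Finset.sum_mul_sq_le_sq_mul_sq _ _ _).trans ?_
        refine mul_le_mul_of_nonneg_right ?_ (squareSum_nonneg p x)
        rw [Finset.mul_sum]
        refine Finset.sum_le_sum fun i _ => ?_
        rw [mul_pow, mul_comm]
        refine mul_le_mul_of_nonneg_right ?_ (sq_nonneg _)
        have := hp.nonneg i
        have := hp.le i
        nlinarith
      have h3 : U.1 x ^ 2 ≤ A * squareSum p x := by
        rw [hU1, hx]
        exact Finset.sum_mul_sq_le_sq_mul_sq _ _ _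
      apply abs_le_of_sq_le_sq _ (mul_nonneg hl (mul_nonneg hA0 (squareSum_nonneg p x)))
      rw [mul_pow]
      calc (f x - l * U.1 x) ^ 2 * U.1 x ^ 2
          ≤ ((l ^ 2 * A) * squareSum p x) * (A * squareSum p x) := by
            gcongr
            exact mul_nonneg (by positivity) (squareSum_nonneg p x)
        _ = _ := by ring
    have hUi : Integrable fun x => U.1 x ^ 2 := (Lp.memLp U.1).integrable_sq
    have hfUi : Integrable fun x => f x * U.1 x :=
      MemLp.integrable_mul (p := 2) (q := 2) (Lp.memLp f) (Lp.memLp U.1)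
    have hAi : Integrable fun x => A * squareSum p x := (integrable_squareSum p).const_mul A
    have hN0 : ∫ x, U.1 x ^ 2 = A := by rw [← norm_sq_eq_integral_sq, hU1, hu]
    have hη2m : AEStronglyMeasurable (fun x => η x ^ 2) volume :=
      (hη.continuous.pow 2).aestronglyMeasurable
    have hη2b : ∀ x, ‖η x ^ 2‖ ≤ 1 := fun x => by
      rw [norm_pow, Real.norm_eq_abs]; exact pow_le_one₀ (abs_nonneg _) (hM x)
    have hη2 : ∀ x, 0 ≤ η x ^ 2 ∧ η x ^ 2 ≤ 1 := fun x =>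
      ⟨sq_nonneg _, pow_le_one₀ (h01 x).1 (h01 x).2⟩
    have hηUi : Integrable fun x => η x ^ 2 * U.1 x ^ 2 :=
      hUi.bdd_mul (c := 1) hη2m (Eventually.of_forall hη2b)
    have hS2 : ∫ x, S.indicator (fun x => A * squareSum p x) x = e * A := by
      rw [integral_indicator hS, integral_const_mul, mul_comm]
    constructor
    · rw [← hQ1, hN]
      have h1 : ∫ x, U.1 x ^ 2 ≤ ∫ x, (η x ^ 2 * U.1 x ^ 2 +
          S.indicator (fun x => A * squareSum p x) x) := by
        refine integral_mono_ae hUi (hηUi.add (hAi.indicator hS)) ?_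
        filter_upwards [hu2] with x hx
        by_cases hxS : x ∈ S
        · rw [indicator_of_mem hxS]
          nlinarith [hη2 x, sq_nonneg (U.1 x)]
        · rw [indicator_of_notMem hxS, hSη x hxS]; linarith
      rw [integral_add hηUi (hAi.indicator hS), hS2, hN0] at h1
      linarith
    · rw [← hQ2, ← hQ1, hE, hN]
      have hgi : Integrable (fun x => U.1 x ^ 2 * ‖fderiv ℝ η x‖ ^ 2) := by
        refine hUi.mul_bdd (c := K ^ 2) ?_ (Eventually.of_forall fun x => ?_)
        · exact ((hη.continuous_fderiv (by simp)).norm.pow 2).aestronglyMeasurable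
        · rw [norm_pow, norm_norm]; gcongr; exact hK x
      have h1 : ∫ x, U.1 x ^ 2 * ‖fderiv ℝ η x‖ ^ 2 ≤ K ^ 2 * (e * A) := by
        rw [← hS2, ← integral_const_mul]
        refine integral_mono_ae hgi ((hAi.indicator hS).const_mul _) ?_
        filter_upwards [hu2] with x hx
        by_cases hxS : x ∈ S
        · rw [indicator_of_mem hxS, mul_comm]
          have := hK x
          gcongr
        · rw [indicator_of_notMem hxS, hSη' x hxS]; simp
      have hff : Integrable fun x => f x * (η x ^ 2 * U.1 x) := by
        refine (hfUi.bdd_mul (c := 1) hη2m (Eventually.of_forall hη2b)).congr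
          (Eventually.of_forall fun x => ?_)
        beta_reduce
        ring
      have h2 : ∫ x, (f x * (η x ^ 2 * U.1 x) - l * (η x ^ 2 * U.1 x ^ 2)) ≤
          ∫ x, ((f x * U.1 x - l * U.1 x ^ 2) +
            l * S.indicator (fun x => A * squareSum p x) x) := by
        refine integral_mono_ae (hff.sub (hηUi.const_mul l))
          ((hfUi.sub (hUi.const_mul l)).add ((hAi.indicator hS).const_mul l)) ?_
        filter_upwards [hfl] with x hx
        have h3 : f x * (η x ^ 2 * U.1 x) - l * (η x ^ 2 * U.1 x ^ 2) =
          (f x * U.1 x - l * U.1 x ^ 2) - (1 - η x ^ 2) * ((f x - l * U.1 x) * U.1 x) := by ring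
        rw [h3]
        by_cases hxS : x ∈ S
        · rw [indicator_of_mem hxS, sub_eq_add_neg]
          gcongr
          have h4 := abs_le.1 hx
          have h5 := hη2 x
          nlinarith
        · rw [indicator_of_notMem hxS, hSη x hxS]; simp
      have h6 : ∫ x, f x * U.1 x ≤ l * ∑ i, α i ^ 2 := by
        rw [← inner_eq_integral, hU1, hp.orthonormal.inner_sum, Finset.mul_sum]
        refine Finset.sum_le_sum fun i _ => ?_
        have := hp.le i
        simp only [conj_trivial]
        nlinarith [sq_nonneg (α i)]
      have h7 : ∫ x, ((f x * U.1 x - l * U.1 x ^ 2) +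
            l * S.indicator (fun x => A * squareSum p x) x) =
          (∫ x, f x * U.1 x) - l * A + l * (e * A) := by
        have h8 : Integrable fun x => f x * U.1 x - l * U.1 x ^ 2 := hfUi.sub (hUi.const_mul l)
        rw [integral_add h8 ((hAi.indicator hS).const_mul l),
          integral_sub hfUi (hUi.const_mul l), integral_const_mul, integral_const_mul, hN0, hS2]
      rw [integral_sub hff (hηUi.const_mul l), h7, integral_const_mul] at h2
      linarith
  refine ⟨q, hq, ?_, fun α => ?_⟩
  · rw [Fintype.linearIndependent_iff]
    intro α hα i
    have h1 := (key α).1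
    rw [hα, norm_zero] at h1
    have h2 : ∑ i, α i ^ 2 ≤ 0 := by
      by_contra! h
      nlinarith
    have h3 := (Finset.single_le_sum (f := fun i => α i ^ 2) (fun i _ => sq_nonneg (α i))
      (Finset.mem_univ i)).trans h2
    exact pow_eq_zero_iff two_ne_zero |>.1 (le_antisymm h3 (sq_nonneg _))
  · obtain ⟨h1, h2⟩ := key α
    have hA0 : 0 ≤ ∑ i, α i ^ 2 := Finset.sum_nonneg fun i _ => sq_nonneg _
    refine h2.trans ?_
    -- The assumption e ≤ 1/2 enters here and produces the factor 2 in the statement.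
    have h3 : ∑ i, α i ^ 2 ≤ 2 * ‖∑ i, α i • (q i).1‖ ^ 2 := by nlinarith
    have h4 : (l + K ^ 2) * (e * ∑ i, α i ^ 2) ≤
        (l + K ^ 2) * (e * (2 * ‖∑ i, α i • (q i).1‖ ^ 2)) := by gcongr
    linarith

/-- Caccioppoli's inequality combined with the Faber–Krahn inequality. -/
lemma exists_decay (hd : d ≠ 0) : ∃ C > 0, ∀ (Ω : Set (Space d)) (k : ℕ) (l : ℝ)
    (p : Fin k → L2 d × L2Field d) (μ : Fin k → ℝ), IsEigenSystem (gradientPairs Ω) l p μ → 0 ≤ l →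
    ∀ (η : Space d → ℝ) (K : ℝ) (B B' : Set (Space d)), ContDiff ℝ ∞ η →
    (∀ x, 0 ≤ η x ∧ η x ≤ 1) → (∀ x, ‖fderiv ℝ η x‖ ≤ K) → MeasurableSet B → MeasurableSet B' →
    (∀ x, x ∈ B' → η x = 1) → (∀ x, x ∉ B → η x = 0) → (∀ x, x ∉ B → fderiv ℝ η x = 0) →
    volume (Ω ∩ B) < ⊤ →
    ∫ x in B', squareSum p x ≤
      C * (volume.real (Ω ∩ B) ^ (1 / (d : ℝ))) ^ 2 * (l + K ^ 2) * ∫ x in B, squareSum p x := by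
  obtain ⟨C, hC, hFK⟩ := exists_norm_le_of_hasWeakGradient hd
  refine ⟨C ^ 2, by positivity, ?_⟩
  intro Ω k l p μ hp hl η K B B' hη h01 hK hB hB' h1 h0 h0' hfin
  have hM : ∀ x, |η x| ≤ 1 := fun x => abs_le.2 ⟨by linarith [(h01 x).1], (h01 x).2⟩
  have hi : ∀ i, Integrable fun x => (p i).1 x ^ 2 := fun i => (Lp.memLp (p i).1).integrable_sq
  simp only [squareSum]
  rw [integral_finsetSum _ fun i _ => (hi i).integrableOn,
    integral_finsetSum _ fun i _ => (hi i).integrableOn, Finset.mul_sum]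
  refine Finset.sum_le_sum fun i _ => ?_
  obtain ⟨q, hq, hq1, hq2⟩ := exists_mul_gradientPairs (hp.mem i) hη hM hK
  have hE := norm_sq_mul_of_resolvent (f := μ i • (p i).1) (hp.mem i) (fun r hr => by
    rw [real_inner_smul_left, hp.inner_eq i r hr]) hη hM hK hq2
  have hη2b : ∀ x, ‖η x ^ 2‖ ≤ 1 := fun x => by
    rw [norm_pow, Real.norm_eq_abs]; exact pow_le_one₀ (abs_nonneg _) (hM x)
  have hBi : Integrable (B.indicator fun x => (p i).1 x ^ 2) := (hi i).indicator hB
  have e1 : ∫ x in B', (p i).1 x ^ 2 ≤ ‖q.1‖ ^ 2 := by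
    rw [norm_sq_eq_integral_sq, ← integral_indicator hB']
    refine integral_mono_ae ((hi i).indicator hB') (Lp.memLp q.1).integrable_sq ?_
    filter_upwards [hq1] with x hx
    by_cases hxB : x ∈ B'
    · rw [indicator_of_mem hxB, hx, h1 x hxB, one_mul]
    · rw [indicator_of_notMem hxB]; positivity
  have e2 : ∫ x, (μ i • (p i).1 : L2 d) x * (η x ^ 2 * (p i).1 x) ≤
      l * ∫ x in B, (p i).1 x ^ 2 := by
    rw [← integral_indicator hB, ← integral_const_mul]
    refine integral_mono_of_nonneg ?_ (hBi.const_mul l) ?_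
    · filter_upwards [Lp.coeFn_smul (μ i) (p i).1] with x hx
      rw [hx, Pi.smul_apply, smul_eq_mul, Pi.zero_apply]
      have := mul_nonneg (hp.nonneg i) (mul_nonneg (sq_nonneg (η x)) (sq_nonneg ((p i).1 x)))
      linarith
    · filter_upwards [Lp.coeFn_smul (μ i) (p i).1] with x hx
      rw [hx, Pi.smul_apply, smul_eq_mul]
      by_cases hxB : x ∈ B
      · rw [indicator_of_mem hxB]
        have h3 : η x ^ 2 * (p i).1 x ^ 2 ≤ (p i).1 x ^ 2 :=
          mul_le_of_le_one_left (sq_nonneg _) (pow_le_one₀ (h01 x).1 (h01 x).2)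
        calc μ i * (p i).1 x * (η x ^ 2 * (p i).1 x) = μ i * (η x ^ 2 * (p i).1 x ^ 2) := by ring
          _ ≤ l * (p i).1 x ^ 2 := mul_le_mul (hp.le i) h3 (by positivity) hl
      · rw [indicator_of_notMem hxB, h0 x hxB]; simp
  have e3 : ∫ x, (p i).1 x ^ 2 * ‖fderiv ℝ η x‖ ^ 2 ≤ K ^ 2 * ∫ x in B, (p i).1 x ^ 2 := by
    rw [← integral_indicator hB, ← integral_const_mul]
    refine integral_mono_of_nonneg (Eventually.of_forall fun x => by positivity)
      (hBi.const_mul _) (Eventually.of_forall fun x => ?_)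
    beta_reduce
    by_cases hxB : x ∈ B
    · rw [indicator_of_mem hxB, mul_comm]
      have := hK x
      gcongr
    · rw [indicator_of_notMem hxB, h0' x hxB]; simp
  -- Faber-Krahn is applied to ηu, which lives in Ω ∩ B, so a small volume in B improves the
  -- estimate.
  have e4 := hFK q.1 q.2 (Ω ∩ B) (volume.real (Ω ∩ B)) hq.1 (by
    filter_upwards [hq.2] with x hx hxn
    refine hx fun h => hxn ⟨h.1, ?_⟩
    by_contra hxB
    exact h.2 (h0 x hxB)) measureReal_nonneg (by
    rw [measureReal_def, ENNReal.ofReal_toReal hfin.ne])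
  calc ∫ x in B', (p i).1 x ^ 2 ≤ ‖q.1‖ ^ 2 := e1
    _ ≤ (C * volume.real (Ω ∩ B) ^ (1 / (d : ℝ)) * ‖q.2‖) ^ 2 := by gcongr
    _ = C ^ 2 * (volume.real (Ω ∩ B) ^ (1 / (d : ℝ))) ^ 2 * ‖q.2‖ ^ 2 := by ring
    _ ≤ C ^ 2 * (volume.real (Ω ∩ B) ^ (1 / (d : ℝ))) ^ 2 *
        ((l + K ^ 2) * ∫ x in B, (p i).1 x ^ 2) := by
      gcongr
      rw [hE, add_mul]
      exact add_le_add e2 e3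
    _ = _ := by ring

/-! ### Density estimate for inner minimisers -/

/-- `Ω` minimises `λ_k + β P` among its subsets, where `l` and `p` are upper bounds for `λ_k(Ω)` and
`P(Ω)`. -/
structure IsInnerMin (β : ℝ) (k : ℕ) (Ω : Set (Space d)) (l p : ℝ) : Prop where
  nullMeasurableSet : NullMeasurableSet Ω
  volume_lt_top : volume Ω < ⊤
  hasTestSpace : HasTestSpace (gradientPairs Ω) k l
  nonneg_left : 0 ≤ l
  nonneg_right : 0 ≤ p
  perimeter_le : perimeter Ω ≤ ENNReal.ofReal p
  le : ∀ Ω' ⊆ Ω, NullMeasurableSet Ω' → ∀ l' p' : ℝ, 0 ≤ p' →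
    HasTestSpace (gradientPairs Ω') k l' → perimeter Ω' ≤ ENNReal.ofReal p' →
    l + β * p ≤ l' + β * p'

/-- The radial ramp in terms of radii: (t + δ)/((t + δ)² - t²) ≤ 1/δ. -/
lemma exists_ball_ramp (d : ℕ) : ∃ C > 0, ∀ (x₀ : Space d) (t δ : ℝ), 0 ≤ t → 0 < δ →
    ∃ r : Space d → ℝ, ContDiff ℝ ∞ r ∧ (∀ x, 0 ≤ r x ∧ r x ≤ 1) ∧
      (∀ x, ‖x - x₀‖ ≤ t → r x = 0) ∧ (∀ x, t + δ ≤ ‖x - x₀‖ → r x = 1) ∧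
      (∀ x, ‖fderiv ℝ r x‖ ≤ C / δ) ∧
      ∀ x, ¬ (t < ‖x - x₀‖ ∧ ‖x - x₀‖ < t + δ) → fderiv ℝ r x = 0 := by
  obtain ⟨C, hC, h⟩ := exists_ramp d
  refine ⟨C, hC, fun x₀ t δ ht hδ => ?_⟩
  obtain ⟨r, h1, h2, h3, h4, h5, h6⟩ := h x₀ (t ^ 2) ((t + δ) ^ 2) (by nlinarith) (sq_nonneg _)
  refine ⟨r, h1, h2, fun x hx => h3 x (by gcongr), fun x hx => h4 x (by gcongr), fun x => ?_,
    fun x hx => h6 x ?_⟩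
  · refine (h5 x).trans ?_
    rw [Real.sqrt_sq (by positivity), div_le_div_iff₀ (by nlinarith) hδ]
    nlinarith [mul_nonneg hC.le (mul_nonneg ht hδ.le)]
  · rintro ⟨h7, h8⟩
    exact hx ⟨lt_of_pow_lt_pow_left₀ 2 (norm_nonneg _) h7,
      lt_of_pow_lt_pow_left₀ 2 (by positivity) h8⟩

lemma rpow_one_div_pow {d : ℕ} (hd : d ≠ 0) {m : ℝ} (hm : 0 ≤ m) : (m ^ (1 / (d : ℝ))) ^ d = m := by
  rw [one_div]
  exact Real.rpow_inv_natCast_pow hm hd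

/-- De Giorgi's iteration. -/
lemma le_geometric_of_iteration {d : ℕ} (hd : 2 ≤ d) {A : ℝ} (hA : 1 ≤ A) {v e : ℕ → ℝ}
    (hv0 : ∀ n, 0 ≤ v n) (he0 : ∀ n, 0 ≤ e n)
    (hv : ∀ n, e n ≤ 1 / 2 → v (n + 1) ^ (d - 1) ≤ A * 4 ^ n * (v n ^ d + e n))
    (he : ∀ n, e (n + 1) ≤ A * 4 ^ n * v n ^ 2 * e n)
    (h0 : v 0 ^ d + e 0 ≤ ((A * 8 ^ d)⁻¹) ^ d) (n : ℕ) :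
    v n ^ d + e n ≤ ((A * 8 ^ d)⁻¹ * (4⁻¹) ^ n) ^ d := by
  obtain ⟨m, rfl⟩ : ∃ m, d = m + 1 := ⟨d - 1, by omega⟩
  rw [Nat.add_sub_cancel] at hv
  set a : ℝ := (A * 8 ^ (m + 1))⁻¹
  have ha0 : 0 < a := by positivity
  have h8 : (1 : ℝ) ≤ 8 ^ (m + 1) := one_le_pow₀ (by norm_num)
  have hAa : A * a = ((8 : ℝ) ^ (m + 1))⁻¹ := by
    simp only [a]; field_simp
  have ha1 : a ≤ 1 / 2 := by
    have h1 : a ≤ A * a := le_mul_of_one_le_left ha0.le hA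
    have h2 : (8 : ℝ) ≤ 8 ^ (m + 1) := le_self_pow₀ (by norm_num) (by omega)
    have h3 : ((8 : ℝ) ^ (m + 1))⁻¹ ≤ 8⁻¹ := inv_anti₀ (by norm_num) h2
    rw [hAa] at h1
    linarith
  induction n with
  | zero => simpa using h0
  | succ n ih =>
    -- The constant a is chosen so that A 4ⁿ W is 8 to the power -d at every stage: the decay of W
    -- compensates the growth of the coefficients, and both inequalities gain a power of W.
    set W : ℝ := a * 4⁻¹ ^ n
    have hq1 : (4⁻¹ : ℝ) ^ n ≤ 1 := pow_le_one₀ (by norm_num) (by norm_num)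
    have hW0 : 0 < W := by positivity
    have hWa : W ≤ a := mul_le_of_le_one_right ha0.le hq1
    have hWn : a * 4⁻¹ ^ (n + 1) = W / 4 := by simp only [W, pow_succ]; ring
    rw [hWn]
    have h4W : A * 4 ^ n * W = ((8 : ℝ) ^ (m + 1))⁻¹ := by
      rw [← hAa]
      simp only [W]
      rw [inv_pow]
      field_simp
    have hvW : v n ≤ W := by
      refine le_of_pow_le_pow_left₀ (n := m + 1) (by omega) hW0.le ?_
      linarith [he0 n]
    have heW : e n ≤ W ^ (m + 1) := by linarith [pow_nonneg (hv0 n) (m + 1)]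
    have hehalf : e n ≤ 1 / 2 := by
      refine heW.trans ((pow_le_of_le_one hW0.le ?_ (by omega)).trans ?_) <;> linarith
    have h1 : v (n + 1) ≤ W / 8 := by
      refine le_of_pow_le_pow_left₀ (n := m) (by omega) (by positivity) ((hv n hehalf).trans ?_)
      calc A * 4 ^ n * (v n ^ (m + 1) + e n) ≤ A * 4 ^ n * W ^ (m + 1) := by gcongr
        _ = (A * 4 ^ n * W) * W ^ m := by ring
        _ = ((8 : ℝ) ^ (m + 1))⁻¹ * W ^ m := by rw [h4W]
        _ ≤ ((8 : ℝ) ^ m)⁻¹ * W ^ m := by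
          gcongr
          · norm_num
          · omega
        _ = (W / 8) ^ m := by rw [div_pow]; ring
    have h2 : e (n + 1) ≤ ((8 : ℝ) ^ (m + 1))⁻¹ * W ^ (m + 1) := by
      calc e (n + 1) ≤ A * 4 ^ n * v n ^ 2 * e n := he n
        _ ≤ A * 4 ^ n * W ^ 2 * W ^ (m + 1) := by
          gcongr
          · exact he0 n
          · exact hv0 n
        _ = (A * 4 ^ n * W) * W * W ^ (m + 1) := by ring
        _ ≤ (A * 4 ^ n * W) * 1 * W ^ (m + 1) := by gcongr; linarith
        _ = _ := by rw [h4W, mul_one]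
    have h3 : v (n + 1) ^ (m + 1) ≤ ((8 : ℝ) ^ (m + 1))⁻¹ * W ^ (m + 1) := by
      calc v (n + 1) ^ (m + 1) ≤ (W / 8) ^ (m + 1) := by
            gcongr
            exact hv0 _
        _ = _ := by rw [div_pow]; ring
    -- The target is at least twice the common bound for the volume and mass terms, which leaves
    -- room for their sum.
    have h5 : (W / 4) ^ (m + 1) = 2 ^ (m + 1) * (((8 : ℝ) ^ (m + 1))⁻¹ * W ^ (m + 1)) := by
      rw [← inv_pow, ← mul_pow, ← mul_pow]; congr 1; ring
    have h6 : (2 : ℝ) ≤ 2 ^ (m + 1) := le_self_pow₀ (by norm_num) (by omega)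
    rw [h5]
    have h7 : 0 ≤ ((8 : ℝ) ^ (m + 1))⁻¹ * W ^ (m + 1) := by positivity
    nlinarith

/-- The two inequalities of the iteration. -/
lemma exists_density_step (hd : 2 ≤ d) {β : ℝ} (hβ : 0 < β) {l₀ : ℝ} (hl₀ : 0 ≤ l₀) :
    ∃ A ≥ (1 : ℝ), ∀ (k : ℕ) (Ω : Set (Space d)) (l p : ℝ), IsInnerMin β k Ω l p → l ≤ l₀ →
      ∀ (P : Fin k → L2 d × L2Field d) (μ : Fin k → ℝ), IsEigenSystem (gradientPairs Ω) l P μ →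
      ∀ (x₀ : Space d) (s δ : ℝ), 0 ≤ s → 0 < δ → δ ≤ 1 →
      (∫ x in Metric.closedBall x₀ (s + 2 * δ), squareSum P x ≤ 1 / 2 →
        (volume.real (Ω ∩ Metric.closedBall x₀ s) ^ (1 / (d : ℝ))) ^ (d - 1) ≤
          A / δ ^ 2 * (volume.real (Ω ∩ Metric.closedBall x₀ (s + 2 * δ)) +
            ∫ x in Metric.closedBall x₀ (s + 2 * δ), squareSum P x)) ∧
      ∫ x in Metric.closedBall x₀ s, squareSum P x ≤
        A / δ ^ 2 * (volume.real (Ω ∩ Metric.closedBall x₀ (s + 2 * δ)) ^ (1 / (d : ℝ))) ^ 2 *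
          ∫ x in Metric.closedBall x₀ (s + 2 * δ), squareSum P x := by
  have hd0 : d ≠ 0 := by omega
  obtain ⟨C₁, hC₁, hramp⟩ := exists_ball_ramp d
  obtain ⟨C₂, hC₂, hcut⟩ := exists_cut d
  obtain ⟨C₃, hC₃, hiso⟩ := exists_isoperimetric hd0
  obtain ⟨C₄, hC₄, hdec⟩ := exists_decay hd0
  set A₁ : ℝ := C₃ / β * (2 * (l₀ + C₁ ^ 2) + β * C₂)
  set A₂ : ℝ := C₄ * (l₀ + C₁ ^ 2)
  have hA₁ : 0 ≤ A₁ := by positivity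
  have hA₂ : 0 ≤ A₂ := by positivity
  refine ⟨1 + A₁ + A₂, by simp only [ge_iff_le]; linarith, ?_⟩
  intro k Ω l p hmin hll P μ hP x₀ s δ hs hδ hδ1
  have hl := hmin.nonneg_left
  have hfin : ∀ r, volume (Ω ∩ Metric.closedBall x₀ r) < ⊤ := fun r =>
    (measure_mono inter_subset_left).trans_lt hmin.volume_lt_top
  have hδ2 : 1 ≤ 1 / δ ^ 2 := by
    rw [le_div_iff₀ (by positivity), one_mul]
    exact pow_le_one₀ hδ.le hδ1
  have hlK : l + (C₁ / δ) ^ 2 ≤ (l₀ + C₁ ^ 2) * (1 / δ ^ 2) := by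
    have h1 : l ≤ l₀ * (1 / δ ^ 2) := hll.trans (le_mul_of_one_le_right hl₀ hδ2)
    rw [add_mul, div_pow, mul_one_div (C₁ ^ 2)]
    linarith
  set e : ℝ → ℝ := fun r => ∫ x in Metric.closedBall x₀ r, squareSum P x
  have he0 : ∀ r, 0 ≤ e r := fun r => integral_nonneg fun x => squareSum_nonneg P x
  have hmono : ∀ r r', r ≤ r' → volume.real (Ω ∩ Metric.closedBall x₀ r) ≤
      volume.real (Ω ∩ Metric.closedBall x₀ r') := fun r r' h =>
    measureReal_mono (inter_subset_inter_right _ (Metric.closedBall_subset_closedBall h))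
      (hfin r').ne
  have hnorm : ∀ (r : ℝ) (x : Space d), x ∈ Metric.closedBall x₀ r ↔ ‖x - x₀‖ ≤ r := fun r x => by
    rw [Metric.mem_closedBall, dist_eq_norm]
  have hmeas : ∀ r, MeasurableSet (Metric.closedBall x₀ r) := fun r =>
    Metric.isClosed_closedBall.measurableSet
  constructor
  · intro he
    change e (s + 2 * δ) ≤ 1 / 2 at he
    change _ ≤ (1 + A₁ + A₂) / δ ^ 2 * (_ + e (s + 2 * δ))
    set m := volume.real (Ω ∩ Metric.closedBall x₀ (s + 2 * δ))
    have hm0 : 0 ≤ m := measureReal_nonneg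
    suffices h : ∀ ε > 0, (volume.real (Ω ∩ Metric.closedBall x₀ s) ^ (1 / (d : ℝ))) ^ (d - 1) ≤
        A₁ / δ ^ 2 * (m + e (s + 2 * δ)) + C₃ * ε by
      have h2 : (volume.real (Ω ∩ Metric.closedBall x₀ s) ^ (1 / (d : ℝ))) ^ (d - 1) ≤
        A₁ / δ ^ 2 * (m + e (s + 2 * δ)) := by
        refine le_of_forall_pos_le_add fun ε hε => ?_
        have := h (ε / C₃) (by positivity)
        rwa [mul_div_cancel₀ _ hC₃.ne'] at this
      refine h2.trans ?_
      have := he0 (s + 2 * δ)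
      gcongr
      linarith
    intro ε hε
    -- The competitor is Ω without the ball of radius t in [s, s + δ). Its test space comes from a
    -- cutoff rising between t and t + δ, which stays inside the ball of radius s + 2δ.
    obtain ⟨t, ht, p₁, p₂, hp₁, hp₂, hP₁, hP₂, hpp⟩ := hcut Ω p hmin.nullMeasurableSet
      hmin.nonneg_right hmin.perimeter_le x₀ s δ ε hs hδ hε
    obtain ⟨r, hr, hr01, hr0, hr1, hrK, hrz⟩ := hramp x₀ t δ (hs.trans ht.1) hδ
    have hts : t + δ ≤ s + 2 * δ := by linarith [ht.2]
    have hT := hP.hasTestSpace_mul hl hr hr01 hrK (hmeas (s + 2 * δ))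
      (fun x hx => hr1 x (by rw [hnorm, not_le] at hx; linarith))
      (fun x hx => hrz x (by rw [hnorm, not_le] at hx; exact fun h => by linarith [h.2])) he
    have hsub : Ω ∩ {x | r x ≠ 0} ⊆ Ω \ Metric.closedBall x₀ t := fun x hx =>
      ⟨hx.1, fun h => hx.2 (hr0 x ((hnorm _ _).1 h))⟩
    have hle := hmin.le (Ω \ Metric.closedBall x₀ t) Set.sdiff_subset
      (hmin.nullMeasurableSet.diff (hmeas t).nullMeasurableSet) _ p₂ hp₂
      (hT.mono (gradientPairs_mono (Eventually.of_forall hsub)) le_rfl) hP₂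
    have hann : volume.real (Ω ∩ (Metric.closedBall x₀ (s + δ) \ Metric.closedBall x₀ s)) ≤ m :=
      measureReal_mono (inter_subset_inter_right _ (Set.sdiff_subset.trans
        (Metric.closedBall_subset_closedBall (by linarith)))) (hfin _).ne
    -- Minimality bounds the perimeter of the removed piece by the increase of λ_k plus the cost of
    -- the cut.
    have hp₁le : β * p₁ ≤ 2 * (l + (C₁ / δ) ^ 2) * e (s + 2 * δ) + β * (C₂ / δ * m) + β * ε := by
      have h1 : C₂ / δ * volume.real (Ω ∩ (Metric.closedBall x₀ (s + δ) \ Metric.closedBall x₀ s)) ≤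
        C₂ / δ * m := by gcongr
      have h2 : β * (p₁ + p₂) ≤ β * (p + C₂ / δ * m + ε) :=
        mul_le_mul_of_nonneg_left (by linarith) hβ.le
      change l + β * p ≤ l + 2 * (l + (C₁ / δ) ^ 2) * e (s + 2 * δ) + β * p₂ at hle
      linarith
    have hp₁' : C₃ * p₁ ≤ A₁ / δ ^ 2 * (m + e (s + 2 * δ)) + C₃ * ε := by
      have hδ' : C₂ / δ ≤ C₂ / δ ^ 2 := by
        gcongr
        exact pow_le_of_le_one hδ.le hδ1 two_ne_zero
      have h1 : β * p₁ ≤ 2 * ((l₀ + C₁ ^ 2) * (1 / δ ^ 2)) * e (s + 2 * δ) +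
          β * (C₂ / δ ^ 2 * m) + β * ε := by
        refine hp₁le.trans ?_
        have := he0 (s + 2 * δ)
        gcongr
      have h2 : 2 * ((l₀ + C₁ ^ 2) * (1 / δ ^ 2)) * e (s + 2 * δ) + β * (C₂ / δ ^ 2 * m) ≤
          (2 * (l₀ + C₁ ^ 2) + β * C₂) / δ ^ 2 * (m + e (s + 2 * δ)) := by
        have h3 : 0 ≤ 2 * (l₀ + C₁ ^ 2) / δ ^ 2 * m := by positivity
        have h4 : 0 ≤ β * C₂ / δ ^ 2 * e (s + 2 * δ) := by have := he0 (s + 2 * δ); positivity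
        have h5 : (2 * (l₀ + C₁ ^ 2) + β * C₂) / δ ^ 2 * (m + e (s + 2 * δ)) =
          2 * ((l₀ + C₁ ^ 2) * (1 / δ ^ 2)) * e (s + 2 * δ) + β * (C₂ / δ ^ 2 * m) +
            (2 * (l₀ + C₁ ^ 2) / δ ^ 2 * m + β * C₂ / δ ^ 2 * e (s + 2 * δ)) := by ring
        linarith
      have h6 : C₃ / β * (β * p₁) ≤ C₃ / β *
          ((2 * (l₀ + C₁ ^ 2) + β * C₂) / δ ^ 2 * (m + e (s + 2 * δ)) + β * ε) := by
        gcongr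
        linarith
      calc C₃ * p₁ = C₃ / β * (β * p₁) := by field_simp
        _ ≤ _ := h6
        _ = _ := by simp only [A₁]; field_simp
    refine le_trans ?_ hp₁'
    set M := volume.real (Ω ∩ Metric.closedBall x₀ t)
    have hM0 : 0 ≤ M := measureReal_nonneg
    have hI := hiso (Ω ∩ Metric.closedBall x₀ t) p₁
      (hmin.nullMeasurableSet.inter (hmeas t).nullMeasurableSet) (hfin t) hp₁ hP₁
    have hv : volume.real (Ω ∩ Metric.closedBall x₀ s) ^ (1 / (d : ℝ)) ≤ M ^ (1 / (d : ℝ)) :=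
      Real.rpow_le_rpow measureReal_nonneg (hmono s t ht.1) (by positivity)
    refine (pow_le_pow_left₀ (by positivity) hv (d - 1)).trans ?_
    change M ≤ C₃ * M ^ (1 / (d : ℝ)) * p₁ at hI
    have hvd := rpow_one_div_pow hd0 hM0
    set V := M ^ (1 / (d : ℝ))
    have hV0 : 0 ≤ V := by positivity
    rcases hV0.eq_or_lt with h | h
    · rw [← h, zero_pow (by omega)]; positivity
    · rw [← hvd] at hI
      have h1 : V ^ d = V ^ (d - 1) * V := by rw [← pow_succ]; congr 1; omega
      rw [h1] at hI
      exact le_of_mul_le_mul_right (by linarith) h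
  · obtain ⟨r, hr, hr01, hr0, hr1, hrK, hrz⟩ := hramp x₀ s δ hs hδ
    have hfd : ∀ x, fderiv ℝ (fun x => 1 - r x) x = - fderiv ℝ r x := fun x => by
      rw [fderiv_const_sub]
    have := hdec Ω k l P μ hP hl (fun x => 1 - r x) (C₁ / δ) (Metric.closedBall x₀ (s + 2 * δ))
      (Metric.closedBall x₀ s) (contDiff_const.sub hr)
      (fun x => ⟨by linarith [(hr01 x).2], by linarith [(hr01 x).1]⟩)
      (fun x => by rw [hfd, norm_neg]; exact hrK x) (hmeas _) (hmeas _)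
      (fun x hx => by rw [hr0 x ((hnorm _ _).1 hx), sub_zero])
      (fun x hx => by
        rw [hnorm, not_le] at hx
        rw [hr1 x (by linarith), sub_self])
      (fun x hx => by
        rw [hnorm, not_le] at hx
        rw [hfd, hrz x (fun h => by linarith [h.2]), neg_zero]) (hfin _)
    refine this.trans ?_
    change _ * e (s + 2 * δ) ≤ _ * e (s + 2 * δ)
    refine mul_le_mul_of_nonneg_right ?_ (he0 _)
    set V := volume.real (Ω ∩ Metric.closedBall x₀ (s + 2 * δ)) ^ (1 / (d : ℝ))
    calc C₄ * V ^ 2 * (l + (C₁ / δ) ^ 2) ≤ C₄ * V ^ 2 * ((l₀ + C₁ ^ 2) * (1 / δ ^ 2)) := by gcongr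
      _ = A₂ / δ ^ 2 * V ^ 2 := by simp only [A₂]; ring
      _ ≤ (1 + A₁ + A₂) / δ ^ 2 * V ^ 2 := by gcongr; linarith

/-- A lower density bound for minimisers. -/
lemma exists_density (hd : 2 ≤ d) {β : ℝ} (hβ : 0 < β) {l₀ : ℝ} (hl₀ : 0 ≤ l₀) (k : ℕ) :
    ∃ τ > (0 : ℝ), ∀ (Ω : Set (Space d)) (l p : ℝ), IsInnerMin β k Ω l p → l ≤ l₀ →
      ∀ x₀ : Space d, volume.real (Ω ∩ Metric.closedBall x₀ 3) ≤ τ →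
        volume (Ω ∩ Metric.closedBall x₀ 1) = 0 := by
  have hd0 : d ≠ 0 := by omega
  obtain ⟨A, hA, hstep⟩ := exists_density_step hd hβ hl₀
  -- With δ = 2^(-(n+2)) one has A/δ² = 16 A 4ⁿ.
  set B : ℝ := 16 * A
  have hB : 1 ≤ B := by simp only [B]; linarith
  set a : ℝ := (B * 8 ^ d)⁻¹
  have ha : 0 < a := by positivity
  -- The initial volume and mass are bounded by σ and 4Aσk, so this σ starts the iteration.
  set σ : ℝ := min 1 (a ^ d / (1 + 4 * A * k))
  have hσ : 0 < σ := by positivity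
  refine ⟨σ ^ d, by positivity, fun Ω l p hmin hll x₀ hx₀ => ?_⟩
  obtain ⟨P, μ, hP⟩ := hmin.hasTestSpace.exists_isEigenSystem
    (compactPairs_gradientPairs_self hmin.volume_lt_top)
  have hS := hstep k Ω l p hmin hll P μ hP x₀
  set m : ℝ → ℝ := fun r => volume.real (Ω ∩ Metric.closedBall x₀ r)
  set e : ℝ → ℝ := fun r => ∫ x in Metric.closedBall x₀ r, squareSum P x
  have he0 : ∀ r, 0 ≤ e r := fun r => integral_nonneg fun x => squareSum_nonneg P x
  have hm0 : ∀ r, 0 ≤ m r := fun r => measureReal_nonneg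
  have hfin : ∀ r, volume (Ω ∩ Metric.closedBall x₀ r) < ⊤ := fun r =>
    (measure_mono inter_subset_left).trans_lt hmin.volume_lt_top
  have hmono : ∀ r r', r ≤ r' → m r ≤ m r' := fun r r' h =>
    measureReal_mono (inter_subset_inter_right _ (Metric.closedBall_subset_closedBall h))
      (hfin r').ne
  have hek : ∀ r, e r ≤ k := fun r => by
    rw [← integral_squareSum hP]
    exact setIntegral_le_integral (integrable_squareSum P)
      (Eventually.of_forall fun x => squareSum_nonneg P x)
  set w : ℝ → ℝ := fun r => m r ^ (1 / (d : ℝ))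
  have hw0 : ∀ r, 0 ≤ w r := fun r => Real.rpow_nonneg (hm0 r) _
  have hwd : ∀ r, w r ^ d = m r := fun r => rpow_one_div_pow hd0 (hm0 r)
  have hw3 : w 3 ≤ σ := le_of_pow_le_pow_left₀ hd0 hσ.le (by rw [hwd]; exact hx₀)
  -- The radii decrease from 2 to 1.
  set ρ : ℕ → ℝ := fun n => 1 + 2⁻¹ ^ n
  have hinit : w (ρ 0) ^ d + e (ρ 0) ≤ a ^ d := by
    have hρ0 : ρ 0 = 2 := by simp only [ρ]; norm_num
    rw [hρ0]
    -- Only the volume is assumed small. One decay step from radius 3 to radius 2, starting from the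
    -- total mass k, makes the mass small as well.
    have h1 := (hS 2 (1 / 2) (by norm_num) (by norm_num) (by norm_num)).2
    have h23 : (2 : ℝ) + 2 * (1 / 2) = 3 := by norm_num
    rw [h23] at h1
    change e 2 ≤ A / (1 / 2) ^ 2 * w 3 ^ 2 * e 3 at h1
    have hσ1 : σ ≤ 1 := min_le_left _ _
    have hA4 : A / (1 / 2) ^ 2 = 4 * A := by ring
    rw [hA4] at h1
    have h2 : e 2 ≤ 4 * A * σ * k := by
      refine h1.trans ?_
      have h3 : w 3 ^ 2 ≤ σ := (pow_le_pow_left₀ (hw0 3) hw3 2).trans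
        (pow_le_of_le_one hσ.le hσ1 two_ne_zero)
      have := he0 3
      have := hek 3
      gcongr
    have h4 : w 2 ^ d ≤ σ := by
      rw [hwd]
      refine (hmono 2 3 (by norm_num)).trans (hx₀.trans ?_)
      exact pow_le_of_le_one hσ.le hσ1 hd0
    have h5 : σ ≤ a ^ d / (1 + 4 * A * k) := min_le_right _ _
    rw [le_div_iff₀ (by positivity)] at h5
    linarith
  have hiter := le_geometric_of_iteration hd hB (v := fun n => w (ρ n)) (e := fun n => e (ρ n))
    (fun n => hw0 _) (fun n => he0 _) (fun n hn => ?_) (fun n => ?_) hinit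
  · have hlim : Tendsto (fun n : ℕ => (a * (4⁻¹ : ℝ) ^ n) ^ d) atTop (𝓝 0) := by
      have h1 : Tendsto (fun n : ℕ => (4⁻¹ : ℝ) ^ n) atTop (𝓝 0) :=
        tendsto_pow_atTop_nhds_zero_of_lt_one (by norm_num) (by norm_num)
      have h2 := (h1.const_mul a).pow d
      rwa [mul_zero, zero_pow hd0] at h2
    have hm1 : m 1 ≤ 0 := by
      refine ge_of_tendsto' hlim fun n => ?_
      have h1 := hiter n
      simp only [hwd] at h1
      have h2 : m 1 ≤ m (ρ n) := hmono _ _ (by simp only [ρ, le_add_iff_nonneg_right]; positivity)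
      linarith [he0 (ρ n)]
    have := le_antisymm hm1 (hm0 1)
    exact (measureReal_eq_zero_iff (hfin 1).ne).1 this
  all_goals
    have hδ : ρ (n + 1) + 2 * (2⁻¹ ^ (n + 2)) = ρ n := by
      simp only [ρ, pow_succ]; ring
    have hA' : A / (2⁻¹ ^ (n + 2)) ^ 2 = B * 4 ^ n := by
      simp only [B]
      rw [← pow_mul, inv_pow, div_inv_eq_mul, mul_comm (n + 2), pow_mul, pow_add]
      norm_num
      ring
    have h1 := hS (ρ (n + 1)) (2⁻¹ ^ (n + 2)) (by positivity) (by positivity)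
      (pow_le_one₀ (by norm_num) (by norm_num))
    rw [hδ, hA'] at h1
  · simp only [hwd]
    exact h1.1 hn
  · exact h1.2

/-! ### Covering by few balls and confinement -/

/-- A set satisfying a lower density bound is covered by finitely many balls. -/
lemma exists_finset_cover {Ω : Set (Space d)} (hΩ : NullMeasurableSet Ω) {τ : ℝ}
    (hτ : 0 < τ) {N : ℕ} (hN : volume Ω ≤ ENNReal.ofReal (N * τ))
    (hdens : ∀ x₀ : Space d, volume.real (Ω ∩ Metric.closedBall x₀ 3) ≤ τ →
        volume (Ω ∩ Metric.closedBall x₀ 1) = 0) :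
    ∃ T : Finset (Space d), T.card ≤ N ∧ ∀ᵐ x, x ∈ Ω → ∃ c ∈ T, ‖x - c‖ ≤ 6 := by
  classical
  have hfin : volume Ω < ⊤ := hN.trans_lt ENNReal.ofReal_lt_top
  set X : Set (Space d) := {x | volume (Ω ∩ Metric.closedBall x 1) ≠ 0}
  have hX : ∀ x ∈ X, ENNReal.ofReal τ ≤ volume (Ω ∩ Metric.closedBall x 3) := by
    intro x hx
    have h1 : τ < volume.real (Ω ∩ Metric.closedBall x 3) := by
      by_contra! h
      exact hx (hdens x h)
    rw [← ENNReal.ofReal_toReal ((measure_mono inter_subset_left).trans_lt hfin).ne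
      (a := volume (Ω ∩ Metric.closedBall x 3))]
    exact ENNReal.ofReal_le_ofReal h1.le
  have hae : ∀ᵐ x, x ∈ Ω → x ∈ X := by
    have h0 : volume (Ω \ X) = 0 := by
      refine measure_null_of_locally_null _ fun x hx => ?_
      refine ⟨(Ω \ X) ∩ Metric.closedBall x 1, inter_mem_nhdsWithin _ ?_, ?_⟩
      · exact Metric.closedBall_mem_nhds x one_pos
      · have h1 : volume (Ω ∩ Metric.closedBall x 1) = 0 := by
          by_contra h
          exact hx.2 h
        exact measure_mono_null (inter_subset_inter_left _ Set.sdiff_subset) h1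
    rw [ae_iff]
    convert h0 using 2
    ext x
    simp
  -- A maximal family of 6-separated points of X: the balls of radius 3 are disjoint and each
  -- carries volume at least τ, so there are at most N of them. By maximality the balls of radius 6
  -- cover X.
  set P : ℕ → Prop := fun n => ∃ T : Finset (Space d), T.card = n ∧ (∀ c ∈ T, c ∈ X) ∧
    (T : Set (Space d)).Pairwise fun c c' => 6 < dist c c'
  have hP0 : P 0 := ⟨∅, by simp, by simp, by simp⟩
  have hPN : ∀ n, P n → n ≤ N := by
    rintro n ⟨T, rfl, hTX, hTd⟩
    have h1 : volume (⋃ c ∈ T, Ω ∩ Metric.closedBall c 3) =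
        ∑ c ∈ T, volume (Ω ∩ Metric.closedBall c 3) := by
      refine measure_biUnion_finset₀ ?_ fun c _ =>
        hΩ.inter Metric.isClosed_closedBall.measurableSet.nullMeasurableSet
      intro c hc c' hc' hne
      refine Disjoint.aedisjoint ?_
      exact (Metric.closedBall_disjoint_closedBall
        (by have := hTd hc hc' hne; linarith)).mono inter_subset_right inter_subset_right
    have h2 : volume (⋃ c ∈ T, Ω ∩ Metric.closedBall c 3) ≤ volume Ω :=
      measure_mono (iUnion₂_subset fun _ _ => inter_subset_left)
    have h3 : T.card • ENNReal.ofReal τ ≤ ∑ c ∈ T, volume (Ω ∩ Metric.closedBall c 3) :=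
      Finset.card_nsmul_le_sum _ _ _ fun c hc => hX c (hTX c hc)
    have h4 := (h3.trans (h1.ge.trans h2)).trans hN
    rw [nsmul_eq_mul, ← ENNReal.ofReal_natCast, ← ENNReal.ofReal_mul (by positivity),
      ENNReal.ofReal_le_ofReal_iff (by positivity)] at h4
    exact_mod_cast le_of_mul_le_mul_right h4 hτ
  obtain ⟨T, hT, hTX, hTd⟩ := Nat.findGreatest_spec (P := P) (Nat.zero_le N) hP0
  refine ⟨T, hT ▸ Nat.findGreatest_le N, ?_⟩
  filter_upwards [hae] with x hx hxΩ
  by_contra! h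
  have hxT : x ∉ T := fun hxT => by
    have := h x hxT
    rw [sub_self, norm_zero] at this
    linarith
  have hP1 : P (Nat.findGreatest P N + 1) := by
    refine ⟨insert x T, by rw [Finset.card_insert_of_notMem hxT, hT], ?_, ?_⟩
    · intro c hc
      rcases Finset.mem_insert.1 hc with rfl | hc
      · exact hx hxΩ
      · exact hTX c hc
    · rw [Finset.coe_insert]
      refine hTd.insert fun c hc _ => ?_
      rw [dist_comm c x, dist_eq_norm]
      exact ⟨h c hc, h c hc⟩
  have := Nat.le_findGreatest (hPN _ hP1) hP1
  omega

lemma abs_apply_le_norm (x : Space d) (j : Fin d) : |x j| ≤ ‖x‖ := by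
  rw [← Real.norm_eq_abs]
  exact PiLp.norm_apply_le x j

lemma norm_le_of_abs_apply_le {x : Space d} {B : ℝ} (hB : 0 ≤ B) (h : ∀ j, |x j| ≤ B) :
    ‖x‖ ≤ d * B := by
  have h1 : ‖x‖ ^ 2 ≤ d * B ^ 2 := by
    rw [EuclideanSpace.norm_sq_eq]
    refine (Finset.sum_le_card_nsmul _ _ (B ^ 2) fun j _ => ?_).trans (by simp)
    rw [Real.norm_eq_abs]
    have := h j
    gcongr
  refine le_of_sq_le_sq ?_ (by positivity)
  refine h1.trans ?_
  rw [mul_pow]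
  gcongr
  exact_mod_cast Nat.le_self_pow two_ne_zero d

/-- A set with `λ_k ≤ l`, `P ≤ p`, covered by balls of radius `6` with the given centres. -/
structure IsCovered (k : ℕ) (l p : ℝ) {ι : Type*} (c : ι → Space d) (Ω : Set (Space d)) : Prop where
  nullMeasurableSet : NullMeasurableSet Ω
  hasTestSpace : HasTestSpace (gradientPairs Ω) k l
  perimeter_le : perimeter Ω ≤ ENNReal.ofReal p
  exists_norm_le : ∀ x ∈ Ω, ∃ i, ‖x - c i‖ ≤ 6

/-- Finitely many points that are widely spread leave a gap. -/
lemma exists_gap {ι : Type*} [Fintype ι] {N : ℕ} (hN : Fintype.card ι ≤ N) (b : ι → ℝ) {i₀ : ι} :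
    ∃ m < N, ∀ i, b i ≤ b i₀ + 17 * m ∨ b i₀ + 17 * m + 17 < b i := by
  by_contra! h
  -- Otherwise each of the N consecutive windows of length 17 above b i₀ contains some b i. These
  -- indices are distinct and differ from i₀, giving N + 1 indices. The length 17 = 6 + 5 + 6 leaves
  -- a slab of width 5 between balls of radius 6.
  choose f hf using fun m : Fin N => h m m.2
  have hinj : Function.Injective f := by
    intro m m' hm
    have h1 := hf m
    have h2 := hf m'
    rw [hm] at h1
    have h3 : ((m : ℕ) : ℝ) < (m' : ℕ) + 1 := by linarith
    have h4 : ((m' : ℕ) : ℝ) < (m : ℕ) + 1 := by linarith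
    norm_cast at h3 h4
    exact Fin.ext (by omega)
  have hnot : i₀ ∉ Set.range f := by
    rintro ⟨m, hm⟩
    have h1 := (hf m).1
    rw [hm] at h1
    have : (0 : ℝ) ≤ 17 * (m : ℕ) := by positivity
    linarith
  have := Fintype.card_lt_of_injective_of_notMem f hinj hnot
  rw [Fintype.card_fin] at this
  omega

/-- A spread larger than 17N forces an empty slab with centres on both sides. Moving the far side by
one unit shortens the spread in this coordinate and leaves the others unchanged. -/
lemma IsCovered.exists_reduce {k : ℕ} {l p : ℝ} (hp : 0 ≤ p) (j : Fin d) {ι : Type*} [Fintype ι]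
    {N : ℕ} (hN : Fintype.card ι ≤ N) {c : ι → Space d} {Ω : Set (Space d)}
    (h : IsCovered k l p c Ω) {S : ℝ} (hS : 17 * N ≤ S)
    (hspread : ∀ i i', c i j - c i' j ≤ S + 1) :
    ∃ (c' : ι → Space d) (Ω' : Set (Space d)), IsCovered k l p c' Ω' ∧
      (∀ i i', c' i j - c' i' j ≤ S) ∧ ∀ i j', j' ≠ j → c' i j' = c i j' := by
  by_cases hbig : ∃ i i', 17 * (N : ℝ) < c i j - c i' j
  swap
  · push Not at hbig
    exact ⟨c, Ω, h, fun i i' => (hbig i i').trans hS, fun _ _ _ => rfl⟩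
  obtain ⟨ia, ib, hab⟩ := hbig
  have : Nonempty ι := ⟨ia⟩
  obtain ⟨i₀, hi₀⟩ := Finite.exists_min fun i => c i j
  obtain ⟨i₁, hi₁⟩ := Finite.exists_max fun i => c i j
  obtain ⟨m, hmN, hgap⟩ := exists_gap hN (fun i => c i j) (i₀ := i₀)
  set θ : ℝ := c i₀ j + 17 * m
  have hθ0 : c i₀ j ≤ θ := by simp only [θ, le_add_iff_nonneg_right]; positivity
  have hθ1 : θ + 17 < c i₁ j := by
    have h1 : ((m : ℕ) : ℝ) + 1 ≤ N := by exact_mod_cast hmN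
    have h2 := hi₀ ib
    have h3 := hi₁ ia
    simp only [θ]
    linarith
  set e : Space d := EuclideanSpace.single j 1
  have hej : e j = 1 := by simp [e]
  have hej' : ∀ j', j' ≠ j → e j' = 0 := fun j' hj' => by simp [e, hj']
  set c' : ι → Space d := fun i => if θ < c i j then c i - e else c i
  have hc'R : ∀ i, θ < c i j → c' i = c i - e := fun i hi => if_pos hi
  have hc'L : ∀ i, ¬ θ < c i j → c' i = c i := fun i hi => if_neg hi
  have hxL : ∀ x i, ‖x - c i‖ ≤ 6 → ¬ θ < c i j → x j ≤ θ + 6 := by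
    intro x i hx hi
    have h1 := (abs_le.1 ((abs_apply_le_norm _ j).trans hx)).2
    rw [PiLp.sub_apply] at h1
    linarith
  have hxR : ∀ x i, ‖x - c i‖ ≤ 6 → θ < c i j → θ + 6 + 5 ≤ x j := by
    intro x i hx hi
    have h1 := (abs_le.1 ((abs_apply_le_norm _ j).trans hx)).1
    rw [PiLp.sub_apply] at h1
    rcases hgap i with h2 | h2
    · exact absurd hi (not_lt.2 h2)
    · linarith
  have hΩgap : ∀ x ∈ Ω, x j ≤ θ + 6 ∨ θ + 6 + 5 ≤ x j := by
    intro x hx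
    obtain ⟨i, hi⟩ := h.exists_norm_le x hx
    by_cases hci : θ < c i j
    · exact Or.inr (hxR x i hi hci)
    · exact Or.inl (hxL x i hi hci)
  refine ⟨c', closeGap j (θ + 6) Ω, ⟨nullMeasurableSet_closeGap j _ h.nullMeasurableSet,
    hasTestSpace_closeGap j _ hΩgap h.hasTestSpace,
    perimeter_closeGap_le j _ h.nullMeasurableSet hΩgap hp h.perimeter_le, ?_⟩, ?_, ?_⟩
  · rintro x (⟨hx, hxa⟩ | ⟨hx, hxa⟩)
    · obtain ⟨i, hi⟩ := h.exists_norm_le x hx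
      refine ⟨i, ?_⟩
      rw [hc'L i fun hci => ?_]
      · exact hi
      · have := hxR x i hi hci
        change x j ≤ θ + 6 at hxa
        linarith
    · obtain ⟨i, hi⟩ := h.exists_norm_le _ hx
      refine ⟨i, ?_⟩
      by_cases hci : θ < c i j
      · rw [hc'R i hci]
        convert hi using 2
        simp only [similarity, one_smul]
        abel
      · have := hxL _ i hi hci
        change θ + 6 + 5 ≤ _ at hxa
        linarith
  · intro i i'
    have h1 := hspread i i'
    have h2 := hi₀ i'
    have h3 := hi₁ i
    have h4 := hspread i₁ i₀
    by_cases hi : θ < c i j <;> by_cases hi' : θ < c i' j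
    · rw [hc'R i hi, hc'R i' hi', PiLp.sub_apply, PiLp.sub_apply, hej]
      rcases hgap i' with h5 | h5 <;> linarith
    · rw [hc'R i hi, hc'L i' hi', PiLp.sub_apply, hej]
      linarith
    · rw [hc'L i hi, hc'R i' hi', PiLp.sub_apply, hej]
      have : (0 : ℝ) ≤ 17 * N := by positivity
      rcases hgap i' with h5 | h5 <;> linarith
    · rw [hc'L i hi, hc'L i' hi']
      linarith
  · intro i j' hj'
    by_cases hi : θ < c i j
    · rw [hc'R i hi, PiLp.sub_apply, hej' j' hj', sub_zero]
    · rw [hc'L i hi]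

lemma IsCovered.exists_reduce_coordinate {k : ℕ} {l p : ℝ} (hp : 0 ≤ p) (j : Fin d) {ι : Type*}
    [Fintype ι] {N : ℕ} (hN : Fintype.card ι ≤ N) {c : ι → Space d} {Ω : Set (Space d)}
    (h : IsCovered k l p c Ω) :
    ∃ (c' : ι → Space d) (Ω' : Set (Space d)), IsCovered k l p c' Ω' ∧
      (∀ i i', c' i j - c' i' j ≤ 17 * N) ∧ ∀ i j', j' ≠ j → c' i j' = c i j' := by
  suffices ∀ (n : ℕ) (c : ι → Space d) (Ω : Set (Space d)), IsCovered k l p c Ω →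
      (∀ i i', c i j - c i' j ≤ 17 * N + n) →
      ∃ (c' : ι → Space d) (Ω' : Set (Space d)), IsCovered k l p c' Ω' ∧
      (∀ i i', c' i j - c' i' j ≤ 17 * N) ∧ ∀ i j', j' ≠ j → c' i j' = c i j' by
    obtain ⟨M, hM⟩ := (Set.finite_range fun q : ι × ι => c q.1 j - c q.2 j).bddAbove
    refine this ⌈M⌉₊ c Ω h fun i i' => ?_
    have h1 : c i j - c i' j ≤ M := hM ⟨(i, i'), rfl⟩
    have h2 := Nat.le_ceil M
    have : (0 : ℝ) ≤ 17 * N := by positivity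
    linarith
  intro n
  induction n with
  | zero =>
    intro c Ω h hs
    exact ⟨c, Ω, h, by simpa using hs, fun _ _ _ => rfl⟩
  | succ n ih =>
    intro c Ω h hs
    obtain ⟨c₁, Ω₁, h1, h2, h3⟩ := h.exists_reduce hp j hN (S := 17 * N + n) (by simp)
      (fun i i' => by have := hs i i'; push_cast at this; linarith)
    obtain ⟨c₂, Ω₂, h4, h5, h6⟩ := ih c₁ Ω₁ h1 h2
    exact ⟨c₂, Ω₂, h4, h5, fun i j' hj' => (h6 i j' hj').trans (h3 i j' hj')⟩

/-- The coordinates are treated in turn, as each reduction keeps the other ones. A translation then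
moves one centre to the origin. The resulting radius depends only on d and N. -/
lemma IsCovered.exists_subset_closedBall {k : ℕ} {l p : ℝ} (hd : 1 ≤ d) (hp : 0 ≤ p) {ι : Type*}
    [Fintype ι] {N : ℕ} (hN : Fintype.card ι ≤ N) {c : ι → Space d} {Ω : Set (Space d)}
    (h : IsCovered k l p c Ω) :
    ∃ Ω' ⊆ Metric.closedBall (0 : Space d) (d * (17 * N) + 6), NullMeasurableSet Ω' ∧
      HasTestSpace (gradientPairs Ω') k l ∧ perimeter Ω' ≤ ENNReal.ofReal p := by
  obtain ⟨c', Ω', h', hs⟩ : ∃ (c' : ι → Space d) (Ω' : Set (Space d)), IsCovered k l p c' Ω' ∧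
      ∀ j ∈ (Finset.univ : Finset (Fin d)), ∀ i i', c' i j - c' i' j ≤ 17 * N := by
    induction (Finset.univ : Finset (Fin d)) using Finset.induction_on with
    | empty => exact ⟨c, Ω, h, by simp⟩
    | insert a s ha ih =>
      obtain ⟨c₁, Ω₁, h1, h2⟩ := ih
      obtain ⟨c₂, Ω₂, h3, h4, h5⟩ := h1.exists_reduce_coordinate hp a hN
      refine ⟨c₂, Ω₂, h3, fun j hj i i' => ?_⟩
      by_cases hja : j = a
      · rw [hja]; exact h4 i i'
      · rw [h5 i j hja, h5 i' j hja]
        exact h2 j ((Finset.mem_insert.1 hj).resolve_left hja) i i'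
  rcases isEmpty_or_nonempty ι with hι | ⟨⟨i₀⟩⟩
  · refine ⟨Ω', fun x hx => ?_, h'.nullMeasurableSet, h'.hasTestSpace, h'.perimeter_le⟩
    obtain ⟨i, -⟩ := h'.exists_norm_le x hx
    exact hι.elim i
  · refine ⟨similarity 1 (c' i₀) ⁻¹' Ω', fun x hx => ?_, h'.nullMeasurableSet.preimage
      (quasiMeasurePreserving_similarity one_pos _), ?_, ?_⟩
    · obtain ⟨i, hi⟩ := h'.exists_norm_le _ hx
      rw [mem_closedBall_zero_iff]
      have h1 : ‖c' i - c' i₀‖ ≤ d * (17 * N) := by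
        refine norm_le_of_abs_apply_le (by positivity) fun j => abs_le.2 ⟨?_, ?_⟩
        · rw [PiLp.sub_apply]
          linarith [hs j (Finset.mem_univ j) i₀ i]
        · rw [PiLp.sub_apply]
          exact hs j (Finset.mem_univ j) i i₀
      have h2 : x = (similarity 1 (c' i₀) x - c' i) + (c' i - c' i₀) := by
        simp [similarity]
      rw [h2]
      exact (norm_add_le _ _).trans (by linarith)
    · have := h'.hasTestSpace.similarity one_pos (c' i₀)
      rwa [one_pow, one_mul] at this
    · have := perimeter_similarity_le hd one_pos (c' i₀) h'.nullMeasurableSet hp h'.perimeter_le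
      rwa [one_pow, inv_one, one_mul] at this

/-! ### Existence for the penalised problem -/

lemma HasTestSpace.pos (hd : d ≠ 0) {k : ℕ} (hk : 1 ≤ k) {Ω : Set (Space d)}
    (hΩ : volume Ω < ⊤) {l : ℝ} (h : HasTestSpace (gradientPairs Ω) k l) : 0 < l := by
  obtain ⟨p, μ, hp⟩ := h.exists_isEigenSystem (compactPairs_gradientPairs_self hΩ)
  exact (hp.pos hd hΩ ⟨0, hk⟩).trans_le (hp.le _)

/-- Existence of minimisers of `λ_k + P` among the subsets of a set of finite measure. -/
lemma exists_min_subset (hd : d ≠ 0) {k : ℕ} (hk : 1 ≤ k) {A : Set (Space d)} (hA : volume A < ⊤)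
    (hne : ∃ Ω ⊆ A, ∃ l p : ℝ, NullMeasurableSet Ω ∧ 0 ≤ p ∧ HasTestSpace (gradientPairs Ω) k l ∧
      perimeter Ω ≤ ENNReal.ofReal p) :
    ∃ Ω ⊆ A, ∃ l p : ℝ, NullMeasurableSet Ω ∧ 0 ≤ p ∧ HasTestSpace (gradientPairs Ω) k l ∧
      perimeter Ω ≤ ENNReal.ofReal p ∧ ∀ Ω' ⊆ A, NullMeasurableSet Ω' → ∀ l' p' : ℝ, 0 ≤ p' →
      HasTestSpace (gradientPairs Ω') k l' → perimeter Ω' ≤ ENNReal.ofReal p' →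
        l + p ≤ l' + p' := by
  set V : Set ℝ := {t | ∃ Ω ⊆ A, ∃ l p : ℝ, NullMeasurableSet Ω ∧ 0 ≤ p ∧
    HasTestSpace (gradientPairs Ω) k l ∧ perimeter Ω ≤ ENNReal.ofReal p ∧ t = l + p}
  have hVne : V.Nonempty := by
    obtain ⟨Ω, hΩ, l, p, h1, h2, h3, h4⟩ := hne
    exact ⟨l + p, Ω, hΩ, l, p, h1, h2, h3, h4, rfl⟩
  have hl0 : ∀ {Ω : Set (Space d)} {l : ℝ}, Ω ⊆ A → HasTestSpace (gradientPairs Ω) k l → 0 < l :=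
    fun hΩ h => h.pos hd hk ((measure_mono hΩ).trans_lt hA)
  have hVb : BddBelow V := by
    refine ⟨0, ?_⟩
    rintro t ⟨Ω, hΩ, l, p, h1, h2, h3, h4, rfl⟩
    have := hl0 hΩ h3
    positivity
  obtain ⟨t, -, ht, htV⟩ := exists_seq_tendsto_sInf hVne hVb
  choose Ω hΩ l p h1 h2 h3 h4 h5 using htV
  obtain ⟨M, hM⟩ := ht.bddAbove_range
  have hlp : ∀ n, (l n, p n) ∈ Icc (0 : ℝ) M ×ˢ Icc (0 : ℝ) M := by
    intro n
    have h6 : t n ≤ M := hM ⟨n, rfl⟩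
    have h7 := hl0 (hΩ n) (h3 n)
    have h8 := h2 n
    have h9 := h5 n
    exact ⟨⟨h7.le, by linarith⟩, ⟨h8, by linarith⟩⟩
  -- The two bounds converge separately along a subsequence, and each is lower semicontinuous along
  -- the convergence of the sets.
  obtain ⟨⟨l', p'⟩, -, φ, hφ, hlim⟩ := (isCompact_Icc.prod isCompact_Icc).tendsto_subseq hlp
  have hll : Tendsto (fun n => l (φ n)) atTop (𝓝 l') := (Prod.tendsto_iff _ _).1 hlim |>.1
  have hpp : Tendsto (fun n => p (φ n)) atTop (𝓝 p') := (Prod.tendsto_iff _ _).1 hlim |>.2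
  have hM0 : 0 ≤ M := (hlp 0).1.1.trans (hlp 0).1.2
  obtain ⟨E, ψ, hψ, hE, hEA, hae⟩ := exists_limit_set hA (fun n => h1 (φ n)) (fun n => hΩ (φ n)) hM0
    (fun n => (h4 (φ n)).trans (ENNReal.ofReal_le_ofReal (hlp (φ n)).2.2))
  have hEfin : ∀ n, volume (Ω n) < ⊤ := fun n => (measure_mono (hΩ n)).trans_lt hA
  have hc : CompactPairs (fun n => gradientPairs (Ω (φ (ψ n)))) (gradientPairs E) := by
    refine compactPairs_gradientPairs hA (fun n => Eventually.of_forall (hΩ _)) ?_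
    filter_upwards [hae] with x hx hxE
    rcases hx with h | h
    · exact absurd h.1 hxE
    · exact h.2
  choose P μ hP using fun n => (h3 (φ (ψ n))).exists_isEigenSystem
    (compactPairs_gradientPairs_self (hEfin _))
  have hT := hasTestSpace_of_limit hc (hll.comp hψ.tendsto_atTop) hP
  have hper := perimeter_le_of_tendsto (fun n => h1 (φ (ψ n))) hE hae (fun n => h2 _)
    (hpp.comp hψ.tendsto_atTop) (fun n => h4 _)
  refine ⟨E, hEA, l', p', hE, ge_of_tendsto' hpp fun n => h2 _, hT, hper, ?_⟩
  intro Ω' hΩ' hm l₁ p₁ hp₁ hT₁ hP₁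
  have h6 : sInf V ≤ l₁ + p₁ := csInf_le hVb ⟨Ω', hΩ', l₁, p₁, hm, hp₁, hT₁, hP₁, rfl⟩
  refine le_trans (le_of_eq ?_) h6
  have h7 : Tendsto (fun n => t (φ n)) atTop (𝓝 (sInf V)) := ht.comp hφ.tendsto_atTop
  refine tendsto_nhds_unique (hll.add hpp) (h7.congr fun n => h5 _)

/-- The isoperimetric inequality bounds the volume by the perimeter. -/
lemma exists_volume_le (hd : 2 ≤ d) (p₀ : ℝ) : ∃ V ≥ (0 : ℝ), ∀ (E : Set (Space d)) (p : ℝ),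
    NullMeasurableSet E → volume E < ⊤ → 0 ≤ p → p ≤ p₀ → perimeter E ≤ ENNReal.ofReal p →
      volume E ≤ ENNReal.ofReal V := by
  have hd0 : d ≠ 0 := by omega
  obtain ⟨C, hC, h⟩ := exists_isoperimetric hd0
  refine ⟨max 1 (C * p₀) ^ d, by positivity, fun E p hE hfin hp hpp hP => ?_⟩
  have h1 := h E p hE hfin hp hP
  rw [← ENNReal.ofReal_toReal hfin.ne]
  refine ENNReal.ofReal_le_ofReal ?_
  change volume.real E ≤ _
  have hm0 : 0 ≤ volume.real E := measureReal_nonneg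
  have hvd := rpow_one_div_pow hd0 hm0
  set v := volume.real E ^ (1 / (d : ℝ))
  have hv0 : 0 ≤ v := by positivity
  rw [← hvd] at h1 ⊢
  gcongr
  -- With v the 1/d-th power of the volume, the isoperimetric inequality reads v^(d-1) ≤ C p. For v
  -- > 1 and d ≥ 2 this gives v ≤ C p.
  by_contra! hv
  have hv1 : 1 < v := (le_max_left _ _).trans_lt hv
  have h2 : v ^ d = v ^ (d - 1) * v := by rw [← pow_succ]; congr 1; omega
  have h3 : v ^ (d - 1) ≤ C * p := by
    rw [h2] at h1
    exact le_of_mul_le_mul_right (by linarith) (by linarith : 0 < v)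
  have h4 : v ≤ v ^ (d - 1) := le_self_pow₀ hv1.le (by omega)
  have h5 : C * p ≤ C * p₀ := by gcongr
  have h6 := (le_max_right 1 (C * p₀)).trans_lt hv
  linarith

lemma iInter_compl_closedBall : ⋂ n : ℕ, (Metric.closedBall (0 : Space d) n)ᶜ = ∅ := by
  rw [← compl_iUnion, Metric.iUnion_closedBall_nat, compl_univ]

lemma antitone_compl_closedBall :
    Antitone fun n : ℕ => (Metric.closedBall (0 : Space d) n)ᶜ := fun n m h =>
  compl_subset_compl.2 (Metric.closedBall_subset_closedBall (by exact_mod_cast h))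

/-- Every set of finite measure can be truncated at a small cost. -/
lemma exists_truncation {Ω : Set (Space d)} (hΩ : NullMeasurableSet Ω)
    (hfin : volume Ω < ⊤) {k : ℕ} {l p : ℝ} (hl : 0 ≤ l) (hp : 0 ≤ p)
    (hT : HasTestSpace (gradientPairs Ω) k l) (hP : perimeter Ω ≤ ENNReal.ofReal p) {ε : ℝ}
    (hε : 0 < ε) :
    ∃ (R : ℝ) (Ω' : Set (Space d)), Ω' ⊆ Metric.closedBall 0 R ∧ NullMeasurableSet Ω' ∧
      HasTestSpace (gradientPairs Ω') k (l + ε) ∧ perimeter Ω' ≤ ENNReal.ofReal (p + ε) := by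
  obtain ⟨C₁, hC₁, hramp⟩ := exists_ball_ramp d
  obtain ⟨C₂, hC₂, hcut⟩ := exists_cut d
  obtain ⟨P, μ, hP'⟩ := hT.exists_isEigenSystem (compactPairs_gradientPairs_self hfin)
  have hmeas : ∀ r, MeasurableSet (Metric.closedBall (0 : Space d) r) := fun r =>
    Metric.isClosed_closedBall.measurableSet
  set S : ℕ → Set (Space d) := fun n => (Metric.closedBall 0 n)ᶜ
  have h1 : Tendsto (fun n => ∫ x in S n, squareSum P x) atTop (𝓝 0) := by
    have := tendsto_setIntegral_of_antitone (μ := volume) (f := squareSum P)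
      (s := S) (fun n => (hmeas n).compl) (antitone_compl_closedBall (d := d))
      ⟨0, (integrable_squareSum P).integrableOn⟩
    rwa [show ⋂ n, S n = ∅ from iInter_compl_closedBall, setIntegral_empty] at this
  have h2 : Tendsto (fun n => volume.real (Ω ∩ S n)) atTop (𝓝 0) := by
    have := tendsto_measure_iInter_atTop (μ := volume) (s := fun n => Ω ∩ S n)
      (fun n => hΩ.inter (hmeas n).compl.nullMeasurableSet)
      (fun n m h => inter_subset_inter_right _ (antitone_compl_closedBall h))
      ⟨0, ((measure_mono inter_subset_left).trans_lt hfin).ne⟩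
    rw [← inter_iInter, iInter_compl_closedBall, inter_empty, measure_empty] at this
    exact (ENNReal.tendsto_toReal ENNReal.zero_ne_top).comp this
  have h3 : Tendsto (fun n => 2 * (l + (C₁ / 1) ^ 2) * ∫ x in S n, squareSum P x) atTop (𝓝 0) := by
    simpa using h1.const_mul (2 * (l + (C₁ / 1) ^ 2))
  have h4 : Tendsto (fun n => C₂ / 1 * volume.real (Ω ∩ S n)) atTop (𝓝 0) := by
    simpa using h2.const_mul (C₂ / 1)
  obtain ⟨n, hn1, hn2, hn3⟩ := ((h1.eventually_le_const (u := 1 / 2) (by norm_num)).and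
    ((h3.eventually_le_const hε).and (h4.eventually_le_const (half_pos hε)))).exists
  -- The set is cut outside the radius n + 1, where the cutoff for the eigenfunctions, falling
  -- between n and n + 1, already vanishes. Both costs are tails of integrable quantities.
  obtain ⟨t, ht, p₁, p₂, hp₁, hp₂, hP₁, hP₂, hpp⟩ := hcut Ω p hΩ hp hP 0 (n + 1) 1 (ε / 2)
    (by positivity) one_pos (half_pos hε)
  obtain ⟨r, hr, hr01, hr0, hr1, hrK, hrz⟩ := hramp 0 n 1 (by positivity) one_pos
  simp only [sub_zero] at hr0 hr1 hrz
  have hfd : ∀ x, fderiv ℝ (fun x => 1 - r x) x = - fderiv ℝ r x := fun x => by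
    rw [fderiv_const_sub]
  have hmS : ∀ x, x ∉ S n → ‖x‖ ≤ n := fun x hx => by simpa [S] using hx
  have hT' := hP'.hasTestSpace_mul hl (η := fun x => 1 - r x) (contDiff_const.sub hr)
    (fun x => ⟨by linarith [(hr01 x).2], by linarith [(hr01 x).1]⟩)
    (fun x => by rw [hfd, norm_neg]; exact hrK x) (hmeas n).compl
    (fun x hx => by rw [hr0 x (hmS x hx), sub_zero])
    (fun x hx => by
      rw [hfd, hrz x (fun h => absurd h.1 (not_lt.2 (hmS x hx))), neg_zero]) hn1
  refine ⟨t, Ω ∩ Metric.closedBall 0 t, inter_subset_right,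
    hΩ.inter (hmeas t).nullMeasurableSet, hT'.mono (gradientPairs_mono ?_) (by linarith),
    hP₁.trans (ENNReal.ofReal_le_ofReal ?_)⟩
  · refine Eventually.of_forall fun x hx => ⟨hx.1, ?_⟩
    rw [mem_closedBall_zero_iff]
    by_contra! h
    exact hx.2 (by rw [hr1 x (by linarith [ht.1]), sub_self])
  · have h5 : volume.real (Ω ∩ (Metric.closedBall 0 ((n : ℝ) + 1 + 1) \
        Metric.closedBall 0 ((n : ℝ) + 1))) ≤ volume.real (Ω ∩ S n) := by
      refine measureReal_mono (inter_subset_inter_right _ fun x hx => ?_)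
        ((measure_mono inter_subset_left).trans_lt hfin).ne
      intro h
      exact hx.2 (Metric.closedBall_subset_closedBall (by linarith) h)
    have h6 : C₂ / 1 * volume.real (Ω ∩ (Metric.closedBall 0 ((n : ℝ) + 1 + 1) \
        Metric.closedBall 0 ((n : ℝ) + 1))) ≤ C₂ / 1 * volume.real (Ω ∩ S n) := by gcongr
    linarith

/-- Divergences of compactly supported fields have integral zero. Cutting the whole space along a
sphere then gives a ball of finite perimeter without computing its perimeter. -/
lemma perimeter_univ_le : perimeter (Set.univ : Set (Space d)) ≤ ENNReal.ofReal 0 := by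
  rw [perimeter_le_iff le_rfl]
  intro φ hφ
  refine le_of_eq ?_
  rw [setIntegral_univ]
  set π : Fin d → Space d →L[ℝ] ℝ := fun i => EuclideanSpace.proj i
  have hc : ∀ i : Fin d, ContDiff ℝ 1 fun x => φ x i := fun i => (π i).contDiff.comp hφ.1
  have hs : ∀ i : Fin d, HasCompactSupport fun x => φ x i := fun i =>
    hφ.2.1.comp_left (g := fun y : Space d => y i) rfl
  have hfd : ∀ (i : Fin d) (x v : Space d), fderiv ℝ φ x v i = fderiv ℝ (fun x => φ x i) x v := by
    intro i x v
    have h1 := ((π i).hasFDerivAt.comp x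
      (hφ.1.differentiable one_ne_zero x).hasFDerivAt).fderiv
    have h2 : fderiv ℝ (fun x => φ x i) x = _ := h1
    rw [h2]
    rfl
  have hint : ∀ i : Fin d, Integrable fun x =>
      fderiv ℝ (fun x => φ x i) x (EuclideanSpace.single i 1) := fun i =>
    (((hc i).continuous_fderiv one_ne_zero).clm_apply
      continuous_const).integrable_of_hasCompactSupport ((hs i).fderiv_apply (𝕜 := ℝ) _)
  simp only [divergence, hfd]
  rw [integral_finsetSum _ fun i _ => hint i]
  refine Finset.sum_eq_zero fun i _ => ?_
  have := integral_mul_fderiv_eq_neg_fderiv_mul_of_integrable (μ := (volume : Measure (Space d)))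
    (f := fun _ => (1 : ℝ)) (g := fun x => φ x i) (v := EuclideanSpace.single i 1)
    (by simp) (by simpa using hint i)
    (by simpa using (hc i).continuous.integrable_of_hasCompactSupport (hs i))
    (fun x _ => differentiableAt_const _) (fun x _ => (hc i).differentiable one_ne_zero x)
  simpa using this

lemma exists_gradientPairs_of_testFunction {φ : Space d → ℝ} (hφ : ContDiff ℝ ∞ φ)
    (hc : HasCompactSupport φ) {A : Set (Space d)} (hA : ∀ x, x ∉ A → φ x = 0) :
    ∃ p ∈ gradientPairs A, p.1 =ᵐ[volume] φ := by
  have h1 := memLp_testFunction hφ hc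
  have hgs : HasCompactSupport (gradient φ) :=
    (hc.fderiv (𝕜 := ℝ)).comp_left (g := (InnerProductSpace.toDual ℝ (Space d)).symm) (map_zero _)
  have h2 : MemLp (gradient φ) 2 (volume : Measure (Space d)) :=
    (continuous_gradient hφ).memLp_of_hasCompactSupport hgs
  refine ⟨(h1.toLp φ, h2.toLp _), ⟨hasWeakGradient_toLp h1 h2 ?_, ?_⟩, h1.coeFn_toLp⟩
  · intro ψ hψ hψc v
    simp only [inner_gradient_eq]
    have e1 : Continuous fun x => fderiv ℝ φ x v :=
      (hφ.continuous_fderiv (by simp)).clm_apply continuous_const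
    have e2 : Continuous fun x => fderiv ℝ ψ x v :=
      (hψ.continuous_fderiv (by simp)).clm_apply continuous_const
    exact integral_mul_fderiv_eq_neg_fderiv_mul_of_integrable
      ((e1.mul hψ.continuous).integrable_of_hasCompactSupport hψc.mul_left)
      ((hφ.continuous.mul e2).integrable_of_hasCompactSupport hc.mul_right)
      ((hφ.continuous.mul hψ.continuous).integrable_of_hasCompactSupport hc.mul_right)
      (fun x _ => hφ.differentiable (by simp) x) (fun x _ => hψ.differentiable (by simp) x)
  · filter_upwards [h1.coeFn_toLp] with x hx hxA
    rw [hx, hA x hxA]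

/-- Linearly independent families span test spaces. -/
lemma exists_hasTestSpace_of_linearIndependent {H K : Type*} [NormedAddCommGroup H]
    [InnerProductSpace ℝ H] [NormedAddCommGroup K] [InnerProductSpace ℝ K]
    {𝒢 : Submodule ℝ (H × K)} {k : ℕ} {p : Fin k → H × K} (hp : ∀ i, p i ∈ 𝒢)
    (hi : LinearIndependent ℝ fun i => (p i).1) : ∃ l, HasTestSpace 𝒢 k l := by
  set T : (Fin k → ℝ) →ₗ[ℝ] H := Fintype.linearCombination ℝ fun i => (p i).1
  have hker : LinearMap.ker T = ⊥ := by
    have := hi.fintypeLinearCombination_injective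
    exact LinearMap.ker_eq_bot.2 this
  obtain ⟨c, -, hc⟩ := T.exists_antilipschitzWith hker
  set M : (Fin k → ℝ) →L[ℝ] K :=
    LinearMap.toContinuousLinearMap (Fintype.linearCombination ℝ fun i => (p i).2)
  refine ⟨(‖M‖ * c) ^ 2, p, hp, hi, fun α => ?_⟩
  have h1 : ‖α‖ ≤ c * ‖T α‖ := by
    have := hc.le_mul_dist α 0
    simpa using this
  have h2 : ‖M α‖ ≤ ‖M‖ * ‖α‖ := M.le_opNorm α
  have e1 : T α = ∑ i, α i • (p i).1 := rfl
  have e2 : M α = ∑ i, α i • (p i).2 := rfl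
  rw [← e1, ← e2, ← mul_pow]
  refine pow_le_pow_left₀ (norm_nonneg _) (h2.trans ?_) 2
  rw [mul_assoc]
  gcongr

/-- Bumps of radius 1 centred at the points 3i on an axis have disjoint supports, hence are linearly
independent, and all lie in a ball of radius at least 3k + 1. -/
lemma exists_competitor (hd : d ≠ 0) (k : ℕ) :
    ∃ R : ℝ, ∃ Ω ⊆ Metric.closedBall (0 : Space d) R, ∃ l p : ℝ, NullMeasurableSet Ω ∧ 0 ≤ p ∧
      HasTestSpace (gradientPairs Ω) k l ∧ perimeter Ω ≤ ENNReal.ofReal p := by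
  obtain ⟨C₂, hC₂, hcut⟩ := exists_cut d
  obtain ⟨t, ht, p₁, p₂, hp₁, hp₂, hP₁, hP₂, hpp⟩ := hcut Set.univ 0 nullMeasurableSet_univ le_rfl
    perimeter_univ_le 0 (3 * k + 1) 1 1 (by positivity) one_pos one_pos
  rw [univ_inter] at hP₁
  set j : Fin d := ⟨0, Nat.pos_of_ne_zero hd⟩
  set x₀ : Fin k → Space d := fun i => (3 * (i : ℕ) : ℝ) • EuclideanSpace.single j 1
  set b : ∀ i, ContDiffBump (x₀ i) := fun i => ⟨1 / 2, 1, by norm_num, by norm_num⟩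
  have hx₀ : ∀ i, ‖x₀ i‖ ≤ 3 * k := by
    intro i
    rw [norm_smul, PiLp.norm_single, norm_one, mul_one, Real.norm_of_nonneg (by positivity)]
    have : ((i : ℕ) : ℝ) ≤ k := by exact_mod_cast i.2.le
    linarith
  have hdist : ∀ i i', i ≠ i' → 3 ≤ dist (x₀ i) (x₀ i') := by
    intro i i' hne
    rw [dist_eq_norm, ← sub_smul, norm_smul, PiLp.norm_single, norm_one, mul_one,
      ← mul_sub, norm_mul, Real.norm_of_nonneg (by norm_num : (0 : ℝ) ≤ 3), Real.norm_eq_abs]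
    have h1 : (1 : ℝ) ≤ |((i : ℕ) : ℝ) - ((i' : ℕ) : ℝ)| := by
      have h2 : ((i : ℕ) : ℤ) - ((i' : ℕ) : ℤ) ≠ 0 := by
        intro h
        exact hne (Fin.ext (by omega))
      exact_mod_cast Int.one_le_abs h2
    linarith
  have hzero : ∀ i x, 1 ≤ dist x (x₀ i) → b i x = 0 := fun i x hx => (b i).zero_of_le_dist hx
  choose P hP hPb using fun i => exists_gradientPairs_of_testFunction
    (A := Metric.closedBall (0 : Space d) t) (b i).contDiff (b i).hasCompactSupport (fun x hx => by
      refine hzero i x ?_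
      rw [mem_closedBall_zero_iff, not_le] at hx
      rw [dist_eq_norm]
      have := norm_sub_norm_le x (x₀ i)
      have := hx₀ i
      have := ht.1
      linarith)
  have hi : LinearIndependent ℝ fun i => (P i).1 := by
    refine linearIndependent_of_ne_zero_of_inner_eq_zero (fun i h0 => ?_) fun i i' hne => ?_
    · have h1 : ∀ᵐ x, b i x = 0 := by
        filter_upwards [hPb i, Lp.coeFn_zero ℝ 2 (volume : Measure (Space d))] with x h1 h2
        rw [← h1, h0, h2, Pi.zero_apply]
      have h2 := (Continuous.ae_eq_iff_eq volume (b i).continuous continuous_const).1 h1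
      have h3 : b i (x₀ i) = 1 :=
        (b i).one_of_mem_closedBall (Metric.mem_closedBall_self (b i).rIn_pos.le)
      rw [h2] at h3
      exact zero_ne_one h3
    · beta_reduce
      rw [inner_eq_integral_of_ae (hPb i) (hPb i')]
      refine (integral_congr_ae (Eventually.of_forall fun x => ?_)).trans (integral_zero _ _)
      rcases le_or_gt 1 (dist x (x₀ i)) with h | h
      · simp [hzero i x h]
      · have h1 := hdist i i' hne
        have h2 := dist_triangle_left (x₀ i) (x₀ i') x
        simp [hzero i' x (by linarith)]
  obtain ⟨l, hl⟩ := exists_hasTestSpace_of_linearIndependent hP hi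
  exact ⟨t, Metric.closedBall 0 t, Subset.rfl, l, p₁,
    Metric.isClosed_closedBall.measurableSet.nullMeasurableSet, hp₁, hl, hP₁⟩

/-- Existence of minimisers of `λ_k + P`. -/
lemma exists_global_min (hd : 2 ≤ d) {k : ℕ} (hk : 1 ≤ k) :
    ∃ (Ω : Set (Space d)) (l p : ℝ), NullMeasurableSet Ω ∧ volume Ω < ⊤ ∧ 0 ≤ p ∧
      HasTestSpace (gradientPairs Ω) k l ∧ perimeter Ω ≤ ENNReal.ofReal p ∧
      ∀ Ω' : Set (Space d), NullMeasurableSet Ω' → volume Ω' < ⊤ → ∀ l' p' : ℝ, 0 ≤ p' →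
        HasTestSpace (gradientPairs Ω') k l' → perimeter Ω' ≤ ENNReal.ofReal p' →
        l + p ≤ l' + p' := by
  have hd0 : d ≠ 0 := by omega
  obtain ⟨R₁, Ω₁, hΩ₁, l₁, p₁, hm₁, hp₁, hT₁, hP₁⟩ := exists_competitor hd0 k
  have hballfin : ∀ R, volume (Metric.closedBall (0 : Space d) R) < ⊤ := fun R =>
    Metric.isBounded_closedBall.measure_lt_top
  have hl₁ : 0 < l₁ := hT₁.pos hd0 hk ((measure_mono hΩ₁).trans_lt (hballfin _))
  set F : ℝ := l₁ + p₁
  have hF : 0 ≤ F := by positivity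
  obtain ⟨τ, hτ, hdens⟩ := exists_density hd one_pos hF k
  obtain ⟨V, hV0, hV⟩ := exists_volume_le hd F
  set N : ℕ := ⌈V / τ⌉₊
  have hN : V ≤ N * τ := by
    rw [← div_le_iff₀ hτ]
    exact Nat.le_ceil _
  set R₀ : ℝ := d * (17 * N) + 6
  have hmin : ∀ R, R₁ ≤ R → ∃ Ω ⊆ Metric.closedBall (0 : Space d) R, ∃ l p : ℝ,
      NullMeasurableSet Ω ∧ 0 ≤ p ∧ HasTestSpace (gradientPairs Ω) k l ∧
      perimeter Ω ≤ ENNReal.ofReal p ∧ ∀ Ω' ⊆ Metric.closedBall (0 : Space d) R,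
        NullMeasurableSet Ω' → ∀ l' p' : ℝ, 0 ≤ p' →
        HasTestSpace (gradientPairs Ω') k l' → perimeter Ω' ≤ ENNReal.ofReal p' →
        l + p ≤ l' + p' := fun R hR => exists_min_subset hd0 hk (hballfin R)
    ⟨Ω₁, hΩ₁.trans (Metric.closedBall_subset_closedBall hR), l₁, p₁, hm₁, hp₁, hT₁, hP₁⟩
  -- The minimiser in the ball of radius R is replaced by a rearranged copy in the fixed ball of
  -- radius R₀ with the same l and p. The density constant τ and the volume bound V, hence N and R₀,
  -- do not depend on R.
  have hunif : ∀ R, R₁ ≤ R → ∃ Ω' ⊆ Metric.closedBall (0 : Space d) R₀, ∃ l p : ℝ,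
      NullMeasurableSet Ω' ∧ 0 ≤ p ∧ HasTestSpace (gradientPairs Ω') k l ∧
      perimeter Ω' ≤ ENNReal.ofReal p ∧ ∀ Ω' ⊆ Metric.closedBall (0 : Space d) R,
        NullMeasurableSet Ω' → ∀ l' p' : ℝ, 0 ≤ p' →
        HasTestSpace (gradientPairs Ω') k l' → perimeter Ω' ≤ ENNReal.ofReal p' →
        l + p ≤ l' + p' := by
    intro R hR
    obtain ⟨Ω, hΩR, l, p, hm, hp, hT, hP, hle⟩ := hmin R hR
    have hfin : volume Ω < ⊤ := (measure_mono hΩR).trans_lt (hballfin R)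
    have hl : 0 < l := hT.pos hd0 hk hfin
    have hlpF : l + p ≤ F := hle Ω₁ (hΩ₁.trans (Metric.closedBall_subset_closedBall hR)) hm₁ l₁ p₁
      hp₁ hT₁ hP₁
    have hinner : IsInnerMin 1 k Ω l p := ⟨hm, hfin, hT, hl.le, hp, hP,
      fun Ω' hΩ' hm' l' p' hp' hT' hP' => by
        rw [one_mul, one_mul]
        exact hle Ω' (hΩ'.trans hΩR) hm' l' p' hp' hT' hP'⟩
    have hvol : volume Ω ≤ ENNReal.ofReal (N * τ) :=
      (hV Ω p hm hfin hp (by linarith) hP).trans (ENNReal.ofReal_le_ofReal hN)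
    obtain ⟨T, hTN, hTc⟩ := exists_finset_cover hm hτ hvol
      (hdens Ω l p hinner (by linarith))
    set U : Set (Space d) := ⋃ c ∈ T, Metric.closedBall c 6
    have hU : MeasurableSet U := Finset.measurableSet_biUnion _ fun c _ =>
      Metric.isClosed_closedBall.measurableSet
    have hmemU : ∀ x, x ∈ U ↔ ∃ c ∈ T, ‖x - c‖ ≤ 6 := fun x => by
      simp [U, dist_eq_norm]
    have hae : (Ω ∩ U : Set (Space d)) =ᵐ[volume] Ω := by
      refine Filter.eventuallyEq_set.2 ?_
      filter_upwards [hTc] with x hx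
      exact ⟨fun h => h.1, fun h => ⟨h, (hmemU x).2 (hx h)⟩⟩
    have hcov : IsCovered k l p (fun c : T => (c : Space d)) (Ω ∩ U) := by
      refine ⟨hm.inter hU.nullMeasurableSet, hT.mono (gradientPairs_mono ?_) le_rfl, ?_, ?_⟩
      · filter_upwards [hTc] with x hx hxΩ
        exact ⟨hxΩ, (hmemU x).2 (hx hxΩ)⟩
      · rw [perimeter_congr hae]; exact hP
      · rintro x ⟨-, hx⟩
        obtain ⟨c, hc, hxc⟩ := (hmemU x).1 hx
        exact ⟨⟨c, hc⟩, hxc⟩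
    obtain ⟨Ω', hΩ', hm', hT', hP'⟩ := hcov.exists_subset_closedBall (by omega) hp
      (N := N) (by simpa using hTN)
    exact ⟨Ω', hΩ', l, p, hm', hp, hT', hP', hle⟩
  -- The ball of radius R₂ admits all rearranged copies, so its minimum is at most that in every
  -- larger ball. Truncation extends the comparison to unbounded competitors.
  set R₂ := max R₁ R₀
  obtain ⟨Ω, hΩR, l, p, hm, hp, hT, hP, hle⟩ := hmin R₂ (le_max_left _ _)
  refine ⟨Ω, l, p, hm, (measure_mono hΩR).trans_lt (hballfin _), hp, hT, hP, ?_⟩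
  intro Ω' hm' hfin' l' p' hp' hT' hP'
  refine le_of_forall_pos_le_add fun ε hε => ?_
  obtain ⟨R, Ω'', hΩ'', hm'', hT'', hP''⟩ := exists_truncation hm' hfin' (hT'.pos hd0 hk hfin').le
    hp' hT' hP' (half_pos hε)
  obtain ⟨Ω₃, hΩ₃, l₃, p₃, hm₃, hp₃, hT₃, hP₃, hle₃⟩ := hunif (max R₁ R) (le_max_left _ _)
  have h1 := hle₃ Ω'' (hΩ''.trans (Metric.closedBall_subset_closedBall (le_max_right _ _))) hm''
    _ _ (by positivity) hT'' hP''
  have h2 := hle Ω₃ (hΩ₃.trans (Metric.closedBall_subset_closedBall (le_max_right _ _))) hm₃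
    _ _ hp₃ hT₃ hP₃
  linarith

/-! ### Scaling back to the constrained problem -/

lemma exists_pow_eq {n : ℕ} (hn : n ≠ 0) {x : ℝ} (hx : 0 < x) : ∃ t > (0 : ℝ), t ^ n = x :=
  ⟨x ^ ((n : ℝ)⁻¹), Real.rpow_pos_of_pos hx _, Real.rpow_inv_natCast_pow hx.le hn⟩

lemma similarity_preimage_preimage {t : ℝ} (ht : 0 < t) (Ω : Set (Space d)) :
    similarity t⁻¹ 0 ⁻¹' (similarity t 0 ⁻¹' Ω) = Ω := by
  ext x
  simp [similarity, smul_inv_smul₀ ht.ne']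

/-- The reverse inequality is the forward one for the inverse dilation. -/
lemma perimeter_similarity (hd : 1 ≤ d) {t : ℝ} (ht : 0 < t) {Ω : Set (Space d)}
    (hΩ : NullMeasurableSet Ω) {p : ℝ} (hp : 0 ≤ p) (hP : perimeter Ω = ENNReal.ofReal p) :
    perimeter (similarity t 0 ⁻¹' Ω) = ENNReal.ofReal ((t ^ (d - 1))⁻¹ * p) := by
  have h1 := perimeter_similarity_le hd ht 0 hΩ hp hP.le
  refine le_antisymm h1 ?_
  have hfin : perimeter (similarity t 0 ⁻¹' Ω) ≠ ⊤ := (h1.trans_lt ENNReal.ofReal_lt_top).ne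
  have h2 := perimeter_similarity_le hd (inv_pos.2 ht) 0
    (hΩ.preimage (quasiMeasurePreserving_similarity ht 0)) ENNReal.toReal_nonneg
    (ENNReal.ofReal_toReal hfin).ge
  rw [similarity_preimage_preimage ht, hP, inv_pow, inv_inv,
    ENNReal.ofReal_le_ofReal_iff (by positivity)] at h2
  refine ENNReal.ofReal_le_of_le_toReal ?_
  rw [inv_mul_le_iff₀ (by positivity)]
  exact h2

lemma volume_preimage_similarity_lt_top {t : ℝ} (ht : 0 < t) {Ω : Set (Space d)}
    (hΩ : NullMeasurableSet Ω) (hfin : volume Ω < ⊤) : volume (similarity t 0 ⁻¹' Ω) < ⊤ := by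
  rw [volume_preimage_similarity ht 0 hΩ]
  exact ENNReal.mul_lt_top ENNReal.ofReal_lt_top hfin

lemma HasTestSpace.volume_ne_zero {k : ℕ} (hk : 1 ≤ k) {Ω : Set (Space d)} {l : ℝ}
    (h : HasTestSpace (gradientPairs Ω) k l) : volume Ω ≠ 0 := by
  intro h0
  obtain ⟨p, hp, hi, -⟩ := h
  refine hi.ne_zero ⟨0, hk⟩ ?_
  rw [Lp.eq_zero_iff_ae_eq_zero]
  filter_upwards [(hp ⟨0, hk⟩).2, measure_eq_zero_iff_ae_notMem.1 h0] with x h1 h2 using h1 h2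

/-- By the isoperimetric inequality zero perimeter means zero volume, which leaves no nonzero test
function. Positivity permits rescaling to a prescribed perimeter. -/
lemma HasTestSpace.perimeter_pos (hd : d ≠ 0) {k : ℕ} (hk : 1 ≤ k) {Ω : Set (Space d)} {l : ℝ}
    (h : HasTestSpace (gradientPairs Ω) k l) (hΩ : NullMeasurableSet Ω) (hfin : volume Ω < ⊤)
    {p : ℝ} (hp : 0 ≤ p) (hP : perimeter Ω ≤ ENNReal.ofReal p) : 0 < p := by
  refine hp.lt_of_ne fun h0 => h.volume_ne_zero hk ?_
  obtain ⟨C, hC, hiso⟩ := exists_isoperimetric hd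
  have h1 := hiso Ω p hΩ hfin hp hP
  rw [← h0, mul_zero] at h1
  exact (measureReal_eq_zero_iff hfin.ne).1 (le_antisymm h1 measureReal_nonneg)

lemma hasTestSpace_of_eigenvalue_le {Ω : Set (Space d)} (hΩ : volume Ω < ⊤)
    {k : ℕ} {l : ℝ} (hl : 0 < l) (h : eigenvalue k Ω ≤ ENNReal.ofReal l) :
    HasTestSpace (gradientPairs Ω) k l := by
  obtain ⟨p, μ, hp⟩ := exists_isEigenSystem_of_eigenvalue_le hΩ hl h
  exact hp.hasTestSpace

/-- Test spaces with bounds 1/(n + 1) would converge to one with bound 0. -/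
lemma eigenvalue_ne_zero (hd : d ≠ 0) {k : ℕ} (hk : 1 ≤ k) {Ω : Set (Space d)}
    (hΩ : volume Ω < ⊤) : eigenvalue k Ω ≠ 0 := by
  intro h0
  have h1 : ∀ n : ℕ, (0 : ℝ) < 1 / ((n : ℝ) + 1) := fun n => by positivity
  choose p μ hp using fun n => exists_isEigenSystem_of_eigenvalue_le (k := k) hΩ (h1 n)
    (by rw [h0]; exact zero_le)
  have h2 := hasTestSpace_of_limit (compactPairs_gradientPairs_self hΩ)
    tendsto_one_div_add_atTop_nhds_zero_nat hp
  exact lt_irrefl _ (h2.pos hd hk hΩ)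

lemma le_of_forall_le_ofReal {a b : ℝ≥0∞}
    (h : ∀ l : ℝ, 0 < l → b ≤ ENNReal.ofReal l → a ≤ ENNReal.ofReal l) : a ≤ b := by
  refine le_of_forall_gt_imp_ge_of_dense fun c hc => ?_
  rcases eq_or_ne c ⊤ with rfl | hc'
  · exact le_top
  · have hc0 : c ≠ 0 := (bot_le.trans_lt hc).ne'
    rw [← ENNReal.ofReal_toReal hc'] at hc ⊢
    exact h _ (ENNReal.toReal_pos hc0 hc') hc.le

/-- A solution with finite eigenvalue exists. -/
lemma exists_isSolution (hd : 2 ≤ d) {k : ℕ} (hk : 1 ≤ k) {c : ℝ} (hc : 0 < c) :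
    ∃ Ω : Set (Space d), IsSolution k c Ω ∧ eigenvalue k Ω < ⊤ := by
  have hd0 : d ≠ 0 := by omega
  have hd1 : 1 ≤ d := by omega
  obtain ⟨Ω, l, p, hm, hfin, hp, hT, hP, hle⟩ := exists_global_min hd hk
  have hPfin : perimeter Ω ≠ ⊤ := (hP.trans_lt ENNReal.ofReal_lt_top).ne
  -- Minimality forces the upper bound p to be the actual perimeter, since the latter could
  -- otherwise replace it.
  have hPeq : perimeter Ω = ENNReal.ofReal p := by
    refine le_antisymm hP (ENNReal.ofReal_le_of_le_toReal ?_)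
    have := hle Ω hm hfin l _ ENNReal.toReal_nonneg hT (ENNReal.ofReal_toReal hPfin).ge
    linarith
  have hp0 := hT.perimeter_pos hd0 hk hm hfin hp hP
  have hl0 := hT.pos hd0 hk hfin
  obtain ⟨t, ht, htp⟩ := exists_pow_eq (n := d - 1) (by omega) (div_pos hp0 hc)
  have hfin' := volume_preimage_similarity_lt_top ht hm hfin
  have hev : eigenvalue k (similarity t 0 ⁻¹' Ω) ≤ ENNReal.ofReal (t ^ 2 * l) :=
    eigenvalue_le_of_hasTestSpace hd0 hfin' (by positivity) (hT.similarity ht 0)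
  refine ⟨similarity t 0 ⁻¹' Ω, ⟨⟨hm.preimage (quasiMeasurePreserving_similarity ht 0), ?_, hfin'⟩,
    ?_⟩, hev.trans_lt ENNReal.ofReal_lt_top⟩
  · rw [perimeter_similarity hd1 ht hm hp hPeq, htp]
    congr 1
    field_simp
  · rintro Ω' ⟨hm', hP', hf'⟩
    refine le_of_forall_le_ofReal fun l' hl' hlE => ?_
    have hT' := hasTestSpace_of_eigenvalue_le hf' hl' hlE
    have ht' : 0 < t⁻¹ := inv_pos.2 ht
    -- A competitor of perimeter c is scaled back to perimeter p, so the perimeter terms cancel in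
    -- the penalised comparison.
    have h1 := hle (similarity t⁻¹ 0 ⁻¹' Ω')
      (hm'.preimage (quasiMeasurePreserving_similarity ht' 0))
      (volume_preimage_similarity_lt_top ht' hm' hf') _ p hp (hT'.similarity ht' 0) (by
        refine (perimeter_similarity_le hd1 ht' 0 hm' hc.le hP'.le).trans (le_of_eq ?_)
        rw [inv_pow, inv_inv, htp, div_mul_cancel₀ _ hc.ne'])
    refine hev.trans (ENNReal.ofReal_le_ofReal ?_)
    have h2 : l ≤ (t⁻¹) ^ 2 * l' := by linarith
    calc t ^ 2 * l ≤ t ^ 2 * ((t⁻¹) ^ 2 * l') := by gcongr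
      _ = l' := by field_simp

/-- The function l/σ² + (2l/n)σⁿ is minimal at σ = 1: both terms lie above their tangents there,
whose slopes -2l and 2l cancel. Bernoulli's inequality gives the second tangent, and (σ - 1)²(2σ +
1) ≥ 0 the first. -/
lemma add_le_of_le_sq_mul {n : ℕ} (hn : n ≠ 0) {l l' σ : ℝ} (hl : 0 ≤ l) (hσ : 0 < σ)
    (h : l ≤ σ ^ 2 * l') : l + 2 * l / n ≤ l' + 2 * l / n * σ ^ n := by
  have hn0 : (0 : ℝ) < n := by exact_mod_cast Nat.pos_of_ne_zero hn
  have h1 : 1 + n * (σ - 1) ≤ σ ^ n := by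
    have := one_add_mul_le_pow (a := σ - 1) (by linarith) n
    rwa [add_sub_cancel] at this
  have h2 : 2 * l / n * (1 + n * (σ - 1)) ≤ 2 * l / n * σ ^ n := by gcongr
  have h3 : 2 * l / n * (1 + n * (σ - 1)) = 2 * l / n + 2 * l * (σ - 1) := by field_simp
  have h4 : l + 2 * l * (1 - σ) ≤ l' := by
    have h5 : 0 ≤ l * ((σ - 1) ^ 2 * (2 * σ + 1)) := by positivity
    have h6 : σ ^ 2 * (l + 2 * l * (1 - σ)) ≤ σ ^ 2 * l' := by
      have h7 : σ ^ 2 * (l + 2 * l * (1 - σ)) = l - l * ((σ - 1) ^ 2 * (2 * σ + 1)) := by ring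
      linarith
    exact le_of_mul_le_mul_left h6 (by positivity)
  linarith

/-- Solutions of the constrained problem minimise a penalised functional. -/
lemma IsSolution.isInnerMin (hd : 2 ≤ d) {k : ℕ} (hk : 1 ≤ k) {c : ℝ} (hc : 0 < c)
    {Ω : Set (Space d)} (h : IsSolution k c Ω) (hev : eigenvalue k Ω < ⊤) :
    ∃ β > 0, ∃ l, IsInnerMin β k Ω l c := by
  have hd0 : d ≠ 0 := by omega
  have hd1 : 1 ≤ d := by omega
  obtain ⟨⟨hm, hP, hfin⟩, hmin⟩ := h
  set l : ℝ := (eigenvalue k Ω).toReal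
  have hl : 0 < l := ENNReal.toReal_pos (eigenvalue_ne_zero hd0 hk hfin) hev.ne
  have hT := hasTestSpace_of_eigenvalue_le hfin hl (ENNReal.ofReal_toReal hev.ne).ge
  have hn : 0 < ((d - 1 : ℕ) : ℝ) := by exact_mod_cast (by omega : 0 < d - 1)
  -- With this β the penalty βP of a set of perimeter c σ^(d-1) is (2l/(d - 1)) σ^(d-1), as required
  -- by `add_le_of_le_sq_mul`.
  refine ⟨2 * l / ((d - 1 : ℕ) : ℝ) / c, by positivity, l, hm, hfin, hT, hl.le, hc.le, hP.le, ?_⟩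
  intro Ω' hΩ' hm' l' p' hp' hT' hP'
  have hfin' : volume Ω' < ⊤ := (measure_mono hΩ').trans_lt hfin
  have hPfin : perimeter Ω' ≠ ⊤ := (hP'.trans_lt ENNReal.ofReal_lt_top).ne
  have hPeq := (ENNReal.ofReal_toReal hPfin).symm
  set q := (perimeter Ω').toReal
  have hq0 : 0 < q := hT'.perimeter_pos hd0 hk hm' hfin' ENNReal.toReal_nonneg hPeq.le
  have hqp : q ≤ p' := ENNReal.toReal_le_of_le_ofReal hp' hP'
  obtain ⟨σ, hσ, hσq⟩ := exists_pow_eq (n := d - 1) (by omega) (div_pos hq0 hc)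
  have hfin'' := volume_preimage_similarity_lt_top hσ hm' hfin'
  have hl' := hT'.pos hd0 hk hfin'
  have hadm : similarity σ 0 ⁻¹' Ω' ∈ Admissible d c := by
    refine ⟨hm'.preimage (quasiMeasurePreserving_similarity hσ 0), ?_, hfin''⟩
    rw [perimeter_similarity hd1 hσ hm' hq0.le hPeq, hσq]
    congr 1
    field_simp
  have h1 : l ≤ σ ^ 2 * l' :=
    ENNReal.toReal_le_of_le_ofReal (by positivity) ((hmin hadm).trans
      (eigenvalue_le_of_hasTestSpace hd0 hfin'' (by positivity) (hT'.similarity hσ 0)))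
  have h2 := add_le_of_le_sq_mul (n := d - 1) (by omega) hl.le hσ h1
  have h3 : 2 * l / ((d - 1 : ℕ) : ℝ) / c * c = 2 * l / ((d - 1 : ℕ) : ℝ) := by field_simp
  have h4 : 2 * l / ((d - 1 : ℕ) : ℝ) * σ ^ (d - 1) = 2 * l / ((d - 1 : ℕ) : ℝ) / c * q := by
    rw [hσq]; field_simp
  have h5 : 2 * l / ((d - 1 : ℕ) : ℝ) / c * q ≤ 2 * l / ((d - 1 : ℕ) : ℝ) / c * p' := by gcongr
  rw [h3]
  linarith

/-- The density bound and finite volume allow only finitely many covering balls. -/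
lemma IsInnerMin.essentiallyBounded (hd : 2 ≤ d) {β : ℝ} (hβ : 0 < β) {k : ℕ} {Ω : Set (Space d)}
    {l p : ℝ} (h : IsInnerMin β k Ω l p) : EssentiallyBounded Ω := by
  obtain ⟨τ, hτ, hdens⟩ := exists_density hd hβ h.nonneg_left k
  obtain ⟨T, -, hT⟩ := exists_finset_cover h.nullMeasurableSet hτ
    (N := ⌈volume.real Ω / τ⌉₊) (by
      rw [← ENNReal.ofReal_toReal h.volume_lt_top.ne]
      refine ENNReal.ofReal_le_ofReal ?_
      rw [← div_le_iff₀ hτ]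
      exact Nat.le_ceil _) (hdens Ω l p h le_rfl)
  obtain ⟨M, hM⟩ := (T.finite_toSet.image norm).bddAbove
  refine ⟨M + 7, measure_eq_zero_iff_ae_notMem.2 ?_⟩
  filter_upwards [hT] with x hx hxΩ
  obtain ⟨y, hy, hxy⟩ := hx hxΩ.1
  refine hxΩ.2 ?_
  rw [mem_ball_zero_iff]
  have h1 : ‖y‖ ≤ M := hM ⟨y, hy, rfl⟩
  have h2 := norm_sub_norm_le x y
  linarith

end SpectralPerimeter

/-! ### The main theorem -/

theorem theorem3 (d : ℕ) (hd : 2 ≤ d) (k : ℕ) (hk : 1 ≤ k) (c : ℝ) (hc : 0 < c) :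
    (∃ Ω : Set (SpectralPerimeter.Space d), SpectralPerimeter.IsSolution k c Ω) ∧
      ∀ Ω : Set (SpectralPerimeter.Space d), SpectralPerimeter.IsSolution k c Ω →
        SpectralPerimeter.EssentiallyBounded Ω := by
  obtain ⟨Ω₀, h₀, hev⟩ := SpectralPerimeter.exists_isSolution hd hk hc
  refine ⟨⟨Ω₀, h₀⟩, fun Ω h => ?_⟩
  -- An arbitrary solution has finite eigenvalue by comparison with the one constructed, so the
  -- penalised argument applies to it.
  obtain ⟨β, hβ, l, hmin⟩ := h.isInnerMin hd hk hc ((h.2 h₀.1).trans_lt hev)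
  exact hmin.essentiallyBounded hd hβ
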